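/- Let $f:\mathbb R\to\mathbb R$ be $C^1$ and strictly increasing, let $\kappa,u_a\in L^\infty_{loc}([0,\infty))$ depend only on $t$, and consider the system $$v_t+(vf(u))_x=0,\qquad (vu)_t+(vuf(u))_x=\kappa(t)\,(u_a(t)-u)\,v ,\qquad x\in\mathbb R,\ t>0 .$$ Let $R,u_0\in\mathbb R$, $v_0>0$, let $v:[R,\infty)\to(0,\infty)$ be bounded and let $u:[R,\infty)\to\mathbb R$ be continuous and bounded with finitely many extrema (i.e. it changes its monotonicity finitely often). The initial data are $(v_0,u_0)$ for $x\le R$ and $(v(x),u(x))$ for $x>R$. Let $C_1,C_2\ge1$, $\alpha\in(0,1)$, $\rho(\varepsilon)\to0$ as $\varepsilon\to0^+$, $\varepsilon_0>0$, and for every $\varepsilon\in(0,\varepsilon_0)$ let $R=Y_0<Y_1<\cdots$ (depending on $\varepsilon$) be a partition of $[R,\infty)$ with $C_1\varepsilon^\alpha<Y_{i+1}-Y_i<C_2\rho(\varepsilon)$ for all $i\ge0$. Put $(v_i,u_i)=(v(Y_i),u(Y_i))$ for $i\ge1$ and $$U_i(t)=e^{-\int_0^t\kappa}\Big(\int_0^t\kappa(s)u_a(s)e^{\int_0^s\kappa}\,ds+u_i\Big),\qquad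 i\ge0 .$$ Then for every $\varepsilon\in(0,\varepsilon_0)$ there is a function $U^\varepsilon=(v^\varepsilon,u^\varepsilon)$ on $\mathbb R\times[0,\infty)$ with the following properties. (a) $U^\varepsilon$ is measurable, $v^\varepsilon$ is locally integrable, $u^\varepsilon$ is bounded on bounded time intervals, and $U^\varepsilon(\cdot,0)$ equals $(v_0,u_0)$ on $(-\infty,R]$ and $(v_{i+1},u_{i+1})$ on $(Y_i,Y_{i+1}]$. (b) $U^\varepsilon$ consists of elementary waves and a locally finite family of shadow waves. A shadow wave lives on a time interval $(T,S)$, $0\le T<S\le\infty$, in a strip $c(t)-a(t)<x<c(t)+b(t)$ with $a,b>0$, in which $U^\varepsilon=(v_*(t),u_*(t))$ with $v_*>0$ and $\dot c(t)=f(u_*(t))$; here $c,a,b$ are continuous up to the end points and $v_*,u_*$ are continuous. The closed strips of different shadow waves are disjoint at common times. A shadow wave starts either at $t=0$, with width $0$, at a point $Y_i$ with $u_i>u_{i+1}$, or at $T>0$ at the point where another shadow wave ends; every shadow wave that ends at a finite time is continued by one that starts at the same point. Off the closed strips $U^\varepsilon$ is locally one of the states $(v_i,U_i(t))$, or, for some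 $i$ with $u_i\le u_{i+1}$, the Riemann solution equal to $(v_i,U_i(t))$ for $x\le Y_i+\int_0^tf(U_i)$, to a vacuum $(0,z_i(x,t))$ for $Y_i+\int_0^tf(U_i)<x<Y_i+\int_0^tf(U_{i+1})$, and to $(v_{i+1},U_{i+1}(t))$ to the right of it, where $z_i$ is continuous for $t>0$ and equals $U_i$, $U_{i+1}$ on the two contact discontinuities. For every $T$ there is $C$, independent of $\varepsilon$ and of the shadow wave, such that $a(t),b(t)\le C\varepsilon$ and $(a(t)+b(t))v_*(t)\le C$ for $t\le T$. (c) (Admissibility, overcompressibility) For every shadow wave and every $t$ in its life time, $U^\varepsilon(\cdot,t)$ has one-sided limits at the left and the right edge of the strip, taken from outside, and their velocities $u_l,u_r$ satisfy $f(u_r)<f(u_*(t))<f(u_l)$. (d) For every $\varphi\in C_c^\infty(\mathbb R\times[0,\infty))$, as $\varepsilon\to0^+$, $$\int_0^\infty\!\!\int_{\mathbb R}\big(v^\varepsilon\varphi_t+v^\varepsilon f(u^\varepsilon)\varphi_x\big)\,dx\,dt+\int_{\mathbb R}v^\varepsilon(x,0)\varphi(x,0)\,dx\to0,$$ $$\int_0^\infty\!\!\int_{\mathbb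 R}\big(v^\varepsilon u^\varepsilon\varphi_t+v^\varepsilon u^\varepsilon f(u^\varepsilon)\varphi_x+\kappa(t)(u_a(t)-u^\varepsilon)v^\varepsilon\varphi\big)\,dx\,dt+\int_{\mathbb R}(v^\varepsilon u^\varepsilon)(x,0)\varphi(x,0)\,dx\to0 .$$ -/

import Mathlib

open Set Filter Topology MeasureTheory
open scoped ContDiff

noncomputable section

namespace DropletModel

/-- The solution `U(t)` of `U' = κ(t) (u_a(t) - U)`, `U(0) = w`: the velocity carried along a
characteristic that starts with velocity `w`. -/
def velocity (κ ua : ℝ → ℝ) (w t : ℝ) : ℝ :=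
  Real.exp (-∫ s in (0 : ℝ)..t, κ s) *
    ((∫ s in (0 : ℝ)..t, κ s * ua s * Real.exp (∫ r in (0 : ℝ)..s, κ r)) + w)

/-- The position at time `t` of the characteristic that starts at `y` with velocity `w`. -/
def charLine (f κ ua : ℝ → ℝ) (y w t : ℝ) : ℝ :=
  y + ∫ s in (0 : ℝ)..t, f (velocity κ ua w s)

/-- The states of the piecewise constant approximation of the initial data on a partition
`Y 0 < Y 1 < …`: state `0` is taken on `(-∞, Y 0]`, state `i + 1` on `(Y i, Y (i + 1)]`. -/
def sampledState (v₀ u₀ : ℝ) (v u : ℝ → ℝ) (Y : ℕ → ℝ) : ℕ → ℝ × ℝ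
  | 0 => (v₀, u₀)
  | i + 1 => (v (Y (i + 1)), u (Y (i + 1)))

/-- `u` changes its monotonicity on `[R, ∞)` only finitely often (an interval on which `u` is
constant at an extremal value counts once): `u` is monotone on every interval
whose interior avoids a suitable finite set. -/
def HasFinitelyManyExtrema (u : ℝ → ℝ) (R : ℝ) : Prop :=
  ∃ S : Finset ℝ, ∀ a b : ℝ, R ≤ a → (∀ x ∈ S, x ∉ Ioo a b) →
    MonotoneOn u (Icc a b) ∨ AntitoneOn u (Icc a b)

/-- The solution of the Riemann problem at `y` with left state `l` and right state `r`,
`l.2 ≤ r.2`: two contact discontinuities and, between them, a vacuum with velocity `z`.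
Points of the plane are written `p = (x, t)`, states `(v, u)`. -/
def elementaryWave (f κ ua : ℝ → ℝ) (y : ℝ) (l r : ℝ × ℝ) (z : ℝ × ℝ → ℝ) (p : ℝ × ℝ) : ℝ × ℝ :=
  if p.1 ≤ charLine f κ ua y l.2 p.2 then (l.1, velocity κ ua l.2 p.2)
  else if p.1 < charLine f κ ua y r.2 p.2 then (0, z p)
  else (r.1, velocity κ ua r.2 p.2)

/-- The velocity `z` in the vacuum is continuous for positive times and agrees with the adjacent
velocities on the two contact discontinuities. -/
def IsVacuumVelocity (f κ ua : ℝ → ℝ) (y : ℝ) (l r : ℝ × ℝ) (z : ℝ × ℝ → ℝ) : Prop :=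
  ContinuousOn z {p | 0 < p.2 ∧ charLine f κ ua y l.2 p.2 ≤ p.1 ∧
    p.1 ≤ charLine f κ ua y r.2 p.2} ∧
  ∀ t : ℝ, 0 < t →
    z (charLine f κ ua y l.2 t, t) = velocity κ ua l.2 t ∧
    z (charLine f κ ua y r.2 t, t) = velocity κ ua r.2 t

/-- A single shadow wave: it lives from time `birth` to time `death` (possibly `⊤`) in the strip
`center t - left t < x < center t + right t`, in which the state is `(mass t, vel t)`. -/
structure ShadowWave where
  birth : ℝ
  death : EReal
  center : ℝ → ℝ
  left : ℝ → ℝ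
  right : ℝ → ℝ
  mass : ℝ → ℝ
  vel : ℝ → ℝ
  birth_nonneg : 0 ≤ birth
  birth_lt_death : (birth : EReal) < death
  center_cont : ContinuousOn center {t | birth ≤ t ∧ (t : EReal) ≤ death}
  left_cont : ContinuousOn left {t | birth ≤ t ∧ (t : EReal) ≤ death}
  right_cont : ContinuousOn right {t | birth ≤ t ∧ (t : EReal) ≤ death}
  mass_cont : ContinuousOn mass {t | birth < t ∧ (t : EReal) < death}
  vel_cont : ContinuousOn vel {t | birth < t ∧ (t : EReal) < death}
  left_pos : ∀ t : ℝ, birth < t → (t : EReal) < death → 0 < left t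
  right_pos : ∀ t : ℝ, birth < t → (t : EReal) < death → 0 < right t
  mass_pos : ∀ t : ℝ, birth < t → (t : EReal) < death → 0 < mass t

/-- The open life time of a shadow wave. -/
def ShadowWave.Alive (w : ShadowWave) (t : ℝ) : Prop :=
  w.birth < t ∧ (t : EReal) < w.death

/-- The closed strip of a shadow wave, including its end points in time. -/
def ShadowWave.Covers (w : ShadowWave) (p : ℝ × ℝ) : Prop :=
  w.birth ≤ p.2 ∧ (p.2 : EReal) ≤ w.death ∧
    w.center p.2 - w.left p.2 ≤ p.1 ∧ p.1 ≤ w.center p.2 + w.right p.2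

/-- `U = (v, u)` is made up, on `ℝ × [0, ∞)`, of the shadow waves in `W` and of elementary waves:
it starts from the piecewise constant data with states `st` on the partition `Y`; shadow waves
start at time `0` at the points of the partition where the velocity jumps down, or later at a
point where a shadow wave ends because of an interaction; a shadow wave that ends is replaced
by one that starts at the same point; off the shadow waves, `U` is locally one of
the transported states, or the contact discontinuities and the vacuum of a Riemann problem in
which the velocity does not jump down. -/
structure IsShadowWaveTracking (f κ ua : ℝ → ℝ) (Y : ℕ → ℝ) (st : ℕ → ℝ × ℝ)
    (W : Set ShadowWave) (U : ℝ × ℝ → ℝ × ℝ) : Prop where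
  initial_left : ∀ x : ℝ, x ≤ Y 0 → U (x, 0) = st 0
  initial : ∀ (i : ℕ) (x : ℝ), x ∈ Ioc (Y i) (Y (i + 1)) → U (x, 0) = st (i + 1)
  locally_finite : ∀ a b T : ℝ,
    {w ∈ W | ∃ p ∈ Icc a b ×ˢ Icc 0 T, w.Covers p}.Finite
  disjoint : ∀ w ∈ W, ∀ w' ∈ W, w ≠ w' → ∀ t : ℝ, w.Alive t → w'.Alive t →
    ∀ x : ℝ, ¬ (w.Covers (x, t) ∧ w'.Covers (x, t))
  origin : ∀ w ∈ W,
    (w.birth = 0 ∧ w.left 0 = 0 ∧ w.right 0 = 0 ∧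
      ∃ i : ℕ, w.center 0 = Y i ∧ (st (i + 1)).2 < (st i).2) ∨
    (0 < w.birth ∧ ∃ w' ∈ W, w'.death = (w.birth : EReal) ∧
      w'.center w.birth = w.center w.birth)
  continues : ∀ w ∈ W, ∀ s : ℝ, w.death = (s : EReal) →
    ∃ w' ∈ W, w'.birth = s ∧ w'.center s = w.center s
  inner : ∀ w ∈ W, ∀ t : ℝ, w.Alive t →
    ∀ x ∈ Ioo (w.center t - w.left t) (w.center t + w.right t), U (x, t) = (w.mass t, w.vel t)
  speed : ∀ w ∈ W, ∀ t : ℝ, w.Alive t → HasDerivAt w.center (f (w.vel t)) t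
  outer : ∃ z : ℕ → ℝ × ℝ → ℝ,
    (∀ i : ℕ, (st i).2 ≤ (st (i + 1)).2 →
      IsVacuumVelocity f κ ua (Y i) (st i) (st (i + 1)) (z i)) ∧
    ∀ p : ℝ × ℝ, 0 ≤ p.2 → (∀ w ∈ W, ¬ w.Covers p) →
      (∃ i : ℕ, ∀ᶠ q in 𝓝[{q : ℝ × ℝ | 0 ≤ q.2}] p,
        U q = ((st i).1, velocity κ ua (st i).2 q.2)) ∨
      (∃ i : ℕ, (st i).2 ≤ (st (i + 1)).2 ∧ ∀ᶠ q in 𝓝[{q : ℝ × ℝ | 0 ≤ q.2}] p,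
        U q = elementaryWave f κ ua (Y i) (st i) (st (i + 1)) (z i) q)

/-- Admissibility (overcompressibility): the speed `f (vel t)` of every shadow wave lies
strictly between the characteristic speeds of the states `r` and `l` adjacent to its strip, so
that characteristics run into it from both sides. -/
def IsOvercompressive (f : ℝ → ℝ) (W : Set ShadowWave) (U : ℝ × ℝ → ℝ × ℝ) : Prop :=
  ∀ w ∈ W, ∀ t : ℝ, w.Alive t → ∃ l r : ℝ × ℝ,
    Tendsto (fun x => U (x, t)) (𝓝[<] (w.center t - w.left t)) (𝓝 l) ∧
    Tendsto (fun x => U (x, t)) (𝓝[>] (w.center t + w.right t)) (𝓝 r) ∧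
    f r.2 < f (w.vel t) ∧ f (w.vel t) < f l.2

/-- `v` is locally integrable and `u` is measurable and bounded on bounded time intervals, so that
all integrals in the weak form of the system converge. -/
def IsLocallyRegular (U : ℝ × ℝ → ℝ × ℝ) : Prop :=
  Measurable U ∧
  LocallyIntegrableOn (fun p => (U p).1) {p : ℝ × ℝ | 0 ≤ p.2} ∧
  ∀ T : ℝ, ∃ M : ℝ, ∀ x : ℝ, ∀ t ∈ Icc 0 T, |(U (x, t)).2| ≤ M

/-- `-⟨v_t + (v f(u))_x, φ⟩` on `ℝ × [0, ∞)`; here `fderiv ℝ φ p (0, 1)` is `φ_t` and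
`fderiv ℝ φ p (1, 0)` is `φ_x`. -/
def massDefect (f : ℝ → ℝ) (U : ℝ × ℝ → ℝ × ℝ) (φ : ℝ × ℝ → ℝ) : ℝ :=
  (∫ p in {p : ℝ × ℝ | 0 ≤ p.2},
    ((U p).1 * fderiv ℝ φ p (0, 1) + (U p).1 * f (U p).2 * fderiv ℝ φ p (1, 0))) +
  ∫ x : ℝ, (U (x, 0)).1 * φ (x, 0)

/-- `-⟨(v u)_t + (v u f(u))_x - κ(t) (u_a(t) - u) v, φ⟩` on `ℝ × [0, ∞)`. -/
def momentumDefect (f κ ua : ℝ → ℝ) (U : ℝ × ℝ → ℝ × ℝ) (φ : ℝ × ℝ → ℝ) : ℝ :=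
  (∫ p in {p : ℝ × ℝ | 0 ≤ p.2},
    ((U p).1 * (U p).2 * fderiv ℝ φ p (0, 1) +
      (U p).1 * (U p).2 * f (U p).2 * fderiv ℝ φ p (1, 0) +
      κ p.2 * (ua p.2 - (U p).2) * (U p).1 * φ p)) +
  ∫ x : ℝ, (U (x, 0)).1 * (U (x, 0)).2 * φ (x, 0)

end DropletModel

end

/-!
The velocity on a characteristic with initial velocity `w` is `V w t = P t + w * E t` with `E > 0`,
whatever the position of the characteristic. The initial velocity, or *label*, is therefore
constant along characteristics, and a point with label `w` moves with the speed
`G w t = f (V w t)`, which is strictly increasing in `w`. In terms of labels the problem is one of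
pressureless gas dynamics without a source, but with a nonlinear speed.

A shadow wave is a concentrated mass that moves along a curve. Between two update times it keeps
a constant label; at the update times, which include all encounters of waves in the relevant
region, it gets a new label. The ideal label is the average of the labels of the mass it has
absorbed, which conserves momentum. Because the speed is nonlinear, this average need not be
overcompressive. So the new label is taken from the interval of admissible labels (`LAdm`, `RAdm`;
this interval never becomes empty, because admissibility is preserved by the motion, `adv_adm`, and
by merging, `valid_adv`) as close to the average as possible (`NearMean`). If the average is not
admissible, then the label is essentially that of the adjacent state, and the mass absorbed next
does not increase the momentum defect. Hence the defect grows with the number of mergers only, and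
not with the number of updates: it is as small as the time between two updates
(`dev_step`, `Accurate.abs_dev_le`). For each `ε` the update times can be made as dense as
necessary, since finitely many waves reach a bounded region.

Each piece of a wave between consecutive events is given a thin strip whose half width vanishes at
the events (`IsSeg.exists_width`), and the mass is spread evenly over it (`wave`). The strip is so
thin that it stays away from the other waves and from the characteristics that decide about
admissibility; this gives overcompressibility and the structure of the solution outside the strips
(`isOvercompressive_field`, `isShadowWaveTracking_field`).

For the weak form one follows the mass: the mass from `y` is at `pos t y` at time `t`, on its
characteristic or in the wave that has absorbed it. If it keeps its own label as the measure of the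
momentum it carries, then mass and momentum (both a `Weight`) satisfy the weak form exactly, by the
fundamental theorem of calculus (`integral_rate`). In the approximate solution absorbed mass has the
label of its wave, and it is spread over a strip. For each wave this costs an error proportional to
its momentum defect and to the width of its strip (`abs_slice_le`, `abs_defect_le`). The
parameters are chosen in `exists_accurate` such that the sum of these errors is of order `ε`.
-/

noncomputable section

namespace DropletModel

/-! ### Piecewise constant data and their characteristics -/

/-- Piecewise constant initial data in label form. A characteristic is identified by its initial
velocity `w` (its *label*), which it keeps for ever; at time `t` a point with label `w` moves with
speed `G w t`. State `i` has label `w i` and density `v i`; `Y i` is the jump between the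
states `i` and `i + 1`. -/
structure StepData where
  G : ℝ → ℝ → ℝ
  cont : Continuous fun p : ℝ × ℝ => G p.1 p.2
  mono : ∀ t, StrictMono fun w => G w t
  w : ℕ → ℝ
  Wb : ℝ
  w_le : ∀ i, |w i| ≤ Wb
  v : ℕ → ℝ
  v_pos : ∀ i, 0 < v i
  Vb : ℝ
  v_le : ∀ i, v i ≤ Vb
  Y : ℕ → ℝ
  gap : ℝ
  gap_pos : 0 < gap
  Y_gap : ∀ i, Y i + gap ≤ Y (i + 1)

/-- The largest speed on `[0, T]` of a characteristic whose label is at most `B` in absolute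
value. -/
def speedBound (G : ℝ → ℝ → ℝ) (B T : ℝ) : ℝ :=
  sSup ((fun p : ℝ × ℝ => |G p.1 p.2|) '' (Icc (-B) B ×ˢ Icc 0 T))

theorem speedBound_nonneg (G : ℝ → ℝ → ℝ) (B T : ℝ) : 0 ≤ speedBound G B T :=
  Real.sSup_nonneg (by rintro _ ⟨p, -, rfl⟩; exact abs_nonneg _)

namespace StepData

variable (d : StepData)

/-- The displacement up to time `t` of a characteristic with label `w`. -/
def Phi (w t : ℝ) : ℝ := ∫ s in (0 : ℝ)..t, d.G w s

/-- The velocity jumps down at `Y p`, so that a shadow wave starts there. -/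
def D (p : ℕ) : Prop := d.w (p + 1) < d.w p

/-- The bound for the speeds of all waves and characteristics up to time `T`. -/
def L (T : ℝ) : ℝ := speedBound d.G d.Wb T

theorem L_nonneg (T : ℝ) : 0 ≤ d.L T := speedBound_nonneg _ _ _

theorem Wb_nonneg : 0 ≤ d.Wb := (abs_nonneg _).trans (d.w_le 0)

theorem Vb_pos : 0 < d.Vb := (d.v_pos 0).trans_le (d.v_le 0)

theorem abs_G_le {T w t : ℝ} (hw : |w| ≤ d.Wb) (ht : t ∈ Icc 0 T) : |d.G w t| ≤ d.L T := by
  have hK : IsCompact (Icc (-d.Wb) d.Wb ×ˢ Icc (0 : ℝ) T) := isCompact_Icc.prod isCompact_Icc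
  exact le_csSup (hK.image (continuous_abs.comp d.cont)).bddAbove
    ⟨(w, t), ⟨abs_le.1 hw, ht⟩, rfl⟩

theorem continuous_G (w : ℝ) : Continuous (d.G w) :=
  d.cont.comp (continuous_const.prodMk continuous_id)

theorem Phi_zero (w : ℝ) : d.Phi w 0 = 0 := by simp [Phi]

theorem continuous_Phi : Continuous fun p : ℝ × ℝ => d.Phi p.1 p.2 :=
  intervalIntegral.continuous_parametric_intervalIntegral_of_continuous
    (f := fun (p : ℝ × ℝ) s => d.G p.1 s)
    (d.cont.comp ((continuous_fst.comp continuous_fst).prodMk continuous_snd)) continuous_snd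

theorem continuous_Phi_right (w : ℝ) : Continuous (d.Phi w) :=
  d.continuous_Phi.comp (continuous_const.prodMk continuous_id)

theorem continuous_Phi_left (t : ℝ) : Continuous fun w => d.Phi w t :=
  d.continuous_Phi.comp (continuous_id.prodMk continuous_const)

theorem hasDerivAt_Phi (w t : ℝ) : HasDerivAt (d.Phi w) (d.G w t) t :=
  intervalIntegral.integral_hasDerivAt_right ((d.continuous_G w).intervalIntegrable _ _)
    ((d.continuous_G w).stronglyMeasurableAtFilter _ _) (d.continuous_G w).continuousAt

theorem Phi_sub (w s t : ℝ) : d.Phi w t - d.Phi w s = ∫ r in s..t, d.G w r :=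
  intervalIntegral.integral_interval_sub_left ((d.continuous_G w).intervalIntegrable _ _)
    ((d.continuous_G w).intervalIntegrable _ _)

theorem Phi_sub_lt {w w' s t : ℝ} (h : w < w') (hst : s < t) :
    d.Phi w t - d.Phi w s < d.Phi w' t - d.Phi w' s := by
  rw [Phi_sub, Phi_sub]
  exact intervalIntegral.integral_lt_integral_of_continuousOn_of_le_of_exists_lt hst
    (d.continuous_G w).continuousOn (d.continuous_G w').continuousOn
    (fun r _ => (d.mono r h).le) ⟨s, ⟨le_rfl, hst.le⟩, d.mono s h⟩

theorem Phi_sub_le {w w' s t : ℝ} (h : w ≤ w') (hst : s ≤ t) :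
    d.Phi w t - d.Phi w s ≤ d.Phi w' t - d.Phi w' s := by
  rcases h.eq_or_lt with rfl | h
  · exact le_rfl
  rcases hst.eq_or_lt with rfl | hst
  · simp
  exact (d.Phi_sub_lt h hst).le

theorem Phi_mono {w w' t : ℝ} (h : w ≤ w') (ht : 0 ≤ t) : d.Phi w t ≤ d.Phi w' t := by
  simpa [Phi_zero] using d.Phi_sub_le h ht

theorem Phi_lt {w w' t : ℝ} (h : w < w') (ht : 0 < t) : d.Phi w t < d.Phi w' t := by
  simpa [Phi_zero] using d.Phi_sub_lt h ht

theorem abs_Phi_sub_le {T w s t : ℝ} (hw : |w| ≤ d.Wb) (hs : 0 ≤ s) (hst : s ≤ t) (ht : t ≤ T) :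
    |d.Phi w t - d.Phi w s| ≤ d.L T * (t - s) := by
  rw [Phi_sub, ← Real.norm_eq_abs, ← abs_of_nonneg (sub_nonneg.2 hst)]
  refine intervalIntegral.norm_integral_le_of_norm_le_const fun r hr => ?_
  rw [uIoc_of_le hst] at hr
  exact d.abs_G_le hw ⟨hs.trans hr.1.le, hr.2.trans ht⟩

theorem Y_lt_succ (i : ℕ) : d.Y i < d.Y (i + 1) := by
  linarith [d.Y_gap i, d.gap_pos]

theorem Y_strictMono : StrictMono d.Y := strictMono_nat_of_lt_succ d.Y_lt_succ

theorem Y_ge (i : ℕ) : d.Y 0 + i * d.gap ≤ d.Y i := by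
  induction i with
  | zero => simp
  | succ i ih => push_cast; linarith [d.Y_gap i]

theorem Y_tendsto : Tendsto d.Y atTop atTop := by
  refine tendsto_atTop_mono d.Y_ge ?_
  exact tendsto_atTop_add_const_left _ _
    (tendsto_natCast_atTop_atTop.atTop_mul_const d.gap_pos)

theorem exists_Y_gt (x : ℝ) : ∃ N, ∀ i, N ≤ i → x < d.Y i := by
  obtain ⟨N, hN⟩ := (d.Y_tendsto.eventually_gt_atTop x).exists_forall_of_atTop
  exact ⟨N, hN⟩

theorem exists_le_Y (x : ℝ) : ∃ i, x ≤ d.Y i := by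
  obtain ⟨N, hN⟩ := d.exists_Y_gt x
  exact ⟨N, (hN N le_rfl).le⟩

theorem w_mono_of_not_D {i j : ℕ} (hij : i ≤ j) (h : ∀ q, i ≤ q → q < j → ¬ d.D q) :
    d.w i ≤ d.w j := by
  induction j, hij using Nat.le_induction with
  | base => exact le_rfl
  | succ j hj ih =>
    exact (ih fun q hq hqj => h q hq (by omega)).trans (not_lt.1 (h j hj (by omega)))

open Classical in
/-- The index of the state in which the point `y` lies initially. -/
def idx (y : ℝ) : ℕ := Nat.find (d.exists_le_Y y)

theorem le_Y_idx (y : ℝ) : y ≤ d.Y (d.idx y) := by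
  classical exact Nat.find_spec (d.exists_le_Y y)

theorem idx_le_iff {y : ℝ} {j : ℕ} : d.idx y ≤ j ↔ y ≤ d.Y j := by
  classical
  exact ⟨fun h => (d.le_Y_idx y).trans (d.Y_strictMono.monotone h), fun h => Nat.find_min' _ h⟩

theorem lt_idx_iff {y : ℝ} {j : ℕ} : j < d.idx y ↔ d.Y j < y := by
  rw [← not_le, idx_le_iff, not_le]

theorem Y_lt_of_lt_idx {y : ℝ} {j : ℕ} (h : j < d.idx y) : d.Y j < y := d.lt_idx_iff.1 h

theorem idx_mono {y y' : ℝ} (h : y ≤ y') : d.idx y ≤ d.idx y' :=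
  d.idx_le_iff.2 (h.trans (d.le_Y_idx y'))

theorem idx_eq_iff {y : ℝ} {i : ℕ} : d.idx y = i ↔ y ≤ d.Y i ∧ ∀ j, j < i → d.Y j < y := by
  constructor
  · rintro rfl
    exact ⟨d.le_Y_idx y, fun j hj => d.Y_lt_of_lt_idx hj⟩
  · rintro ⟨h1, h2⟩
    refine le_antisymm (d.idx_le_iff.2 h1) (not_lt.1 fun h => ?_)
    exact absurd (d.le_Y_idx y) (not_le.2 (h2 _ h))

theorem measurable_idx : Measurable d.idx :=
  measurable_to_countable' fun i => by
    have : d.idx ⁻¹' {i} = Iic (d.Y i) ∩ ⋂ j : ℕ, {y | j < i → d.Y j < y} := by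
      ext y
      simp [idx_eq_iff]
    rw [this]
    refine (measurableSet_Iic (a := d.Y i)).inter (MeasurableSet.iInter fun j => ?_)
    by_cases h : j < i
    · simp only [h, true_imp_iff]
      exact measurableSet_Ioi
    · simp [h]

/-- The label of the point `y`. -/
def lab (y : ℝ) : ℝ := d.w (d.idx y)

/-- The initial density. -/
def rho (y : ℝ) : ℝ := d.v (d.idx y)

/-- The characteristic through the initial point `y`. -/
def X (y t : ℝ) : ℝ := y + d.Phi (d.lab y) t

theorem abs_lab_le (y : ℝ) : |d.lab y| ≤ d.Wb := d.w_le _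
theorem rho_pos (y : ℝ) : 0 < d.rho y := d.v_pos _
theorem rho_le (y : ℝ) : d.rho y ≤ d.Vb := d.v_le _

theorem measurable_lab : Measurable d.lab := (measurable_from_nat (f := d.w)).comp d.measurable_idx
theorem measurable_rho : Measurable d.rho := (measurable_from_nat (f := d.v)).comp d.measurable_idx

theorem measurable_X : Measurable fun p : ℝ × ℝ => d.X p.1 p.2 :=
  measurable_fst.add (d.continuous_Phi.measurable.comp
    ((d.measurable_lab.comp measurable_fst).prodMk measurable_snd))

theorem X_zero (y : ℝ) : d.X y 0 = y := by simp [X, Phi_zero]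

theorem abs_X_sub_le {T s t : ℝ} (y : ℝ) (hs : 0 ≤ s) (hst : s ≤ t) (ht : t ≤ T) :
    |d.X y t - d.X y s| ≤ d.L T * (t - s) := by
  simpa [X] using d.abs_Phi_sub_le (d.abs_lab_le y) hs hst ht

/-! ### Configurations of shadow waves, and the positions of labels in them -/

/-- A configuration assigns a position to each shadow wave `p` (`D p`); it has to keep their
order. The values at other indices are irrelevant. -/
def MonoD (c : ℕ → ℝ) : Prop := ∀ p q, d.D p → d.D q → p ≤ q → c p ≤ c q

open Classical in
/-- `x` cut off at the first wave to the right of state `i`. -/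
def capUp (c : ℕ → ℝ) (i : ℕ) (x : ℝ) : ℝ :=
  if h : ∃ q, d.D q ∧ i ≤ q then min x (c (Nat.find h)) else x

open Classical in
/-- `x` cut off at the last wave to the left of state `i`. -/
def capLow (c : ℕ → ℝ) (i : ℕ) (x : ℝ) : ℝ :=
  if ∃ p, d.D p ∧ p < i then max x (c (Nat.findGreatest (fun p => d.D p ∧ p < i) i)) else x

/-- The position at time `t` of the mass that was initially at `y`: it follows its characteristic
until it meets the wave on the left or on the right, and stays in the wave from then on. -/
def chi (c : ℕ → ℝ) (t y : ℝ) : ℝ := d.capLow c (d.idx y) (d.capUp c (d.idx y) (d.X y t))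

/-- `q` is the first wave to the right of state `i`. -/
def IsSucc (i q : ℕ) : Prop := d.D q ∧ i ≤ q ∧ ∀ q', d.D q' → i ≤ q' → q ≤ q'

/-- `p` is the last wave to the left of state `i`. -/
def IsPred (i p : ℕ) : Prop := d.D p ∧ p < i ∧ ∀ p', d.D p' → p' < i → p' ≤ p

theorem exists_isSucc {i q : ℕ} (hq : d.D q) (hi : i ≤ q) : ∃ q', d.IsSucc i q' := by
  classical
  have h : ∃ q, d.D q ∧ i ≤ q := ⟨q, hq, hi⟩
  exact ⟨Nat.find h, (Nat.find_spec h).1, (Nat.find_spec h).2,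
    fun q' h1 h2 => Nat.find_min' h ⟨h1, h2⟩⟩

theorem exists_isPred {i p : ℕ} (hp : d.D p) (hi : p < i) : ∃ p', d.IsPred i p' := by
  classical
  have h := Nat.findGreatest_spec (P := fun p => d.D p ∧ p < i) hi.le ⟨hp, hi⟩
  exact ⟨_, h.1, h.2, fun p' h1 h2 => Nat.le_findGreatest h2.le ⟨h1, h2⟩⟩

theorem capUp_eq {c : ℕ → ℝ} {i q : ℕ} (h : d.IsSucc i q) (x : ℝ) :
    d.capUp c i x = min x (c q) := by
  classical
  have h' : ∃ q, d.D q ∧ i ≤ q := ⟨q, h.1, h.2.1⟩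
  have : Nat.find h' = q := le_antisymm (Nat.find_min' h' ⟨h.1, h.2.1⟩)
    (h.2.2 _ (Nat.find_spec h').1 (Nat.find_spec h').2)
  rw [capUp, dif_pos h', this]

theorem capUp_eq_self {c : ℕ → ℝ} {i : ℕ} (h : ∀ q, d.D q → ¬ i ≤ q) (x : ℝ) :
    d.capUp c i x = x := by
  classical
  exact dif_neg (by rintro ⟨q, h1, h2⟩; exact h q h1 h2)

theorem capLow_eq {c : ℕ → ℝ} {i p : ℕ} (h : d.IsPred i p) (x : ℝ) :
    d.capLow c i x = max x (c p) := by
  classical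
  have h' : ∃ q, d.D q ∧ q < i := ⟨p, h.1, h.2.1⟩
  have hs := Nat.findGreatest_spec (P := fun p => d.D p ∧ p < i) h.2.1.le ⟨h.1, h.2.1⟩
  have : Nat.findGreatest (fun p => d.D p ∧ p < i) i = p :=
    le_antisymm (h.2.2 _ hs.1 hs.2) (Nat.le_findGreatest h.2.1.le ⟨h.1, h.2.1⟩)
  rw [capLow, if_pos h', this]

theorem capLow_eq_self {c : ℕ → ℝ} {i : ℕ} (h : ∀ q, d.D q → ¬ q < i) (x : ℝ) :
    d.capLow c i x = x := by
  classical
  exact if_neg (by rintro ⟨q, h1, h2⟩; exact h q h1 h2)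

variable {d}

theorem chi_ge {c : ℕ → ℝ} (hc : d.MonoD c) {t y : ℝ} {p : ℕ} (hp : d.D p) (hi : p < d.idx y) :
    c p ≤ d.chi c t y := by
  obtain ⟨p', h⟩ := d.exists_isPred hp hi
  rw [chi, d.capLow_eq h]
  exact (hc p p' hp h.1 (h.2.2 p hp hi)).trans (le_max_right _ _)

theorem chi_le {c : ℕ → ℝ} (hc : d.MonoD c) {t y : ℝ} {q : ℕ} (hq : d.D q) (hi : d.idx y ≤ q) :
    d.chi c t y ≤ c q := by
  obtain ⟨q', h⟩ := d.exists_isSucc hq hi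
  have h1 : c q' ≤ c q := hc q' q h.1 hq (h.2.2 q hq hi)
  have h2 : d.capUp c (d.idx y) (d.X y t) ≤ c q := by
    rw [d.capUp_eq h]; exact (min_le_right _ _).trans h1
  by_cases hl : ∃ p, d.D p ∧ p < d.idx y
  · obtain ⟨p, hp, hpi⟩ := hl
    obtain ⟨p', h'⟩ := d.exists_isPred hp hpi
    rw [chi, d.capLow_eq h']
    exact max_le h2 (hc p' q h'.1 hq (by have := h'.2.1; omega))
  · push Not at hl
    rw [chi, d.capLow_eq_self (fun q h1 h2 => absurd (hl q h1) (not_le.2 h2))]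
    exact h2

/-- A label is free, or has been absorbed by the first wave on its right, or by the last wave on
its left. -/
theorem chi_cases (c : ℕ → ℝ) (t y : ℝ) :
    d.chi c t y = d.X y t ∨
    (∃ q, d.IsSucc (d.idx y) q ∧ d.chi c t y = c q ∧ c q ≤ d.X y t) ∨
    (∃ p, d.IsPred (d.idx y) p ∧ d.chi c t y = c p ∧ d.capUp c (d.idx y) (d.X y t) ≤ c p) := by
  have hup : d.capUp c (d.idx y) (d.X y t) = d.X y t ∨
      ∃ q, d.IsSucc (d.idx y) q ∧ d.capUp c (d.idx y) (d.X y t) = c q ∧ c q ≤ d.X y t := by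
    by_cases h : ∃ q, d.D q ∧ d.idx y ≤ q
    · obtain ⟨q, hq, hi⟩ := h
      obtain ⟨q', h⟩ := d.exists_isSucc hq hi
      rw [d.capUp_eq h]
      rcases le_total (d.X y t) (c q') with h' | h'
      · left; exact min_eq_left h'
      · right; exact ⟨q', h, min_eq_right h', h'⟩
    · push Not at h
      left; exact d.capUp_eq_self (fun q h1 h2 => absurd (h q h1) (not_lt.2 h2)) _
  by_cases h : ∃ q, d.D q ∧ q < d.idx y
  · obtain ⟨q, hq, hi⟩ := h
    obtain ⟨q', h⟩ := d.exists_isPred hq hi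
    rw [chi, d.capLow_eq h]
    rcases le_total (d.capUp c (d.idx y) (d.X y t)) (c q') with h' | h'
    · right; right; exact ⟨q', h, max_eq_right h', h'⟩
    · rw [max_eq_left h']
      rcases hup with hup | hup
      · exact Or.inl hup
      · exact Or.inr (Or.inl hup)
  · push Not at h
    rw [chi, d.capLow_eq_self (fun q h1 h2 => absurd (h q h1) (not_le.2 h2))]
    rcases hup with hup | hup
    · exact Or.inl hup
    · exact Or.inr (Or.inl hup)

theorem chi_eq_X {c : ℕ → ℝ} {t y : ℝ} (h1 : ∀ p, d.D p → p < d.idx y → c p ≤ d.X y t)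
    (h2 : ∀ q, d.D q → d.idx y ≤ q → d.X y t ≤ c q) : d.chi c t y = d.X y t := by
  have hup : d.capUp c (d.idx y) (d.X y t) = d.X y t := by
    by_cases h : ∃ q, d.D q ∧ d.idx y ≤ q
    · obtain ⟨q, hq, hi⟩ := h
      obtain ⟨q', h⟩ := d.exists_isSucc hq hi
      rw [d.capUp_eq h, min_eq_left (h2 q' h.1 h.2.1)]
    · push Not at h
      exact d.capUp_eq_self (fun q h1 h2 => absurd (h q h1) (not_lt.2 h2)) _
  rw [chi, hup]
  by_cases h : ∃ q, d.D q ∧ q < d.idx y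
  · obtain ⟨q, hq, hi⟩ := h
    obtain ⟨q', h⟩ := d.exists_isPred hq hi
    rw [d.capLow_eq h, max_eq_left (h1 q' h.1 h.2.1)]
  · push Not at h
    exact d.capLow_eq_self (fun q h1 h2 => absurd (h q h1) (not_le.2 h2)) _

theorem chi_eq_succ {c : ℕ → ℝ} (hc : d.MonoD c) {t y : ℝ} {q : ℕ} (hq : d.IsSucc (d.idx y) q)
    (h : c q ≤ d.X y t) : d.chi c t y = c q := by
  refine le_antisymm (chi_le hc hq.1 hq.2.1) ?_
  rw [chi, d.capUp_eq hq, min_eq_right h]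
  by_cases h : ∃ q, d.D q ∧ q < d.idx y
  · obtain ⟨p, hp, hi⟩ := h
    obtain ⟨p', h⟩ := d.exists_isPred hp hi
    rw [d.capLow_eq h]
    exact le_max_left _ _
  · push Not at h
    rw [d.capLow_eq_self (fun q h1 h2 => absurd (h q h1) (not_le.2 h2))]

theorem chi_eq_pred {c : ℕ → ℝ} (hc : d.MonoD c) {t y : ℝ} {p : ℕ} (hp : d.IsPred (d.idx y) p)
    (h : d.X y t ≤ c p) : d.chi c t y = c p := by
  refine le_antisymm ?_ (chi_ge hc hp.1 hp.2.1)
  rw [chi, d.capLow_eq hp]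
  refine max_le ?_ le_rfl
  by_cases h' : ∃ q, d.D q ∧ d.idx y ≤ q
  · obtain ⟨q, hq, hi⟩ := h'
    obtain ⟨q', h'⟩ := d.exists_isSucc hq hi
    rw [d.capUp_eq h']
    exact (min_le_left _ _).trans h
  · push Not at h'
    rwa [d.capUp_eq_self (fun q h1 h2 => absurd (h' q h1) (not_lt.2 h2))]

theorem chi_zero (y : ℝ) : d.chi d.Y 0 y = y := by
  rw [chi_eq_X, d.X_zero]
  · intro p _ h; rw [d.X_zero]; exact (d.Y_lt_of_lt_idx h).le
  · intro q _ h; rw [d.X_zero]; exact d.idx_le_iff.1 h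

end StepData

namespace StepData

variable (d : StepData)

/-! ### Admissible labels and the motion between two update times -/

/-- A wave at `x` may have label `ℓ` as far as the states on its left are concerned: for each of
these states `j` whose label is at most `ℓ`, the wave lies to the right of the characteristic with
label `ℓ` from the right end `Y j` of that state. In terms of the label `λ` of the state adjacent to
the wave this says `ℓ < λ`; the present form is visibly preserved when the wave moves with label
`ℓ`. -/
def LAdm (c : ℕ → ℝ) (t x ℓ : ℝ) : Prop :=
  ∀ j, (∀ q, d.D q → x ≤ c q → j ≤ q) → d.w j ≤ ℓ → d.Y j + d.Phi ℓ t < x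

/-- The counterpart of `LAdm` for the states on the right of a wave at `x`. -/
def RAdm (c : ℕ → ℝ) (t x ℓ : ℝ) : Prop :=
  ∀ j, (∀ q, d.D q → c q ≤ x → q ≤ j) → ℓ ≤ d.w (j + 1) → x < d.Y j + d.Phi ℓ t

/-- The free motion of wave `i` from the configuration `c` at time `t`, with the label that `Ω`
assigns to its location. -/
def gam (c : ℕ → ℝ) (t : ℝ) (Ω : ℝ → ℝ) (τ : ℝ) (i : ℕ) : ℝ :=
  c i + (d.Phi (Ω (c i)) τ - d.Phi (Ω (c i)) t)

open Classical in
/-- The configuration at time `τ` that evolves from `c` at time `t`: when waves meet, all of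
them continue with the leftmost one. Conservation of momentum is restored at the next update. -/
def adv (c : ℕ → ℝ) (t : ℝ) (Ω : ℝ → ℝ) (τ : ℝ) (p : ℕ) : ℝ :=
  if d.D p then
    (insert p ((Finset.range p).filter d.D)).sup' (Finset.insert_nonempty _ _) (d.gam c t Ω τ)
  else c p

variable {d} {c : ℕ → ℝ} {t : ℝ} {Ω : ℝ → ℝ}

theorem LAdm.mono {x ℓ ℓ' : ℝ} (h : d.LAdm c t x ℓ) (ht : 0 ≤ t) (hℓ : ℓ' ≤ ℓ) :
    d.LAdm c t x ℓ' := fun j hj hw => by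
  linarith [h j hj (hw.trans hℓ), d.Phi_mono hℓ ht]

theorem RAdm.mono {x ℓ ℓ' : ℝ} (h : d.RAdm c t x ℓ) (ht : 0 ≤ t) (hℓ : ℓ ≤ ℓ') :
    d.RAdm c t x ℓ' := fun j hj hw => by
  linarith [h j hj (hℓ.trans hw), d.Phi_mono hℓ ht]

theorem adv_ge {τ : ℝ} {i p : ℕ} (hi : d.D i) (hp : d.D p) (h : i ≤ p) :
    d.gam c t Ω τ i ≤ d.adv c t Ω τ p := by
  classical
  rw [adv, if_pos hp]
  refine Finset.le_sup' (d.gam c t Ω τ) ?_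
  rcases h.eq_or_lt with rfl | h
  · simp
  · simp [h, hi]

theorem adv_exists {τ : ℝ} {p : ℕ} (hp : d.D p) :
    ∃ a, d.D a ∧ a ≤ p ∧ d.adv c t Ω τ p = d.gam c t Ω τ a := by
  classical
  obtain ⟨a, ha, h⟩ := Finset.exists_mem_eq_sup' (Finset.insert_nonempty p
    ((Finset.range p).filter d.D)) (d.gam c t Ω τ)
  refine ⟨a, ?_, ?_, by rw [adv, if_pos hp, h]⟩
  · rcases Finset.mem_insert.1 ha with rfl | ha
    · exact hp
    · exact (Finset.mem_filter.1 ha).2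
  · rcases Finset.mem_insert.1 ha with rfl | ha
    · exact le_rfl
    · exact (Finset.mem_range.1 (Finset.mem_filter.1 ha).1).le

theorem adv_mono (τ : ℝ) : d.MonoD (d.adv c t Ω τ) := fun p q hp hq hpq => by
  obtain ⟨a, ha, hap, h⟩ := adv_exists (c := c) (t := t) (Ω := Ω) (τ := τ) hp
  rw [h]
  exact adv_ge ha hq (hap.trans hpq)

theorem adv_leader {τ : ℝ} {p : ℕ} (hp : d.D p) :
    ∃ a, d.D a ∧ a ≤ p ∧ d.adv c t Ω τ p = d.adv c t Ω τ a ∧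
      d.adv c t Ω τ a = d.gam c t Ω τ a := by
  obtain ⟨a, ha, hap, h⟩ := adv_exists (c := c) (t := t) (Ω := Ω) (τ := τ) hp
  have h1 := adv_ge (c := c) (t := t) (Ω := Ω) (τ := τ) ha ha le_rfl
  have h2 := adv_mono (c := c) (t := t) (Ω := Ω) τ a p ha hp hap
  exact ⟨a, ha, hap, le_antisymm (h.le.trans h1) h2, le_antisymm (h2.trans h.le) h1⟩

theorem gam_self (i : ℕ) : d.gam c t Ω t i = c i := by simp [gam]

theorem adv_self (hc : d.MonoD c) : d.adv c t Ω t = c := by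
  funext p
  by_cases hp : d.D p
  · obtain ⟨a, ha, hap, h⟩ := adv_exists (c := c) (t := t) (Ω := Ω) (τ := t) hp
    have h1 := adv_ge (c := c) (t := t) (Ω := Ω) (τ := t) hp hp le_rfl
    rw [gam_self] at h h1
    exact le_antisymm (h.le.trans (hc a p ha hp hap)) h1
  · rw [adv, if_neg hp]

theorem gam_congr {τ : ℝ} {i j : ℕ} (h : c i = c j) : d.gam c t Ω τ i = d.gam c t Ω τ j := by
  simp [gam, h]

theorem adv_eq_of_eq (hc : d.MonoD c) {τ : ℝ} {p q : ℕ} (hp : d.D p) (hq : d.D q)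
    (h : c p = c q) : d.adv c t Ω τ p = d.adv c t Ω τ q := by
  wlog hpq : p ≤ q generalizing p q
  · exact (this hq hp h.symm (le_of_not_ge hpq)).symm
  refine le_antisymm (adv_mono τ p q hp hq hpq) ?_
  obtain ⟨a, ha, haq, h'⟩ := adv_exists (c := c) (t := t) (Ω := Ω) (τ := τ) hq
  rw [h']
  rcases le_total a p with hap | hap
  · exact adv_ge ha hp hap
  · have : c a = c p := le_antisymm ((hc a q ha hq haq).trans h.ge) (hc p a hp ha hap)
    rw [gam_congr this]
    exact adv_ge hp hp le_rfl

theorem gam_lt_of_label {s τ : ℝ} {i j : ℕ} (ht : t ≤ s) (hs : s ≤ τ)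
    (h0 : c j ≤ c i) (h : d.gam c t Ω s i ≤ d.gam c t Ω s j) :
    d.gam c t Ω τ i ≤ d.gam c t Ω τ j := by
  rcases h0.eq_or_lt with h0 | h0
  · exact (gam_congr h0.symm).le
  have hlt : Ω (c i) < Ω (c j) := by
    by_contra hcon
    have := d.Phi_sub_le (not_lt.1 hcon) ht
    simp only [gam] at h
    linarith
  have := d.Phi_sub_le hlt.le hs
  simp only [gam] at h ⊢
  linarith

theorem adv_sticky (hc : d.MonoD c) {s τ : ℝ} (ht : t ≤ s) (hs : s ≤ τ) {p q : ℕ} (hp : d.D p)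
    (hq : d.D q) (h : d.adv c t Ω s p = d.adv c t Ω s q) :
    d.adv c t Ω τ p = d.adv c t Ω τ q := by
  wlog hpq : p ≤ q generalizing p q
  · exact (this hq hp h.symm (le_of_not_ge hpq)).symm
  refine le_antisymm (adv_mono τ p q hp hq hpq) ?_
  obtain ⟨a, ha, haq, h'⟩ := adv_exists (c := c) (t := t) (Ω := Ω) (τ := τ) hq
  rw [h']
  rcases le_total a p with hap | hap
  · exact adv_ge ha hp hap
  obtain ⟨l, hl, hlp, hl'⟩ := adv_exists (c := c) (t := t) (Ω := Ω) (τ := s) hp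
  have h1 : d.gam c t Ω s a ≤ d.gam c t Ω s l := by
    rw [← hl', h]; exact adv_ge ha hq haq
  exact (gam_lt_of_label ht hs (hc l a hl ha (hlp.trans hap)) h1).trans (adv_ge hl hp hlp)

/-- Admissibility of a label is preserved by the motion: both sides of the defining inequalities
move with the same speed. -/
theorem adv_adm (hc : d.MonoD c) {τ : ℝ} {a : ℕ} (ha : d.D a)
    (hadm : d.LAdm c t (c a) (Ω (c a)) ∧ d.RAdm c t (c a) (Ω (c a)))
    (hlead : d.adv c t Ω τ a = d.gam c t Ω τ a) :
    d.LAdm (d.adv c t Ω τ) τ (d.adv c t Ω τ a) (Ω (c a)) ∧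
      d.RAdm (d.adv c t Ω τ) τ (d.adv c t Ω τ a) (Ω (c a)) := by
  constructor
  · intro j hj hw
    have := hadm.1 j (fun q hq h => hj q hq ?_) hw
    · rw [hlead, gam]; linarith
    · rcases le_total a q with h' | h'
      · exact adv_mono τ a q ha hq h'
      · exact (adv_eq_of_eq hc ha hq (le_antisymm h (hc q a hq ha h'))).le
  · intro j hj hw
    have := hadm.2 j (fun q hq h => hj q hq ?_) hw
    · rw [hlead, gam]; linarith
    · rcases le_total q a with h' | h'
      · exact adv_mono τ q a hq ha h'
      · exact (adv_eq_of_eq hc hq ha (le_antisymm h (hc a q ha hq h'))).le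

theorem adv_lip (hΩ : ∀ x, |Ω x| ≤ d.Wb) {T s τ : ℝ} (h0 : 0 ≤ s) (hs : s ≤ τ) (hτ : τ ≤ T)
    {p : ℕ} (hp : d.D p) : |d.adv c t Ω τ p - d.adv c t Ω s p| ≤ d.L T * (τ - s) := by
  have key : ∀ i, |d.gam c t Ω τ i - d.gam c t Ω s i| ≤ d.L T * (τ - s) := fun i => by
    have := d.abs_Phi_sub_le (hΩ (c i)) h0 hs hτ
    simpa [gam] using this
  obtain ⟨a, ha, hap, h1⟩ := adv_exists (c := c) (t := t) (Ω := Ω) (τ := τ) hp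
  obtain ⟨b, hb, hbp, h2⟩ := adv_exists (c := c) (t := t) (Ω := Ω) (τ := s) hp
  have h3 := adv_ge (c := c) (t := t) (Ω := Ω) (τ := τ) hb hp hbp
  have h4 := adv_ge (c := c) (t := t) (Ω := Ω) (τ := s) ha hp hap
  have h5 := abs_le.1 (key a)
  have h6 := abs_le.1 (key b)
  rw [abs_le]
  constructor <;> linarith [h5.1, h5.2, h6.1, h6.2]

/-! ### The choice of new labels -/

variable (d) in
/-- The average label of the mass at `x`. It is the label for which the momentum is conserved. -/
def mean (c : ℕ → ℝ) (t x : ℝ) : ℝ :=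
  (∫ y in {y | d.chi c t y = x}, d.rho y * d.lab y) / ∫ y in {y | d.chi c t y = x}, d.rho y

theorem abs_mean_le (c : ℕ → ℝ) (t x : ℝ) : |d.mean c t x| ≤ d.Wb := by
  set s := {y | d.chi c t y = x}
  have h0 : 0 ≤ ∫ y in s, d.rho y := integral_nonneg fun y => (d.rho_pos y).le
  by_cases hi : IntegrableOn d.rho s
  · rw [mean, abs_div, abs_of_nonneg h0]
    refine div_le_of_le_mul₀ h0 d.Wb_nonneg ?_
    rw [← integral_const_mul, ← Real.norm_eq_abs]
    refine norm_integral_le_of_norm_le (hi.const_mul _) (Eventually.of_forall fun y => ?_)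
    rw [Real.norm_eq_abs, abs_mul, abs_of_pos (d.rho_pos y), mul_comm]
    exact mul_le_mul_of_nonneg_right (d.abs_lab_le y) (d.rho_pos y).le
  · rw [mean, integral_undef hi]
    simpa using d.Wb_nonneg

/-- `ℓ` is an admissible label at `x`, and as close to the average label `m` as
admissibility permits, up to `η`. Admissibility is an open condition, so that the extremal
admissible label itself is in general not available. -/
structure NearMean (d : StepData) (c : ℕ → ℝ) (t x m η ℓ : ℝ) : Prop where
  left : d.LAdm c t x ℓ
  right : d.RAdm c t x ℓ
  of_lt : ℓ < m → ∃ ℓ', ¬ d.LAdm c t x ℓ' ∧ ℓ' < ℓ + η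
  of_gt : m < ℓ → ∃ ℓ', ¬ d.RAdm c t x ℓ' ∧ ℓ - η < ℓ'

theorem exists_nearMean (ht : 0 ≤ t) {x m η ℓ₀ B : ℝ} (hη : 0 < η) (h₀ : d.LAdm c t x ℓ₀)
    (h₀' : d.RAdm c t x ℓ₀) (hB : |ℓ₀| ≤ B) (hm : |m| ≤ B) :
    ∃ ℓ, |ℓ| ≤ B ∧ NearMean d c t x m η ℓ := by
  rw [abs_le] at hB hm
  -- `LAdm` is preserved when the label decreases, `RAdm` when it increases: if one of them fails at
  -- `m`, the label nearest to `m` is the end of an interval of admissible labels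
  by_cases hL : d.LAdm c t x m
  · by_cases hR : d.RAdm c t x m
    · exact ⟨m, abs_le.2 hm, hL, hR, fun h => absurd h (lt_irrefl _),
        fun h => absurd h (lt_irrefl _)⟩
    · set S := {ℓ | d.RAdm c t x ℓ}
      have hlow : ∀ ℓ ∈ S, m < ℓ := fun ℓ hℓ => not_le.1 fun h => hR (RAdm.mono hℓ ht h)
      have hbdd : BddBelow S := ⟨m, fun ℓ hℓ => (hlow ℓ hℓ).le⟩
      have hS : S.Nonempty := ⟨ℓ₀, h₀'⟩
      obtain ⟨ℓ₁, h₁, h₁'⟩ := exists_lt_of_csInf_lt hS (show sInf S < sInf S + η / 2 by linarith)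
      have h1m := hlow _ h₁
      have h0m := hlow _ h₀'
      refine ⟨min ℓ₀ ℓ₁, abs_le.2 ⟨?_, (min_le_left _ _).trans hB.2⟩, h₀.mono ht (min_le_left _ _),
        ?_, fun h => ?_, fun _ => ⟨sInf S - η / 4, fun h => ?_, ?_⟩⟩
      · exact le_min hB.1 (by linarith)
      · rcases min_choice ℓ₀ ℓ₁ with h | h <;> rw [h] <;> assumption
      · exact absurd h (not_lt.2 (le_min h0m.le h1m.le))
      · linarith [csInf_le hbdd h]
      · linarith [min_le_right ℓ₀ ℓ₁]
  · set S := {ℓ | d.LAdm c t x ℓ}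
    have hlow : ∀ ℓ ∈ S, ℓ < m := fun ℓ hℓ => not_le.1 fun h => hL (LAdm.mono hℓ ht h)
    have hbdd : BddAbove S := ⟨m, fun ℓ hℓ => (hlow ℓ hℓ).le⟩
    have hS : S.Nonempty := ⟨ℓ₀, h₀⟩
    obtain ⟨ℓ₁, h₁, h₁'⟩ := exists_lt_of_lt_csSup hS (show sSup S - η / 2 < sSup S by linarith)
    have h1m := hlow _ h₁
    have h0m := hlow _ h₀
    refine ⟨max ℓ₀ ℓ₁, abs_le.2 ⟨hB.1.trans (le_max_left _ _), ?_⟩, ?_, h₀'.mono ht (le_max_left _ _),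
      fun _ => ⟨sSup S + η / 4, fun h => ?_, ?_⟩, fun h => ?_⟩
    · exact max_le hB.2 (by linarith)
    · rcases max_choice ℓ₀ ℓ₁ with h | h <;> rw [h] <;> assumption
    · linarith [le_csSup hbdd h]
    · linarith [le_max_right ℓ₀ ℓ₁]
    · exact absurd h (not_lt.2 (max_le h0m.le h1m.le))

end StepData

namespace StepData

/-! ### Existence of wave tracks -/

/-- The waves with index at most `N` move freely, without meeting, from time `t` to time `t'`. -/
def NoColl (d : StepData) (N : ℕ) (c : ℕ → ℝ) (t : ℝ) (Ω : ℝ → ℝ) (t' : ℝ) : Prop :=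
  ∀ p q, d.D p → d.D q → p < q → q ≤ N → c p < c q → ∀ s, t ≤ s → s < t' →
    d.gam c t Ω s p < d.gam c t Ω s q

variable {d : StepData} {c : ℕ → ℝ} {t : ℝ} {Ω : ℝ → ℝ}

theorem continuous_gam (c : ℕ → ℝ) (t : ℝ) (Ω : ℝ → ℝ) (i : ℕ) :
    Continuous fun τ => d.gam c t Ω τ i :=
  continuous_const.add ((d.continuous_Phi_right _).sub continuous_const)

theorem NoColl.gam_le (hc : d.MonoD c) {N : ℕ} {t' : ℝ} (h : NoColl d N c t Ω t') {p q : ℕ}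
    (hp : d.D p) (hq : d.D q) (hpq : p ≤ q) (hqN : q ≤ N) {s : ℝ} (hs : t ≤ s) (hs' : s ≤ t')
    : d.gam c t Ω s p ≤ d.gam c t Ω s q := by
  rcases hpq.eq_or_lt with rfl | hpq
  · exact le_rfl
  rcases (hc p q hp hq hpq.le).eq_or_lt with h0 | h0
  · exact (gam_congr h0).le
  rcases (hs.trans hs').eq_or_lt with rfl | htt
  · obtain rfl : s = t := le_antisymm hs' hs
    rw [gam_self, gam_self]; exact h0.le
  have hcl : IsClosed {s | d.gam c t Ω s p ≤ d.gam c t Ω s q} :=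
    isClosed_le (continuous_gam _ _ _ _) (continuous_gam _ _ _ _)
  have hsub : Ico t t' ⊆ {s | d.gam c t Ω s p ≤ d.gam c t Ω s q} :=
    fun s hs => (h p q hp hq hpq hqN h0 s hs.1 hs.2).le
  have := hcl.closure_subset_iff.2 hsub
  rw [closure_Ico htt.ne] at this
  exact this ⟨hs, hs'⟩

theorem NoColl.adv_eq (hc : d.MonoD c) {N : ℕ} {t' : ℝ} (h : NoColl d N c t Ω t') {p : ℕ}
    (hp : d.D p) (hpN : p ≤ N) {s : ℝ} (hs : t ≤ s) (hs' : s ≤ t') :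
    d.adv c t Ω s p = d.gam c t Ω s p := by
  refine le_antisymm ?_ (adv_ge hp hp le_rfl)
  obtain ⟨a, ha, hap, h1⟩ := adv_exists (c := c) (t := t) (Ω := Ω) (τ := s) hp
  rw [h1]
  exact h.gam_le hc ha hp hap hpN hs hs'

open Classical in
/-- The first time after `t`, but at most `t + δ`, at which waves with index at most `N` meet. -/
theorem exists_next_tick (hc : d.MonoD c) (N : ℕ) (t : ℝ) (Ω : ℝ → ℝ) {δ : ℝ} (hδ : 0 < δ) :
    ∃ t', t < t' ∧ t' ≤ t + δ ∧ NoColl d N c t Ω t' ∧ (t' = t + δ ∨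
      ∃ p q, d.D p ∧ d.D q ∧ p ≤ N ∧ q ≤ N ∧ c p ≠ c q ∧
        d.adv c t Ω t' p = d.adv c t Ω t' q) := by
  set F := ((Finset.range (N + 1)) ×ˢ (Finset.range (N + 1))).filter
    (fun r => d.D r.1 ∧ d.D r.2 ∧ r.1 < r.2 ∧ c r.1 < c r.2) with hF
  set K := Icc t (t + δ) ∩ ({t + δ} ∪ ⋃ r ∈ F, {s | d.gam c t Ω s r.2 ≤ d.gam c t Ω s r.1})
    with hKdef
  have hK : IsCompact K := by
    refine isCompact_Icc.inter_right (isClosed_singleton.union (isClosed_biUnion_finset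
      fun r _ => isClosed_le (continuous_gam _ _ _ _) (continuous_gam _ _ _ _)))
  have hne : K.Nonempty := ⟨t + δ, ⟨by linarith, le_rfl⟩, Or.inl rfl⟩
  obtain ⟨t', ht', hmin⟩ := hK.exists_isLeast hne
  have hFmem : ∀ p q, d.D p → d.D q → p < q → q ≤ N → c p < c q → (p, q) ∈ F := by
    intro p q hp hq hpq hqN h0
    simp only [hF, Finset.mem_filter, Finset.mem_product, Finset.mem_range]
    exact ⟨⟨by omega, by omega⟩, hp, hq, hpq, h0⟩
  have hno : NoColl d N c t Ω t' := by
    intro p q hp hq hpq hqN h0 s hs hs'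
    by_contra hcon
    refine absurd (hmin ⟨⟨hs, hs'.le.trans ht'.1.2⟩, Or.inr ?_⟩) (not_le.2 hs')
    exact mem_iUnion₂.2 ⟨(p, q), hFmem p q hp hq hpq hqN h0, not_lt.1 hcon⟩
  have hlt : t < t' := by
    refine lt_of_le_of_ne ht'.1.1 fun h => ?_
    rcases ht'.2 with h1 | h1
    · simp only [mem_singleton_iff] at h1; linarith
    · obtain ⟨r, hr, h2⟩ := mem_iUnion₂.1 h1
      simp only [← h, mem_ofPred_eq, gam_self] at h2
      exact absurd (Finset.mem_filter.1 hr).2.2.2.2 (not_lt.2 h2)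
  refine ⟨t', hlt, ht'.1.2, hno, ht'.2.imp (fun h => h) fun h1 => ?_⟩
  obtain ⟨⟨p, q⟩, hr, h2⟩ := mem_iUnion₂.1 h1
  simp only [hF, Finset.mem_filter, Finset.mem_product, Finset.mem_range] at hr
  obtain ⟨⟨hpN, hqN⟩, hp, hq, hpq, h0⟩ := hr
  refine ⟨p, q, hp, hq, by omega, by omega, h0.ne, ?_⟩
  refine le_antisymm (adv_mono t' p q hp hq hpq.le) ?_
  rw [hno.adv_eq hc hq (by omega) hlt.le le_rfl]
  exact le_trans h2 (adv_ge hp hp le_rfl)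

/-- A configuration from which the construction can be continued. -/
structure Valid (d : StepData) (t : ℝ) (c : ℕ → ℝ) : Prop where
  nonneg : 0 ≤ t
  mono : d.MonoD c
  adm : ∀ p, d.D p → ∃ ℓ, |ℓ| ≤ d.Wb ∧ d.LAdm c t (c p) ℓ ∧ d.RAdm c t (c p) ℓ

theorem valid_zero (d : StepData) : Valid d 0 d.Y where
  nonneg := le_rfl
  mono := fun _ _ _ _ h => d.Y_strictMono.monotone h
  adm := fun p hp => by
    have hp' : d.w (p + 1) < d.w p := hp
    have h1 := abs_le.1 (d.w_le p)
    have h2 := abs_le.1 (d.w_le (p + 1))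
    refine ⟨(d.w p + d.w (p + 1)) / 2, abs_le.2 ⟨by linarith, by linarith⟩, ?_, ?_⟩
    · intro j hj hw
      rw [Phi_zero, add_zero]
      refine d.Y_strictMono (lt_of_le_of_ne (hj p hp le_rfl) ?_)
      rintro rfl
      linarith
    · intro j hj hw
      rw [Phi_zero, add_zero]
      refine d.Y_strictMono (lt_of_le_of_ne (hj p hp le_rfl) ?_)
      rintro rfl
      linarith

theorem valid_adv (hv : Valid d t c) (hΩ : ∀ x, |Ω x| ≤ d.Wb)
    (hadm : ∀ p, d.D p → d.LAdm c t (c p) (Ω (c p)) ∧ d.RAdm c t (c p) (Ω (c p))) {τ : ℝ}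
    (hτ : t ≤ τ) : Valid d τ (d.adv c t Ω τ) where
  nonneg := hv.nonneg.trans hτ
  mono := adv_mono τ
  adm := fun p hp => by
    obtain ⟨a, ha, hap, h1, h2⟩ := adv_leader (c := c) (t := t) (Ω := Ω) (τ := τ) hp
    have := adv_adm hv.mono ha (hadm a ha) h2
    rw [← h1] at this
    exact ⟨_, hΩ _, this⟩

theorem exists_labels (hv : Valid d t c) {η : ℝ} (hη : 0 < η) :
    ∃ Ω : ℝ → ℝ, (∀ x, |Ω x| ≤ d.Wb) ∧
      ∀ p, d.D p → NearMean d c t (c p) (d.mean c t (c p)) η (Ω (c p)) := by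
  have : ∀ x, ∃ ℓ, |ℓ| ≤ d.Wb ∧ ((∃ p, d.D p ∧ c p = x) →
      NearMean d c t x (d.mean c t x) η ℓ) := by
    intro x
    by_cases h : ∃ p, d.D p ∧ c p = x
    · obtain ⟨p, hp, rfl⟩ := h
      obtain ⟨ℓ₀, h1, h2, h3⟩ := hv.adm p hp
      obtain ⟨ℓ, h4, h5⟩ := exists_nearMean hv.nonneg hη h2 h3 h1 (abs_mean_le c t (c p))
      exact ⟨ℓ, h4, fun _ => h5⟩
    · exact ⟨0, by simpa using d.Wb_nonneg, fun h' => absurd h' h⟩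
  choose Ω h1 h2 using this
  exact ⟨Ω, h1, fun p hp => h2 (c p) ⟨p, hp, rfl⟩⟩

open Classical in
/-- The number of different positions of the waves with index at most `N`. -/
def numPos (d : StepData) (N : ℕ) (c : ℕ → ℝ) : ℕ :=
  (((Finset.range (N + 1)).filter d.D).image c).card

open Classical in
theorem numPos_adv_le (hc : d.MonoD c) (N : ℕ) (τ : ℝ) :
    numPos d N (d.adv c t Ω τ) ≤ numPos d N c ∧
    ((∃ p q, d.D p ∧ d.D q ∧ p ≤ N ∧ q ≤ N ∧ c p ≠ c q ∧
      d.adv c t Ω τ p = d.adv c t Ω τ q) → numPos d N (d.adv c t Ω τ) < numPos d N c) := by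
  set F := (Finset.range (N + 1)).filter d.D with hF
  set g : ℝ → ℝ := fun x => if h : ∃ p, d.D p ∧ c p = x then d.adv c t Ω τ h.choose else 0
  have hg : ∀ p, d.D p → g (c p) = d.adv c t Ω τ p := fun p hp => by
    have h : ∃ q, d.D q ∧ c q = c p := ⟨p, hp, rfl⟩
    simp only [g, dif_pos h]
    exact adv_eq_of_eq hc h.choose_spec.1 hp h.choose_spec.2
  have himg : F.image (d.adv c t Ω τ) = (F.image c).image g := by
    rw [Finset.image_image]
    refine Finset.image_congr fun p hp => ?_
    exact (hg p (Finset.mem_filter.1 hp).2).symm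
  have hle : numPos d N (d.adv c t Ω τ) ≤ numPos d N c := by
    simp only [numPos, ← hF, himg]
    exact Finset.card_image_le
  refine ⟨hle, ?_⟩
  rintro ⟨p, q, hp, hq, hpN, hqN, hne, heq⟩
  refine lt_of_le_of_ne hle fun h => hne ?_
  simp only [numPos, ← hF, himg] at h
  have hinj := Finset.card_image_iff.1 h
  have hm : ∀ r, d.D r → r ≤ N → c r ∈ ((F.image c : Finset ℝ) : Set ℝ) := fun r hr hrN => by
    rw [Finset.mem_coe]
    exact Finset.mem_image_of_mem c (Finset.mem_filter.2 ⟨Finset.mem_range.2 (by omega), hr⟩)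
  exact hinj (hm p hp hpN) (hm q hq hqN) (by rw [hg p hp, hg q hq, heq])

/-- The motion of all shadow waves: `c t p` is the position of wave `p` at time `t`. At the update
times `tick k` new labels `lbl k x` are assigned to the locations `x`; between two updates the
waves move with constant labels. -/
structure Track (d : StepData) where
  tick : ℕ → ℝ
  lbl : ℕ → ℝ → ℝ
  c : ℝ → ℕ → ℝ
  tick_zero : tick 0 = 0
  tick_lt : ∀ k, tick k < tick (k + 1)
  tick_top : Tendsto tick atTop atTop
  c_neg : ∀ t, t ≤ 0 → c t = c 0
  c_zero : c 0 = d.Y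
  slab : ∀ k t, tick k ≤ t → t ≤ tick (k + 1) →
    c t = d.adv (c (tick k)) (tick k) (lbl k) t
  lbl_le : ∀ k x, |lbl k x| ≤ d.Wb
  adm : ∀ k p, d.D p → d.LAdm (c (tick k)) (tick k) (c (tick k) p) (lbl k (c (tick k) p)) ∧
    d.RAdm (c (tick k)) (tick k) (c (tick k) p) (lbl k (c (tick k) p))

/-- The waves with index at most `N` meet only at update times, updates follow each other in steps
of at most `δ`, and the labels are close to the averages. -/
structure Track.Accurate (T : Track d) (N : ℕ) (δ e : ℝ) : Prop where
  tick_le : ∀ k, T.tick (k + 1) ≤ T.tick k + δ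
  noColl : ∀ k, NoColl d N (T.c (T.tick k)) (T.tick k) (T.lbl k) (T.tick (k + 1))
  near : ∀ k p, d.D p → NearMean d (T.c (T.tick k)) (T.tick k) (T.c (T.tick k) p)
    (d.mean (T.c (T.tick k)) (T.tick k) (T.c (T.tick k) p)) (e * (1 / 2) ^ k)
    (T.lbl k (T.c (T.tick k) p))

/-- One step of the construction. A step of length less than `δ` decreases the number of positions
of the waves with index at most `N`; `progress` says so in a form that can be summed. -/
structure StepRel (d : StepData) (N : ℕ) (δ η : ℝ) (s : ℝ × (ℕ → ℝ)) (Ω : ℝ → ℝ)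
    (s' : ℝ × (ℕ → ℝ)) : Prop where
  lt : s.1 < s'.1
  le : s'.1 ≤ s.1 + δ
  eq : s'.2 = d.adv s.2 s.1 Ω s'.1
  bdd : ∀ x, |Ω x| ≤ d.Wb
  near : ∀ p, d.D p → NearMean d s.2 s.1 (s.2 p) (d.mean s.2 s.1 (s.2 p)) η (Ω (s.2 p))
  noColl : NoColl d N s.2 s.1 Ω s'.1
  progress : δ * numPos d N s'.2 + s.1 + δ ≤ δ * numPos d N s.2 + s'.1

theorem exists_stepRel (N : ℕ) {δ η : ℝ} (hδ : 0 < δ) (hη : 0 < η) (s : ℝ × (ℕ → ℝ))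
    (hv : Valid d s.1 s.2) : ∃ (Ω : ℝ → ℝ) (s' : ℝ × (ℕ → ℝ)), Valid d s'.1 s'.2 ∧
      StepRel d N δ η s Ω s' := by
  obtain ⟨Ω, h1, h2⟩ := exists_labels hv hη
  obtain ⟨t', h3, h4, h5, h6⟩ := exists_next_tick hv.mono N s.1 Ω hδ
  refine ⟨Ω, (t', d.adv s.2 s.1 Ω t'), valid_adv hv h1 (fun p hp => ⟨(h2 p hp).1, (h2 p hp).2⟩)
    h3.le, h3, h4, rfl, h1, h2, h5, ?_⟩
  obtain ⟨h7, h8⟩ := numPos_adv_le (t := s.1) (Ω := Ω) hv.mono N t'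
  rcases h6 with h6 | h6
  · have : (numPos d N (d.adv s.2 s.1 Ω t') : ℝ) ≤ numPos d N s.2 := by exact_mod_cast h7
    have := mul_le_mul_of_nonneg_left this hδ.le
    dsimp only
    linarith
  · have : (numPos d N (d.adv s.2 s.1 Ω t') : ℝ) + 1 ≤ numPos d N s.2 := by exact_mod_cast h8 h6
    have := mul_le_mul_of_nonneg_left this hδ.le
    dsimp only
    linarith

theorem exists_track (d : StepData) (N : ℕ) {δ e : ℝ} (hδ : 0 < δ) (he : 0 < e) :
    ∃ T : Track d, T.Accurate N δ e := by
  classical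
  have hη : ∀ k : ℕ, 0 < e * (1 / 2 : ℝ) ^ k := fun k => by positivity
  choose Ω nxt hval hrel using fun (k : ℕ) (s : {s : ℝ × (ℕ → ℝ) // Valid d s.1 s.2}) =>
    exists_stepRel N hδ (hη k) s.1 s.2
  let S : ℕ → {s : ℝ × (ℕ → ℝ) // Valid d s.1 s.2} := fun k =>
    Nat.rec ⟨(0, d.Y), valid_zero d⟩ (fun k s => ⟨nxt k s, hval k s⟩) k
  have hS : ∀ k, StepRel d N δ (e * (1 / 2) ^ k) (S k).1 (Ω k (S k)) (S (k + 1)).1 :=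
    fun k => hrel k (S k)
  let tick : ℕ → ℝ := fun k => (S k).1.1
  have htick : StrictMono tick := strictMono_nat_of_lt_succ fun k => (hS k).lt
  -- all but finitely many steps have length `δ`
  have htop : Tendsto tick atTop atTop := by
    have key : ∀ k : ℕ, δ * k + δ * numPos d N (S k).1.2 ≤ tick k + δ * numPos d N (S 0).1.2 := by
      intro k
      induction k with
      | zero => simp only [tick]; show _ ≤ 0 + _; simp
      | succ k ih => have := (hS k).progress; push_cast; simp only [tick] at *; linarith
    refine tendsto_atTop_mono (f := fun k : ℕ => -(δ * numPos d N (S 0).1.2) + k * δ)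
      (fun k => ?_) ?_
    · have : 0 ≤ δ * (numPos d N (S k).1.2 : ℝ) := by positivity
      linarith [key k]
    · exact tendsto_atTop_add_const_left _ _ (tendsto_natCast_atTop_atTop.atTop_mul_const hδ)
  have hex : ∀ t : ℝ, ∃ k, max t 0 < tick (k + 1) ∧ ∀ j, j < k → tick (j + 1) ≤ max t 0 := by
    intro t
    have h : ∃ k, max t 0 < tick (k + 1) :=
      ((htop.comp (tendsto_add_atTop_nat 1)).eventually_gt_atTop (max t 0)).exists
    exact ⟨Nat.find h, Nat.find_spec h, fun j hj => not_lt.1 (Nat.find_min h hj)⟩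
  choose ix hix hix' using hex
  let c : ℝ → ℕ → ℝ := fun t =>
    d.adv (S (ix t)).1.2 (tick (ix t)) (Ω (ix t) (S (ix t))) (max t 0)
  have h0 : tick 0 = 0 := rfl
  have hfind : ∀ k t, tick k ≤ t → t < tick (k + 1) → max t 0 = t ∧ ix t = k := by
    intro k t h1 h2
    have ht : max t 0 = t := max_eq_left (by rw [← h0]; exact (htick.monotone k.zero_le).trans h1)
    have h3 := hix t
    have h4 := hix' t
    rw [ht] at h3 h4
    refine ⟨ht, le_antisymm (not_lt.1 fun h => ?_) (not_lt.1 fun h => ?_)⟩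
    · linarith [h4 k h]
    · have : tick (ix t + 1) ≤ tick k := htick.monotone h
      linarith
  have hc : ∀ k t, tick k ≤ t → t < tick (k + 1) →
      c t = d.adv (S k).1.2 (tick k) (Ω k (S k)) t := by
    intro k t h1 h2
    simp only [c, hfind k t h1 h2]
  have hpos : ∀ k, c (tick k) = (S k).1.2 := fun k => by
    rw [hc k _ le_rfl (htick (Nat.lt_succ_self k))]
    exact adv_self (S k).2.mono
  refine ⟨⟨tick, fun k => Ω k (S k), c, h0, fun k => htick (Nat.lt_succ_self k), htop, ?_, ?_, ?_,
    fun k => (hS k).bdd, ?_⟩, ?_, ?_, ?_⟩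
  · intro t ht
    have h1 : max t 0 = 0 := max_eq_right ht
    have h2 := hfind 0 0 le_rfl (htick Nat.zero_lt_one)
    have h3 : ix t = 0 := by
      have h4 := hix' t
      rw [h1] at h4
      by_contra h
      have h5 : tick 0 < tick (0 + 1) := htick Nat.zero_lt_one
      linarith [h4 0 (by omega)]
    simp only [c, h1, h2, h3]
  · exact (hpos 0).trans rfl
  · intro k t h1 h2
    rw [hpos]
    rcases h2.eq_or_lt with h2 | h2
    · rw [h2]
      exact (hpos (k + 1)).trans (hS k).eq
    · exact hc k t h1 h2
  · intro k p hp
    rw [hpos]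
    exact ⟨((hS k).near p hp).1, ((hS k).near p hp).2⟩
  · exact fun k => (hS k).le
  · intro k
    simp only [hpos]
    exact (hS k).noColl
  · intro k p hp
    simp only [hpos]
    exact (hS k).near p hp

end StepData

namespace StepData

namespace Track

variable {d : StepData} (T : Track d)

/-! ### Global properties of wave tracks -/

theorem tick_strictMono : StrictMono T.tick := strictMono_nat_of_lt_succ T.tick_lt

theorem tick_nonneg (k : ℕ) : 0 ≤ T.tick k :=
  T.tick_zero ▸ T.tick_strictMono.monotone k.zero_le

theorem exists_slab {t : ℝ} (ht : 0 ≤ t) : ∃ k, T.tick k ≤ t ∧ t < T.tick (k + 1) := by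
  classical
  have h : ∃ k, t < T.tick k := (T.tick_top.eventually_gt_atTop t).exists
  have h0 : Nat.find h ≠ 0 := fun h0 => by
    have := Nat.find_spec h
    rw [h0, T.tick_zero] at this
    linarith
  obtain ⟨k, hk⟩ := Nat.exists_eq_succ_of_ne_zero h0
  refine ⟨k, not_lt.1 (Nat.find_min h (by omega)), ?_⟩
  have := Nat.find_spec h
  rwa [hk] at this

/-- A transitive relation between times that holds within each interval between two updates holds
in general. -/
theorem slab_induction {r : ℝ → ℝ → Prop}
    (htr : ∀ a b c, 0 ≤ a → a ≤ b → b ≤ c → r a b → r b c → r a c)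
    (hs : ∀ k s t, T.tick k ≤ s → s ≤ t → t ≤ T.tick (k + 1) → r s t) {s t : ℝ} (h0 : 0 ≤ s)
    (hst : s ≤ t) : r s t := by
  have key : ∀ k s t, 0 ≤ s → s ≤ t → t ≤ T.tick k → r s t := by
    intro k
    induction k with
    | zero =>
      intro s t h0 hst ht
      exact hs 0 s t (by rwa [T.tick_zero]) hst (ht.trans (T.tick_lt 0).le)
    | succ k ih =>
      intro s t h0 hst ht
      rcases le_total t (T.tick k) with h | h
      · exact ih s t h0 hst h
      rcases le_total (T.tick k) s with h' | h'
      · exact hs k s t h' hst ht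
      · exact htr s _ t h0 h' h (ih s _ h0 h' le_rfl) (hs k _ t le_rfl h ht)
  obtain ⟨k, hk⟩ := (T.tick_top.eventually_ge_atTop t).exists
  exact key k s t h0 hst hk

theorem mono_c (t : ℝ) : d.MonoD (T.c t) := by
  rcases le_total t 0 with h | h
  · rw [T.c_neg t h, T.c_zero]
    exact d.valid_zero.mono
  · obtain ⟨k, h1, h2⟩ := T.exists_slab h
    rw [T.slab k t h1 h2.le]
    exact adv_mono t

theorem sticky {s t : ℝ} (h0 : 0 ≤ s) (hst : s ≤ t) {p q : ℕ} (hp : d.D p) (hq : d.D q)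
    (h : T.c s p = T.c s q) : T.c t p = T.c t q := by
  revert h
  refine T.slab_induction (r := fun s t => T.c s p = T.c s q → T.c t p = T.c t q)
    (fun a b c _ _ _ h1 h2 h => h2 (h1 h)) (fun k s t h1 h2 h3 h => ?_) h0 hst
  rw [T.slab k s h1 (h2.trans h3)] at h
  rw [T.slab k t (h1.trans h2) h3]
  exact adv_sticky (T.mono_c _) h1 h2 hp hq h

theorem lip_c {B s t : ℝ} (h0 : 0 ≤ s) (hst : s ≤ t) (ht : t ≤ B) {p : ℕ} (hp : d.D p) :
    |T.c t p - T.c s p| ≤ d.L B * (t - s) := by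
  revert ht
  refine T.slab_induction (r := fun s t => t ≤ B → |T.c t p - T.c s p| ≤ d.L B * (t - s))
    (fun a b c _ _ hbc h1 h2 hc => ?_) (fun k s t h1 h2 h3 h => ?_) h0 hst
  · have h1 := h1 (hbc.trans hc)
    have h2 := h2 hc
    calc |T.c c p - T.c a p| = |(T.c c p - T.c b p) + (T.c b p - T.c a p)| := by ring_nf
      _ ≤ _ := abs_add_le _ _
      _ ≤ d.L B * (c - a) := by linarith
  · rw [T.slab k s h1 (h2.trans h3), T.slab k t (h1.trans h2) h3]
    exact adv_lip (T.lbl_le k) ((T.tick_nonneg k).trans h1) h2 h hp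

theorem abs_c_sub_Y_le {B t : ℝ} (h0 : 0 ≤ t) (ht : t ≤ B) {p : ℕ} (hp : d.D p) :
    |T.c t p - d.Y p| ≤ d.L B * B := by
  have := T.lip_c le_rfl h0 ht hp
  rw [T.c_zero, sub_zero] at this
  exact this.trans (mul_le_mul_of_nonneg_left ht (d.L_nonneg B))

theorem c_max (t : ℝ) : T.c t = T.c (max t 0) := by
  rcases le_total t 0 with h | h
  · rw [max_eq_right h, T.c_neg t h]
  · rw [max_eq_left h]

theorem continuous_c {p : ℕ} (hp : d.D p) : Continuous fun t => T.c t p := by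
  rw [continuous_iff_continuousAt]
  intro t₀
  set B := max t₀ 0 + 1
  have hB : t₀ < B := by linarith [le_max_left t₀ 0]
  have hlip : LipschitzOnWith ⟨d.L B, d.L_nonneg B⟩ (fun t => T.c t p) (Iio B) := by
    refine LipschitzOnWith.of_dist_le_mul fun s hs t ht => ?_
    have hB0 : 0 ≤ B := by positivity
    wlog hst : s ≤ t generalizing s t
    · rw [dist_comm, dist_comm s t]
      exact this t ht s hs (le_of_not_ge hst)
    rw [dist_comm, Real.dist_eq, dist_comm, Real.dist_eq, T.c_max t, T.c_max s]
    refine (T.lip_c (le_max_right _ _) (max_le_max_right _ hst) (max_le ht.le hB0) hp).trans ?_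
    refine mul_le_mul_of_nonneg_left ?_ (d.L_nonneg B)
    refine (le_abs_self _).trans ?_
    exact abs_max_sub_max_le_abs t s 0
  exact hlip.continuousOn.continuousAt (Iio_mem_nhds hB)

/-- Only finitely many waves reach a bounded region. -/
theorem exists_far (B x : ℝ) : ∃ N, ∀ p, d.D p → N ≤ p → ∀ t, 0 ≤ t → t ≤ B → x < T.c t p := by
  obtain ⟨N, hN⟩ := d.exists_Y_gt (x + d.L B * B)
  refine ⟨N, fun p hp hNp t h0 ht => ?_⟩
  have := abs_le.1 (T.abs_c_sub_Y_le h0 ht hp)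
  linarith [hN p hNp, this.1]

/-- Wave `p` is the leftmost one of those that have merged with it up to time `t`. -/
def Lead (t : ℝ) (p : ℕ) : Prop := d.D p ∧ ∀ q, d.D q → q < p → T.c t q ≠ T.c t p

theorem exists_lead (t : ℝ) {p : ℕ} (hp : d.D p) :
    ∃ a, T.Lead t a ∧ a ≤ p ∧ T.c t a = T.c t p := by
  classical
  have h : ∃ a, d.D a ∧ T.c t a = T.c t p := ⟨p, hp, rfl⟩
  refine ⟨Nat.find h, ⟨(Nat.find_spec h).1, fun q hq hlt heq => ?_⟩, Nat.find_min' h ⟨hp, rfl⟩,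
    (Nat.find_spec h).2⟩
  exact Nat.find_min h hlt ⟨hq, heq.trans (Nat.find_spec h).2⟩

variable {T} in
theorem Lead.eq_of_eq {t : ℝ} {p q : ℕ} (hp : T.Lead t p) (hq : T.Lead t q)
    (h : T.c t p = T.c t q) : p = q := by
  rcases lt_trichotomy p q with hlt | heq | hlt
  · exact absurd h (hq.2 p hp.1 hlt)
  · exact heq
  · exact absurd h.symm (hp.2 q hq.1 hlt)

variable {T} in
theorem Lead.of_le {s t : ℝ} (h0 : 0 ≤ s) (hst : s ≤ t) {p : ℕ} (h : T.Lead t p) : T.Lead s p :=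
  ⟨h.1, fun q hq hqp heq => h.2 q hq hqp (T.sticky h0 hst hq h.1 heq)⟩

variable {T} in
theorem Lead.eq_gam {k : ℕ} {t : ℝ} {p : ℕ} (h : T.Lead t p) (h1 : T.tick k ≤ t)
    (h2 : t ≤ T.tick (k + 1)) : T.c t p = d.gam (T.c (T.tick k)) (T.tick k) (T.lbl k) t p := by
  obtain ⟨a, ha, hap, h3, h4⟩ := adv_leader (c := T.c (T.tick k)) (t := T.tick k)
    (Ω := T.lbl k) (τ := t) h.1
  rw [← T.slab k t h1 h2] at h3 h4
  rcases hap.eq_or_lt with rfl | hlt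
  · exact h4
  · exact absurd h3.symm (h.2 a ha hlt)

variable {T} in
/-- The leftmost wave of a group has stayed on the left of the characteristic on its left. -/
theorem Lead.c_le {t : ℝ} (ht : 0 ≤ t) {p : ℕ} (h : T.Lead t p) :
    T.c t p ≤ d.Y p + d.Phi (d.w p) t := by
  have key := T.slab_induction (r := fun s t => T.Lead t p → T.c s p ≤ d.Y p + d.Phi (d.w p) s →
    T.c t p ≤ d.Y p + d.Phi (d.w p) t) (fun a b c ha hab hbc h1 h2 h h3 =>
      h2 h (h1 (h.of_le (ha.trans hab) hbc) h3)) (fun k s t h1 h2 h3 h h4 => ?_) le_rfl ht h ?_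
  · exact key
  · have h0 := T.tick_nonneg k
    have hs := h.of_le (h0.trans h1) h2
    have hk := h.of_le h0 (h1.trans h2)
    have e1 := h.eq_gam (h1.trans h2) h3
    have e2 := hs.eq_gam h1 (h2.trans h3)
    have hlt : T.lbl k (T.c (T.tick k) p) ≤ d.w p := by
      by_contra hcon
      have h5 := (T.adm k p h.1).1 p (fun q hq hle => not_lt.1 fun hlt =>
        hk.2 q hq hlt (le_antisymm (T.mono_c _ q p hq h.1 hlt.le) hle)) (not_le.1 hcon).le
      have h6 := d.Phi_mono (not_le.1 hcon).le (h0.trans h1)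
      simp only [gam] at e2
      linarith
    have := d.Phi_sub_le hlt h2
    simp only [gam] at e1 e2
    linarith
  · rw [T.c_zero, Phi_zero, add_zero]

/-- The rightmost wave of a group has stayed on the right of the characteristic on its right. -/
theorem le_c_of_last {t : ℝ} (ht : 0 ≤ t) {p : ℕ} (hp : d.D p)
    (h : ∀ q, d.D q → p < q → T.c t q ≠ T.c t p) :
    d.Y p + d.Phi (d.w (p + 1)) t ≤ T.c t p := by
  have key := T.slab_induction (r := fun s t => (∀ q, d.D q → p < q → T.c t q ≠ T.c t p) →
    d.Y p + d.Phi (d.w (p + 1)) s ≤ T.c s p → d.Y p + d.Phi (d.w (p + 1)) t ≤ T.c t p)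
    (fun a b c ha hab hbc h1 h2 h h3 => h2 h (h1 (fun q hq hpq heq => h q hq hpq
      (T.sticky (ha.trans hab) hbc hq hp heq)) h3)) (fun k s t h1 h2 h3 h h4 => ?_) le_rfl ht h ?_
  · exact key
  · have h0 := T.tick_nonneg k
    obtain ⟨a, ha, hap, h7, h8⟩ := adv_leader (c := T.c (T.tick k)) (t := T.tick k)
      (Ω := T.lbl k) (τ := s) hp
    have h9 := (adv_adm (T.mono_c _) (τ := s) ha (T.adm k a ha) h8).2 p (fun q hq hle => by
      refine not_lt.1 fun hlt => h q hq hlt (T.sticky (h0.trans h1) h2 hq hp ?_)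
      rw [T.slab k s h1 (h2.trans h3)]
      rw [← h7] at hle
      exact le_antisymm hle (adv_mono s p q hp hq hlt.le))
    have h10 := adv_ge (c := T.c (T.tick k)) (t := T.tick k) (Ω := T.lbl k) (τ := t) ha hp hap
    rw [← h7, ← T.slab k s h1 (h2.trans h3)] at h9
    rw [h8, ← T.slab k s h1 (h2.trans h3)] at h7
    rw [← T.slab k t (h1.trans h2) h3] at h10
    have hw : d.w (p + 1) ≤ T.lbl k (T.c (T.tick k) a) := by
      by_contra hcon
      have := h9 (not_le.1 hcon).le
      have := d.Phi_mono (not_le.1 hcon).le (h0.trans h1)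
      linarith
    have := d.Phi_sub_le hw h2
    simp only [gam] at h7 h10
    linarith
  · rw [T.c_zero, Phi_zero, add_zero]

/-! ### Labels of waves and events -/

/-- The number of the last update before or at time `t`. -/
def slabIx (t : ℝ) : ℕ := sSup {k | T.tick k ≤ t}

theorem slabIx_eq {k : ℕ} {t : ℝ} (h1 : T.tick k ≤ t) (h2 : t < T.tick (k + 1)) :
    T.slabIx t = k := by
  have : IsGreatest {k | T.tick k ≤ t} k := ⟨h1, fun j hj => by
    by_contra hlt
    have := T.tick_strictMono.monotone (show k + 1 ≤ j by omega)
    have hj' : T.tick j ≤ t := hj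
    linarith⟩
  exact this.csSup_eq

open Classical in
/-- The leftmost of the waves that are at the same place as wave `p`. -/
def leader (t : ℝ) (p : ℕ) : ℕ := if h : d.D p then (T.exists_lead t h).choose else p

theorem lead_leader (t : ℝ) {p : ℕ} (hp : d.D p) : T.Lead t (T.leader t p) := by
  rw [leader, dif_pos hp]; exact (T.exists_lead t hp).choose_spec.1

theorem c_leader (t : ℝ) {p : ℕ} (hp : d.D p) : T.c t (T.leader t p) = T.c t p := by
  rw [leader, dif_pos hp]; exact (T.exists_lead t hp).choose_spec.2.2

theorem leader_eq {t : ℝ} {a p : ℕ} (hp : d.D p) (ha : T.Lead t a) (h : T.c t a = T.c t p) :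
    T.leader t p = a :=
  (T.lead_leader t hp).eq_of_eq ha ((T.c_leader t hp).trans h.symm)

/-- The label of wave `p` at time `t`: its speed is `G (label t p) t`. -/
def label (t : ℝ) (p : ℕ) : ℝ :=
  T.lbl (T.slabIx t) (T.c (T.tick (T.slabIx t)) (T.leader t p))

theorem abs_label_le (t : ℝ) (p : ℕ) : |T.label t p| ≤ d.Wb := T.lbl_le _ _

theorem label_congr {t : ℝ} {p q : ℕ} (hp : d.D p) (hq : d.D q) (h : T.c t p = T.c t q) :
    T.label t p = T.label t q := by
  rw [label, label, T.leader_eq hp (T.lead_leader t hq) ((T.c_leader t hq).trans h.symm)]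

theorem label_adm {t : ℝ} (ht : 0 ≤ t) {p : ℕ} (hp : d.D p) :
    d.LAdm (T.c t) t (T.c t p) (T.label t p) ∧ d.RAdm (T.c t) t (T.c t p) (T.label t p) := by
  obtain ⟨k, h1, h2⟩ := T.exists_slab ht
  have hl := T.lead_leader t hp
  have h3 := hl.eq_gam h1 h2.le
  have := adv_adm (T.mono_c _) (τ := t) hl.1 (T.adm k _ hl.1) (by
    rw [← T.slab k t h1 h2.le]; exact h3)
  rw [← T.slab k t h1 h2.le, T.c_leader t hp] at this
  rwa [label, T.slabIx_eq h1 h2]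

/-- Waves `p` and `q` meet at time `t` for the first time. -/
def Meet (p q : ℕ) (t : ℝ) : Prop := T.c t q = T.c t p ∧ ∀ r, 0 ≤ r → r < t → T.c r q ≠ T.c r p

/-- Something happens to wave `p` at time `t`: an update, or an encounter with another wave. -/
def Ev (p : ℕ) (t : ℝ) : Prop := 0 ≤ t ∧ ((∃ k, t = T.tick k) ∨ ∃ q, d.D q ∧ T.Meet p q t)

theorem ev_zero (p : ℕ) : T.Ev p 0 := ⟨le_rfl, Or.inl ⟨0, T.tick_zero.symm⟩⟩

theorem ev_tick (p k : ℕ) : T.Ev p (T.tick k) := ⟨T.tick_nonneg k, Or.inl ⟨k, rfl⟩⟩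

theorem finite_ev {p : ℕ} (hp : d.D p) (B : ℝ) : {t | T.Ev p t ∧ t ≤ B}.Finite := by
  obtain ⟨K, hK⟩ := (T.tick_top.eventually_gt_atTop B).exists_forall_of_atTop
  obtain ⟨N, hN⟩ := T.exists_far B (d.Y p + d.L B * B)
  refine (((Finset.range K).finite_toSet.image T.tick).union
    ((Finset.range N).finite_toSet.biUnion (t := fun q => {t | 0 ≤ t ∧ T.Meet p q t})
      fun q _ => ?_)).subset ?_
  · refine Set.Subsingleton.finite fun s hs t ht => ?_
    rcases lt_trichotomy s t with h | h | h
    · exact absurd hs.2.1 (ht.2.2 s hs.1 h)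
    · exact h
    · exact absurd ht.2.1 (hs.2.2 t ht.1 h)
  · rintro t ⟨⟨h0, h⟩, htB⟩
    rcases h with ⟨k, rfl⟩ | ⟨q, hq, hm⟩
    · left
      refine ⟨k, ?_, rfl⟩
      rw [Finset.mem_coe, Finset.mem_range]
      by_contra h
      linarith [hK k (not_lt.1 h)]
    · right
      refine mem_biUnion (x := q) ?_ ⟨h0, hm⟩
      rw [Finset.mem_coe, Finset.mem_range]
      by_contra h
      have h1 := hN q hq (not_lt.1 h) t h0 htB
      have h2 := abs_le.1 (T.abs_c_sub_Y_le h0 htB hp)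
      rw [hm.1] at h1
      linarith [h2.2]

theorem exists_next_ev {p : ℕ} (hp : d.D p) (s : ℝ) :
    ∃ s', s < s' ∧ T.Ev p s' ∧ ∀ t ∈ Ioo s s', ¬ T.Ev p t := by
  obtain ⟨k, hk⟩ := (T.tick_top.eventually_gt_atTop s).exists
  have hfin : {t | (T.Ev p t ∧ t ≤ T.tick k) ∧ s < t}.Finite :=
    (T.finite_ev hp (T.tick k)).subset fun t ht => ht.1
  obtain ⟨s', h1, h2⟩ := hfin.exists_minimal ⟨T.tick k, ⟨T.ev_tick p k, le_rfl⟩, hk⟩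
  refine ⟨s', h1.2, h1.1.1, fun t ht hev => ?_⟩
  have := h2 ⟨⟨hev, ht.2.le.trans h1.1.2⟩, ht.1⟩ ht.2.le
  exact absurd ht.2 (not_lt.2 this)

theorem exists_prev_ev {p : ℕ} (hp : d.D p) {s : ℝ} (hs : 0 < s) :
    ∃ r, 0 ≤ r ∧ r < s ∧ T.Ev p r ∧ ∀ t ∈ Ioo r s, ¬ T.Ev p t := by
  have hfin : {t | (T.Ev p t ∧ t ≤ s) ∧ t < s}.Finite :=
    (T.finite_ev hp s).subset fun t ht => ht.1
  obtain ⟨r, h1, h2⟩ := hfin.exists_maximal ⟨0, ⟨T.ev_zero p, hs.le⟩, hs⟩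
  refine ⟨r, h1.1.1.1, h1.2, h1.1.1, fun t ht hev => ?_⟩
  have := h2 ⟨⟨hev, ht.2.le⟩, ht.2⟩ ht.1.le
  exact absurd ht.1 (not_lt.2 this)

theorem exists_meet {p q : ℕ} (hp : d.D p) (hq : d.D q) {t : ℝ} (ht : 0 ≤ t)
    (h : T.c t q = T.c t p) : ∃ r, 0 ≤ r ∧ r ≤ t ∧ T.Meet p q r := by
  have hK : IsCompact (Icc 0 t ∩ {r | T.c r q = T.c r p}) :=
    isCompact_Icc.inter_right (isClosed_eq (T.continuous_c hq) (T.continuous_c hp))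
  obtain ⟨r, hr, hmin⟩ := hK.exists_isLeast ⟨t, ⟨ht, le_rfl⟩, h⟩
  refine ⟨r, hr.1.1, hr.1.2, hr.2, fun r' h0 hlt heq => ?_⟩
  exact absurd (hmin ⟨⟨h0, hlt.le.trans hr.1.2⟩, heq⟩) (not_le.2 hlt)

theorem eq_at_start {p q : ℕ} (hp : d.D p) (hq : d.D q) {s s' t : ℝ}
    (hev : ∀ t ∈ Ioo s s', ¬ T.Ev p t) (h0 : 0 ≤ s) (ht : t ∈ Ioo s s')
    (h : T.c t q = T.c t p) : T.c s q = T.c s p := by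
  obtain ⟨r, hr0, hrt, hm⟩ := T.exists_meet hp hq (h0.trans ht.1.le) h
  have hrs : r ≤ s := not_lt.1 fun hlt =>
    hev r ⟨hlt, hrt.trans_lt ht.2⟩ ⟨hr0, Or.inr ⟨q, hq, hm⟩⟩
  exact T.sticky hr0 hrs hq hp hm.1

theorem Ev.congr {p a : ℕ} (hp : d.D p) (ha : d.D a) {t : ℝ} (h : T.Ev p t)
    (heq : T.c t a = T.c t p) : T.Ev a t := by
  obtain ⟨h0, h | ⟨q, hq, hm⟩⟩ := h
  · exact ⟨h0, Or.inl h⟩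
  refine ⟨h0, Or.inr ?_⟩
  by_cases hr : ∃ r, 0 ≤ r ∧ r < t ∧ T.c r a = T.c r p
  · obtain ⟨r, hr0, hrt, hr⟩ := hr
    refine ⟨q, hq, hm.1.trans heq.symm, fun r' h0' hlt' heq' => ?_⟩
    have hmax : max r r' < t := max_lt hrt hlt'
    refine hm.2 (max r r') (hr0.trans (le_max_left _ _)) hmax ?_
    rw [T.sticky h0' (le_max_right r r') hq ha heq', T.sticky hr0 (le_max_left r r') ha hp hr]
  · push Not at hr
    exact ⟨p, hp, heq.symm, fun r h0 hlt h => hr r h0 hlt h.symm⟩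

/-- A segment of a wave: `p` leads its group of waves between the consecutive events `s` and
`s'`. Each segment gives rise to one shadow wave. -/
structure IsSeg (p : ℕ) (s s' : ℝ) : Prop where
  hD : d.D p
  lt : s < s'
  ev : T.Ev p s
  ev' : T.Ev p s'
  no_ev : ∀ t ∈ Ioo s s', ¬ T.Ev p t
  lead : ∀ t ∈ Ioo s s', T.Lead t p

variable {T}

theorem IsSeg.nonneg {p : ℕ} {s s' : ℝ} (h : T.IsSeg p s s') : 0 ≤ s := h.ev.1

theorem IsSeg.of_lead {p : ℕ} {s s' t : ℝ} (hlt : s < s') (hs : T.Ev p s) (hs' : T.Ev p s')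
    (hev : ∀ t ∈ Ioo s s', ¬ T.Ev p t) (ht : t ∈ Ico s s') (hl : T.Lead t p) : T.IsSeg p s s' where
  hD := hl.1
  lt := hlt
  ev := hs
  ev' := hs'
  no_ev := hev
  lead := fun _ ht' => ⟨hl.1, fun q hq hqp heq => hl.2 q hq hqp
    (T.sticky hs.1 ht.1 hq hl.1 (T.eq_at_start hl.1 hq hev hs.1 ht' heq))⟩

theorem IsSeg.end_unique {p : ℕ} {s s' s'' : ℝ} (h : T.IsSeg p s s') (h' : T.IsSeg p s s'') :
    s' = s'' := by
  rcases lt_trichotomy s' s'' with hlt | heq | hlt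
  · exact absurd h.ev' (h'.no_ev s' ⟨h.lt, hlt⟩)
  · exact heq
  · exact absurd h'.ev' (h.no_ev s'' ⟨h'.lt, hlt⟩)

theorem IsSeg.unique {p : ℕ} {s s' r r' t : ℝ} (h : T.IsSeg p s s') (h' : T.IsSeg p r r')
    (ht : t ∈ Ioo s s') (ht' : t ∈ Ioo r r') : s = r ∧ s' = r' := by
  have hsr : s = r := by
    rcases lt_trichotomy s r with hlt | heq | hlt
    · exact absurd h'.ev (h.no_ev r ⟨hlt, ht'.1.trans ht.2⟩)
    · exact heq
    · exact absurd h.ev (h'.no_ev s ⟨hlt, ht.1.trans ht'.2⟩)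
  subst hsr
  exact ⟨rfl, h.end_unique h'⟩

variable (T)

theorem exists_seg_from {p : ℕ} {s : ℝ} (hl : T.Lead s p) (hs : T.Ev p s) :
    ∃ s', T.IsSeg p s s' := by
  obtain ⟨s', h1, h2, h3⟩ := T.exists_next_ev hl.1 s
  exact ⟨s', IsSeg.of_lead h1 hs h2 h3 ⟨le_rfl, h1⟩ hl⟩

theorem exists_seg_at {p : ℕ} {t : ℝ} (hl : T.Lead t p) (ht : 0 ≤ t) (hev : ¬ T.Ev p t) :
    ∃ s s', T.IsSeg p s s' ∧ t ∈ Ioo s s' := by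
  have h0 : 0 < t := lt_of_le_of_ne ht fun h => hev (h ▸ T.ev_zero p)
  obtain ⟨s', h1, h2, h3⟩ := T.exists_next_ev hl.1 t
  obtain ⟨s, h4, h5, h6, h7⟩ := T.exists_prev_ev hl.1 h0
  refine ⟨s, s', IsSeg.of_lead (h5.trans h1) h6 h2 (fun r hr => ?_) ⟨h5.le, h1⟩ hl, h5, h1⟩
  rcases lt_trichotomy r t with h | h | h
  · exact h7 r ⟨hr.1, h⟩
  · exact h ▸ hev
  · exact h3 r ⟨h, hr.2⟩

theorem exists_seg_covering {p : ℕ} (hp : d.D p) {t : ℝ} (ht : 0 ≤ t) :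
    ∃ a s s', T.IsSeg a s s' ∧ t ∈ Ico s s' ∧ T.c t a = T.c t p := by
  obtain ⟨a, ha, -, h⟩ := T.exists_lead t hp
  by_cases hev : T.Ev a t
  · obtain ⟨s', hs'⟩ := T.exists_seg_from ha hev
    exact ⟨a, t, s', hs', ⟨le_rfl, hs'.lt⟩, h⟩
  · obtain ⟨s, s', hs, hts⟩ := T.exists_seg_at ha ht hev
    exact ⟨a, s, s', hs, ⟨hts.1.le, hts.2⟩, h⟩

/-- The waves that take part in a segment stay together with its leader up to its end. -/
theorem exists_seg_until {p : ℕ} (hp : d.D p) {s : ℝ} (hs : 0 < s) (hev : T.Ev p s) :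
    ∃ a r, T.IsSeg a r s ∧ T.c s a = T.c s p := by
  obtain ⟨r, h1, h2, h3, h4⟩ := T.exists_prev_ev hp hs
  set t₀ := (r + s) / 2 with ht₀
  have ht₀' : t₀ ∈ Ioo r s := ⟨by linarith, by linarith⟩
  have h0 : 0 ≤ t₀ := h1.trans ht₀'.1.le
  obtain ⟨a, ha, -, h⟩ := T.exists_lead t₀ hp
  have hs' : T.c s a = T.c s p := T.sticky h0 ht₀'.2.le ha.1 hp h
  obtain ⟨r', h5, h6, h7, h8⟩ := T.exists_prev_ev ha.1 hs
  have hr' : r' ≤ t₀ := by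
    by_contra hlt
    rw [not_le] at hlt
    refine h4 r' ⟨ht₀'.1.trans hlt, h6⟩ (h7.congr T ha.1 hp ?_)
    exact (T.sticky h0 hlt.le ha.1 hp h).symm
  exact ⟨a, r', IsSeg.of_lead h6 h7 (hev.congr T hp ha.1 hs') h8 ⟨hr', ht₀'.2⟩ ha, hs'⟩

variable {T}

theorem IsSeg.exists_slab {p : ℕ} {s s' : ℝ} (h : T.IsSeg p s s') :
    ∃ k, T.tick k ≤ s ∧ s' ≤ T.tick (k + 1) := by
  obtain ⟨k, h1, h2⟩ := T.exists_slab h.nonneg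
  refine ⟨k, h1, not_lt.1 fun hlt => h.no_ev _ ⟨h2, hlt⟩ (T.ev_tick p _)⟩

/-- On a segment the wave moves with a constant label. -/
theorem IsSeg.exists_label {p : ℕ} {s s' : ℝ} (h : T.IsSeg p s s') :
    ∃ ℓ a, (∀ t ∈ Ioo s s', T.label t p = ℓ) ∧
      ∀ t ∈ Ioo s s', T.c t p = a + d.Phi ℓ t := by
  obtain ⟨k, h1, h2⟩ := h.exists_slab
  refine ⟨T.lbl k (T.c (T.tick k) p), T.c (T.tick k) p -
    d.Phi (T.lbl k (T.c (T.tick k) p)) (T.tick k), fun t ht => ?_, fun t ht => ?_⟩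
  · rw [label, T.slabIx_eq (h1.trans ht.1.le) (ht.2.trans_le h2),
      T.leader_eq h.hD (h.lead t ht) rfl]
  · rw [(h.lead t ht).eq_gam (h1.trans ht.1.le) (ht.2.le.trans h2), gam]
    ring

theorem IsSeg.hasDerivAt {p : ℕ} {s s' : ℝ} (h : T.IsSeg p s s') {t : ℝ} (ht : t ∈ Ioo s s') :
    HasDerivAt (fun t => T.c t p) (d.G (T.label t p) t) t := by
  obtain ⟨ℓ, a, h1, h2⟩ := h.exists_label
  rw [h1 t ht]
  refine ((d.hasDerivAt_Phi ℓ t).const_add a).congr_of_eventuallyEq ?_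
  filter_upwards [isOpen_Ioo.mem_nhds ht] with t' ht'
  exact h2 t' ht'

theorem hasDerivAt_c {p : ℕ} (hp : d.D p) {t : ℝ} (ht : 0 ≤ t) (hev : ¬ T.Ev p t) :
    HasDerivAt (fun t => T.c t p) (d.G (T.label t p) t) t := by
  have h0 : 0 < t := lt_of_le_of_ne ht fun h => hev (h ▸ T.ev_zero p)
  obtain ⟨a, ha, -, h⟩ := T.exists_lead t hp
  obtain ⟨s, s', hs, hts⟩ := T.exists_seg_at ha ht
    (fun hev' => hev (hev'.congr T ha.1 hp h.symm))
  rw [← T.label_congr ha.1 hp h]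
  refine (hs.hasDerivAt hts).congr_of_eventuallyEq ?_
  filter_upwards [isOpen_Ioo.mem_nhds hts] with t' ht'
  exact (T.sticky hs.nonneg ht'.1.le ha.1 hp
    (T.eq_at_start hs.hD hp hs.no_ev hs.nonneg hts h.symm).symm).symm

/-- Within a segment the group of waves does not change. -/
theorem IsSeg.eq_iff {p q : ℕ} {s s' : ℝ} (h : T.IsSeg p s s') (hq : d.D q) {t t' : ℝ}
    (ht : t ∈ Ioo s s') (ht' : t' ∈ Ioo s s') : T.c t q = T.c t p ↔ T.c t' q = T.c t' p :=
  ⟨fun he => T.sticky h.nonneg ht'.1.le hq h.hD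
    (T.eq_at_start h.hD hq h.no_ev h.nonneg ht he),
   fun he => T.sticky h.nonneg ht.1.le hq h.hD
    (T.eq_at_start h.hD hq h.no_ev h.nonneg ht' he)⟩

end Track
end StepData

namespace StepData

variable {d : StepData}

/-! ### Free and absorbed mass -/

theorem chi_free {c : ℕ → ℝ} (hc : d.MonoD c) {t y : ℝ} (h : ∀ q, d.D q → d.chi c t y ≠ c q) :
    d.chi c t y = d.X y t ∧ (∀ p, d.D p → p < d.idx y → c p < d.X y t) ∧
      ∀ q, d.D q → d.idx y ≤ q → d.X y t < c q := by
  have h1 : d.chi c t y = d.X y t := by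
    rcases chi_cases c t y with h1 | ⟨q, h1, h2, -⟩ | ⟨p, h1, h2, -⟩
    · exact h1
    · exact absurd h2 (h q h1.1)
    · exact absurd h2 (h p h1.1)
  rw [← h1]
  exact ⟨rfl, fun p hp hi => lt_of_le_of_ne (chi_ge hc hp hi) (h p hp).symm,
    fun q hq hi => lt_of_le_of_ne (chi_le hc hq hi) (h q hq)⟩

/-- The labels that no wave has absorbed; the jumps of the initial data are left out. -/
def Free (d : StepData) (c : ℕ → ℝ) (t : ℝ) : Set ℝ :=
  {y | (∀ q, d.D q → d.chi c t y ≠ c q) ∧ ∀ i, y ≠ d.Y i}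

theorem strictMonoOn_X {c : ℕ → ℝ} (hc : d.MonoD c) {t : ℝ} (ht : 0 ≤ t) :
    StrictMonoOn (fun y => d.X y t) (Free d c t) := by
  intro y hy y' hy' hlt
  obtain ⟨h1, h2, h3⟩ := chi_free hc hy.1
  obtain ⟨h1', h2', h3'⟩ := chi_free hc hy'.1
  by_cases h : ∃ q, d.D q ∧ d.idx y ≤ q ∧ q < d.idx y'
  · obtain ⟨q, hq, hi, hi'⟩ := h
    exact (h3 q hq hi).trans (h2' q hq hi')
  · push Not at h
    have hw : d.lab y ≤ d.lab y' := d.w_mono_of_not_D (d.idx_mono hlt.le)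
      fun q h4 h5 h6 => absurd (h q h6 h4) (not_le.2 h5)
    have := d.Phi_mono hw ht
    simp only [X]
    linarith

theorem idx_eventuallyEq {y : ℝ} (hy : ∀ i, y ≠ d.Y i) : ∀ᶠ y' in 𝓝 y, d.idx y' = d.idx y := by
  have h1 : y < d.Y (d.idx y) := lt_of_le_of_ne (d.le_Y_idx y) (hy _)
  by_cases h0 : d.idx y = 0
  · filter_upwards [Iio_mem_nhds h1] with y' hy'
    have : d.idx y' ≤ d.idx y := d.idx_le_iff.2 (le_of_lt hy')
    omega
  · have h2 : d.Y (d.idx y - 1) < y := d.Y_lt_of_lt_idx (by omega)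
    filter_upwards [Iio_mem_nhds h1, Ioi_mem_nhds h2] with y' hy' hy''
    have h3 : d.idx y' ≤ d.idx y := d.idx_le_iff.2 (le_of_lt hy')
    have h4 : d.idx y - 1 < d.idx y' := d.lt_idx_iff.2 hy''
    omega

theorem hasDerivAt_X {y : ℝ} (hy : ∀ i, y ≠ d.Y i) (t : ℝ) :
    HasDerivAt (fun y => d.X y t) 1 y := by
  refine ((hasDerivAt_id y).add_const (d.Phi (d.lab y) t)).congr_of_eventuallyEq ?_
  filter_upwards [idx_eventuallyEq hy] with y' hy'
  simp [X, lab, hy']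

theorem ae_ne_Y (d : StepData) : ∀ᵐ y : ℝ, ∀ i, y ≠ d.Y i := by
  rw [ae_all_iff]
  intro i
  filter_upwards [(countable_singleton (d.Y i)).ae_notMem volume] with y hy h
  exact hy h

/-- Free mass moves without being compressed: on free labels `X` preserves the volume. -/
theorem volume_le_of_free {c : ℕ → ℝ} (hc : d.MonoD c) {t : ℝ} (ht : 0 ≤ t) {I : Set ℝ}
    (hI : MeasurableSet I) (hfree : ∀ y ∈ I, ∀ q, d.D q → d.chi c t y ≠ c q) {S : Set ℝ}
    (hab : ∀ y ∈ I, d.X y t ∈ S) : volume I ≤ volume S := by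
  set I' := I \ range d.Y
  have hI' : MeasurableSet I' := hI.diff (countable_range d.Y).measurableSet
  have hvol : volume I = volume I' := by
    refine measure_congr ?_
    refine (sdiff_ae_eq_self.2 ?_).symm
    exact measure_mono_null inter_subset_right ((countable_range d.Y).measure_zero volume)
  have hY : ∀ y ∈ I', ∀ i, y ≠ d.Y i := fun y hy i h => hy.2 ⟨i, h.symm⟩
  have hinj : InjOn (fun y => d.X y t) I' :=
    ((strictMonoOn_X hc ht).mono fun y hy => ⟨hfree y hy.1, hY y hy⟩).injOn
  have := lintegral_image_eq_lintegral_abs_deriv_mul hI'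
    (fun y hy => (hasDerivAt_X (hY y hy) t).hasDerivWithinAt) hinj (fun _ => 1)
  simp only [abs_one, ENNReal.ofReal_one, mul_one, lintegral_one, Measure.restrict_apply_univ]
    at this
  rw [hvol, ← this]
  exact measure_mono (by rintro _ ⟨y, hy, rfl⟩; exact hab y hy.1)

namespace Track

variable (T : Track d)

/-- The position at time `t` of the mass that was initially at `y`. -/
def pos (t y : ℝ) : ℝ := d.chi (T.c t) t y

theorem measurable_pos : Measurable fun p : ℝ × ℝ => T.pos p.1 p.2 := by
  have hX : Measurable fun p : ℝ × ℝ => d.X p.2 p.1 :=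
    d.measurable_X.comp (measurable_snd.prodMk measurable_fst)
  have hc : ∀ {q}, d.D q → Measurable fun p : ℝ × ℝ => T.c p.1 q := fun hq =>
    (T.continuous_c hq).measurable.comp measurable_fst
  have hup : ∀ i, Measurable fun p : ℝ × ℝ => d.capUp (T.c p.1) i (d.X p.2 p.1) := by
    intro i
    by_cases h : ∃ q, d.D q ∧ i ≤ q
    · obtain ⟨q, hq, hi⟩ := h
      obtain ⟨q', h⟩ := d.exists_isSucc hq hi
      simp only [d.capUp_eq h]
      exact hX.min (hc h.1)
    · push Not at h
      simp only [d.capUp_eq_self (fun q h1 h2 => absurd (h q h1) (not_lt.2 h2))]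
      exact hX
  have hlow : ∀ i, Measurable fun p : ℝ × ℝ =>
      d.capLow (T.c p.1) i (d.capUp (T.c p.1) i (d.X p.2 p.1)) := by
    intro i
    by_cases h : ∃ q, d.D q ∧ q < i
    · obtain ⟨q, hq, hi⟩ := h
      obtain ⟨q', h⟩ := d.exists_isPred hq hi
      simp only [d.capLow_eq h]
      exact (hup i).max (hc h.1)
    · push Not at h
      simp only [d.capLow_eq_self (fun q h1 h2 => absurd (h q h1) (not_le.2 h2))]
      exact hup i
  have := measurable_from_prod_countable_right (f := fun r : ℕ × (ℝ × ℝ) =>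
    d.capLow (T.c r.2.1) r.1 (d.capUp (T.c r.2.1) r.1 (d.X r.2.2 r.2.1))) hlow
  exact this.comp ((d.measurable_idx.comp measurable_snd).prodMk measurable_id)

theorem measurable_pos_right (t : ℝ) : Measurable (T.pos t) :=
  T.measurable_pos.comp (measurable_const.prodMk measurable_id)

theorem pos_zero (y : ℝ) : T.pos 0 y = y := by
  rw [pos, T.c_zero, chi_zero]

theorem lip_pos {B s t : ℝ} (h0 : 0 ≤ s) (hst : s ≤ t) (ht : t ≤ B) (y : ℝ) :
    |T.pos t y - T.pos s y| ≤ d.L B * (t - s) := by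
  have hup : |d.capUp (T.c t) (d.idx y) (d.X y t) - d.capUp (T.c s) (d.idx y) (d.X y s)| ≤
      d.L B * (t - s) := by
    by_cases h : ∃ q, d.D q ∧ d.idx y ≤ q
    · obtain ⟨q, hq, hi⟩ := h
      obtain ⟨q', h⟩ := d.exists_isSucc hq hi
      rw [d.capUp_eq h, d.capUp_eq h]
      exact (abs_min_sub_min_le_max _ _ _ _).trans
        (max_le (d.abs_X_sub_le y h0 hst ht) (T.lip_c h0 hst ht h.1))
    · push Not at h
      rw [d.capUp_eq_self (fun q h1 h2 => absurd (h q h1) (not_lt.2 h2)),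
        d.capUp_eq_self (fun q h1 h2 => absurd (h q h1) (not_lt.2 h2))]
      exact d.abs_X_sub_le y h0 hst ht
  rw [pos, pos, chi, chi]
  by_cases h : ∃ q, d.D q ∧ q < d.idx y
  · obtain ⟨q, hq, hi⟩ := h
    obtain ⟨q', h⟩ := d.exists_isPred hq hi
    rw [d.capLow_eq h, d.capLow_eq h]
    exact (abs_max_sub_max_le_max _ _ _ _).trans (max_le hup (T.lip_c h0 hst ht h.1))
  · push Not at h
    rw [d.capLow_eq_self (fun q h1 h2 => absurd (h q h1) (not_le.2 h2)),
      d.capLow_eq_self (fun q h1 h2 => absurd (h q h1) (not_le.2 h2))]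
    exact hup

theorem abs_pos_sub_le {B t : ℝ} (h0 : 0 ≤ t) (ht : t ≤ B) (y : ℝ) :
    |T.pos t y - y| ≤ d.L B * B := by
  have := T.lip_pos le_rfl h0 ht y
  rw [T.pos_zero, sub_zero] at this
  exact this.trans (mul_le_mul_of_nonneg_left ht (d.L_nonneg B))

theorem pos_succ_of_le {s t y : ℝ} (h0 : 0 ≤ s) (hst : s ≤ t) {q : ℕ}
    (hq : d.IsSucc (d.idx y) q)
    (h : T.c s q ≤ d.X y s ∨ ∃ p, d.IsPred (d.idx y) p ∧ T.c s p = T.c s q) :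
    T.pos t y = T.c t q := by
  have key := T.slab_induction (r := fun s t =>
    (T.c s q ≤ d.X y s ∨ ∃ p, d.IsPred (d.idx y) p ∧ T.c s p = T.c s q) →
    (T.c t q ≤ d.X y t ∨ ∃ p, d.IsPred (d.idx y) p ∧ T.c t p = T.c t q))
    (fun a b c _ _ _ h1 h2 h => h2 (h1 h)) (fun k s t h1 h2 h3 h4 => ?_) h0 hst h
  · rcases key with h | ⟨p, hp, h⟩
    · exact chi_eq_succ (T.mono_c t) hq h
    · refine le_antisymm (chi_le (T.mono_c t) hq.1 hq.2.1) ?_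
      rw [← h]
      exact chi_ge (T.mono_c t) hp.1 hp.2.1
  · have hk := T.tick_nonneg k
    rcases h4 with h4 | ⟨p, hp, h4⟩
    · by_cases hl : T.Lead t q
      · left
        have hs := hl.of_le (hk.trans h1) h2
        have e1 := hl.eq_gam (h1.trans h2) h3
        have e2 := hs.eq_gam h1 (h2.trans h3)
        have hadm := (adv_adm (T.mono_c _) (τ := s) hq.1 (T.adm k q hq.1) (by
          rw [← T.slab k s h1 (h2.trans h3)]; exact e2)).1
        rw [← T.slab k s h1 (h2.trans h3)] at hadm
        set ℓ := T.lbl k (T.c (T.tick k) q)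
        have hlt : ℓ ≤ d.lab y := by
          by_contra hcon
          rw [not_le] at hcon
          have h5 := hadm (d.idx y) (fun q' hq' hle => not_lt.1 fun hlt =>
            hs.2 q' hq' (hlt.trans_le hq.2.1) (le_antisymm
              (T.mono_c s q' q hq' hq.1 (hlt.le.trans hq.2.1)) hle)) hcon.le
          have h6 := d.Phi_mono hcon.le (hk.trans h1)
          have h7 := d.le_Y_idx y
          simp only [X] at h4
          linarith
        have := d.Phi_sub_le hlt h2
        simp only [gam] at e1 e2
        simp only [X] at h4 ⊢
        linarith
      · right
        have : ∃ q', d.D q' ∧ q' < q ∧ T.c t q' = T.c t q := by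
          by_contra hcon
          push Not at hcon
          exact hl ⟨hq.1, hcon⟩
        obtain ⟨q', hq', hlt, heq⟩ := this
        have hi : q' < d.idx y := not_le.1 fun hle => absurd (hq.2.2 q' hq' hle) (not_le.2 hlt)
        obtain ⟨p, hp⟩ := d.exists_isPred hq' hi
        refine ⟨p, hp, le_antisymm (T.mono_c t p q hp.1 hq.1 (by have := hp.2.1; have := hq.2.1; omega)) ?_⟩
        rw [← heq]
        exact T.mono_c t q' p hq' hp.1 (hp.2.2 q' hq' hi)
    · exact Or.inr ⟨p, hp, T.sticky (hk.trans h1) h2 hp.1 hq.1 h4⟩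

theorem pos_pred_of_le {s t y : ℝ} (h0 : 0 ≤ s) (hst : s ≤ t) {p : ℕ}
    (hp : d.IsPred (d.idx y) p)
    (h : d.X y s ≤ T.c s p ∨ ∃ q, d.IsSucc (d.idx y) q ∧ T.c s q = T.c s p) :
    T.pos t y = T.c t p := by
  have key := T.slab_induction (r := fun s t =>
    (d.X y s ≤ T.c s p ∨ ∃ q, d.IsSucc (d.idx y) q ∧ T.c s q = T.c s p) →
    (d.X y t ≤ T.c t p ∨ ∃ q, d.IsSucc (d.idx y) q ∧ T.c t q = T.c t p))
    (fun a b c _ _ _ h1 h2 h => h2 (h1 h)) (fun k s t h1 h2 h3 h4 => ?_) h0 hst h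
  · rcases key with h | ⟨q, hq, h⟩
    · exact chi_eq_pred (T.mono_c t) hp h
    · refine le_antisymm ?_ (chi_ge (T.mono_c t) hp.1 hp.2.1)
      rw [← h]
      exact chi_le (T.mono_c t) hq.1 hq.2.1
  · have hk := T.tick_nonneg k
    rcases h4 with h4 | ⟨q, hq, h4⟩
    · by_cases hl : ∃ q, d.D q ∧ d.idx y ≤ q ∧ T.c t q = T.c t p
      · right
        obtain ⟨q, hq, hi, heq⟩ := hl
        obtain ⟨q', hq'⟩ := d.exists_isSucc hq hi
        refine ⟨q', hq', le_antisymm ?_ (T.mono_c t p q' hp.1 hq'.1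
          (by have := hp.2.1; have := hq'.2.1; omega))⟩
        rw [← heq]
        exact T.mono_c t q' q hq'.1 hq (hq'.2.2 q hq hi)
      · left
        push Not at hl
        have hpi := hp.2.1
        obtain ⟨a, ha, hap, h7, h8⟩ := adv_leader (c := T.c (T.tick k)) (t := T.tick k)
          (Ω := T.lbl k) (τ := s) hp.1
        have h9 := (adv_adm (T.mono_c _) (τ := s) ha (T.adm k a ha) h8).2 (d.idx y - 1)
        have h10 := adv_ge (c := T.c (T.tick k)) (t := T.tick k) (Ω := T.lbl k) (τ := t) ha hp.1 hap
        rw [← h7, ← T.slab k s h1 (h2.trans h3)] at h9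
        rw [h8, ← T.slab k s h1 (h2.trans h3)] at h7
        rw [← T.slab k t (h1.trans h2) h3] at h10
        rw [show d.idx y - 1 + 1 = d.idx y by omega] at h9
        have hw : d.lab y ≤ T.lbl k (T.c (T.tick k) a) := by
          by_contra hcon
          rw [not_le] at hcon
          have h5 := h9 (fun q hq hle => by
            by_contra hlt
            have hi : d.idx y ≤ q := by omega
            exact hl q hq hi (T.sticky (hk.trans h1) h2 hq hp.1
              (le_antisymm hle (T.mono_c s p q hp.1 hq (by omega))))) hcon.le
          have h6 := d.Phi_mono hcon.le (hk.trans h1)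
          have h11 := d.Y_lt_of_lt_idx (y := y) (j := d.idx y - 1) (by omega)
          simp only [X] at h4
          linarith
        have := d.Phi_sub_le hw h2
        simp only [gam] at h7 h10
        simp only [X] at h4 ⊢
        linarith
    · exact Or.inr ⟨q, hq, T.sticky (hk.trans h1) h2 hq.1 hp.1 h4⟩

/-- Absorbed mass stays in its wave. -/
theorem pos_sticky {s t y : ℝ} (h0 : 0 ≤ s) (hst : s ≤ t) {p : ℕ} (hp : d.D p)
    (h : T.pos s y = T.c s p) : T.pos t y = T.c t p := by
  have hm := T.mono_c s
  rcases lt_or_ge p (d.idx y) with hi | hi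
  · obtain ⟨p', hp'⟩ := d.exists_isPred hp hi
    have heq : T.c s p' = T.c s p := le_antisymm
      ((chi_ge hm hp'.1 hp'.2.1).trans h.le) (hm p p' hp hp'.1 (hp'.2.2 p hp hi))
    rw [← T.sticky h0 hst hp'.1 hp heq]
    refine T.pos_pred_of_le h0 hst hp' ?_
    rw [← heq] at h
    rcases chi_cases (T.c s) s y with h1 | ⟨q, h1, h2, -⟩ | ⟨p₁, h1, h2, h3⟩
    · exact Or.inl (h1.symm.trans h).le
    · exact Or.inr ⟨q, h1, h2.symm.trans h⟩
    · rw [← h2, show d.chi (T.c s) s y = T.c s p' from h] at h3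
      by_cases hs : ∃ q, d.D q ∧ d.idx y ≤ q
      · obtain ⟨q, hq, hiq⟩ := hs
        obtain ⟨q', hq'⟩ := d.exists_isSucc hq hiq
        rw [d.capUp_eq hq', min_le_iff] at h3
        refine h3.imp (fun h => h) fun h4 => ⟨q', hq', le_antisymm h4 ?_⟩
        exact h.symm.le.trans (chi_le hm hq'.1 hq'.2.1)
      · push Not at hs
        rw [d.capUp_eq_self (fun q h1 h2 => absurd (hs q h1) (not_lt.2 h2))] at h3
        exact Or.inl h3
  · obtain ⟨q', hq'⟩ := d.exists_isSucc hp hi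
    have heq : T.c s q' = T.c s p := le_antisymm (hm q' p hq'.1 hp (hq'.2.2 p hp hi))
      (h.symm.le.trans (chi_le hm hq'.1 hq'.2.1))
    rw [← T.sticky h0 hst hq'.1 hp heq]
    refine T.pos_succ_of_le h0 hst hq' ?_
    rw [← heq] at h
    rcases chi_cases (T.c s) s y with h1 | ⟨q, h1, h2, h3⟩ | ⟨p₁, h1, h2, -⟩
    · exact Or.inl (h.symm.trans h1).le
    · rw [← h2, show d.chi (T.c s) s y = T.c s q' from h] at h3
      exact Or.inl h3
    · exact Or.inr ⟨p₁, h1, h2.symm.trans h⟩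

/-- The labels whose mass is at `x` at time `t`. -/
def fib (t x : ℝ) : Set ℝ := {y | T.pos t y = x}

theorem measurableSet_fib (t x : ℝ) : MeasurableSet (T.fib t x) :=
  T.measurable_pos_right t (measurableSet_singleton x)

theorem fib_subset {B t : ℝ} (h0 : 0 ≤ t) (ht : t ≤ B) (x : ℝ) :
    T.fib t x ⊆ Icc (x - d.L B * B) (x + d.L B * B) := fun y hy => by
  have := abs_le.1 (T.abs_pos_sub_le h0 ht y)
  have hy' : T.pos t y = x := hy
  constructor <;> linarith [this.1, this.2]

theorem volume_fib_lt_top {t : ℝ} (h0 : 0 ≤ t) (x : ℝ) : volume (T.fib t x) < ⊤ :=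
  (measure_mono (T.fib_subset h0 le_rfl x)).trans_lt (by simp)

theorem integrableOn_of_bdd {S : Set ℝ} (hS : volume S < ⊤) {g : ℝ → ℝ} (hg : Measurable g)
    {C : ℝ} (hC : ∀ y, |g y| ≤ C) : IntegrableOn g S := by
  have : IsFiniteMeasure (volume.restrict S) := ⟨by simpa using hS⟩
  exact Integrable.of_bound hg.aestronglyMeasurable C (Eventually.of_forall fun y => hC y)

theorem abs_rho_le (y : ℝ) : |d.rho y| ≤ d.Vb := by
  rw [abs_of_pos (d.rho_pos y)]; exact d.rho_le y

theorem abs_rho_mul_le {ℓ C : ℝ} (y : ℝ) (hℓ : |d.lab y - ℓ| ≤ C) :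
    |d.rho y * (d.lab y - ℓ)| ≤ d.Vb * C := by
  rw [abs_mul]
  exact mul_le_mul (abs_rho_le y) hℓ (abs_nonneg _) d.Vb_pos.le

theorem abs_lab_sub_le (y ℓ : ℝ) : |d.lab y - ℓ| ≤ d.Wb + |ℓ| :=
  (abs_sub _ _).trans (add_le_add_left (d.abs_lab_le y) _)

theorem measurable_rho_lab (ℓ : ℝ) : Measurable fun y => d.rho y * (d.lab y - ℓ) :=
  d.measurable_rho.mul (d.measurable_lab.sub measurable_const)

theorem integrableOn_rho {S : Set ℝ} (hS : volume S < ⊤) : IntegrableOn d.rho S :=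
  integrableOn_of_bdd hS d.measurable_rho abs_rho_le

theorem integrableOn_rho_lab {S : Set ℝ} (hS : volume S < ⊤) (ℓ : ℝ) :
    IntegrableOn (fun y => d.rho y * (d.lab y - ℓ)) S :=
  integrableOn_of_bdd hS (measurable_rho_lab ℓ) fun y => abs_rho_mul_le y (abs_lab_sub_le y ℓ)

/-- The mass concentrated at `x` at time `t`. -/
def mass (t x : ℝ) : ℝ := ∫ y in T.fib t x, d.rho y

theorem mass_nonneg (t x : ℝ) : 0 ≤ T.mass t x := integral_nonneg fun y => (d.rho_pos y).le

theorem setIntegral_rho_le {S : Set ℝ} {b : ℝ} (hb : 0 ≤ b) (hS : volume S ≤ ENNReal.ofReal b) :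
    ∫ y in S, d.rho y ≤ d.Vb * b := by
  have h1 : volume S < ⊤ := hS.trans_lt ENNReal.ofReal_lt_top
  have h2 := norm_setIntegral_le_of_norm_le_const h1 (f := d.rho) (C := d.Vb)
    fun y _ => abs_rho_le y
  refine (le_abs_self _).trans (h2.trans (mul_le_mul_of_nonneg_left ?_ d.Vb_pos.le))
  exact ENNReal.toReal_le_of_le_ofReal hb hS

theorem mass_le {B t : ℝ} (h0 : 0 ≤ t) (ht : t ≤ B) (x : ℝ) :
    T.mass t x ≤ d.Vb * (2 * (d.L B * B)) := by
  have hB : 0 ≤ d.L B * B := mul_nonneg (d.L_nonneg B) (h0.trans ht)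
  refine setIntegral_rho_le (by linarith) ((measure_mono (T.fib_subset h0 ht x)).trans ?_)
  rw [Real.volume_Icc]
  exact ENNReal.ofReal_le_ofReal (by linarith)

/-- The labels that are at `x` at time `t`, but were free at time `s`. -/
def inc (s t x : ℝ) : Set ℝ := {y | T.pos t y = x ∧ ∀ q, d.D q → T.pos s y ≠ T.c s q}

theorem measurableSet_inc (s t x : ℝ) : MeasurableSet (T.inc s t x) := by
  have : T.inc s t x = T.fib t x ∩ ⋂ q : ℕ, {y | d.D q → T.pos s y ≠ T.c s q} := by
    ext y; simp [inc, fib]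
  rw [this]
  refine (T.measurableSet_fib t x).inter (MeasurableSet.iInter fun q => ?_)
  by_cases hq : d.D q
  · simp only [hq, true_imp_iff]
    exact (T.measurableSet_fib s _).compl
  · simp [hq]

theorem volume_inc_le {B s t : ℝ} (h0 : 0 ≤ s) (hst : s ≤ t) (ht : t ≤ B) (x : ℝ) :
    volume (T.inc s t x) ≤ ENNReal.ofReal (2 * (d.L B * (t - s))) := by
  refine (volume_le_of_free (T.mono_c s) h0 (T.measurableSet_inc s t x) (fun y hy => hy.2)
    (S := Icc (x - d.L B * (t - s)) (x + d.L B * (t - s))) fun y hy => ?_).trans ?_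
  · rw [← (chi_free (T.mono_c s) hy.2).1]
    have := abs_le.1 (T.lip_pos h0 hst ht y)
    rw [hy.1] at this
    change T.pos s y ∈ _
    constructor <;> linarith [this.1, this.2]
  · rw [Real.volume_Icc]
    exact ENNReal.ofReal_le_ofReal (by linarith)

open Classical in
/-- The labels at `x = c t p` are those of the waves that have merged there, and those absorbed
in the meantime. -/
theorem fib_eq {s t : ℝ} (h0 : 0 ≤ s) (hst : s ≤ t) {x : ℝ} {M : Finset ℕ}
    (hM : ∀ q, q ∈ M ↔ d.D q ∧ T.c t q = x) :
    T.fib t x = (⋃ z ∈ M.image (T.c s), T.fib s z) ∪ T.inc s t x := by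
  ext y
  constructor
  · intro hy
    by_cases h : ∃ q, d.D q ∧ T.pos s y = T.c s q
    · left
      obtain ⟨q, hq, h⟩ := h
      have h1 := T.pos_sticky h0 hst hq h
      have h2 : T.pos t y = x := hy
      exact mem_biUnion (Finset.mem_coe.2 (Finset.mem_image_of_mem _
        ((hM q).2 ⟨hq, h1.symm.trans h2⟩))) h
    · push Not at h
      exact Or.inr ⟨hy, h⟩
  · rintro (hy | hy)
    · obtain ⟨z, hz, hy⟩ := mem_iUnion₂.1 hy
      obtain ⟨q, hq, rfl⟩ := Finset.mem_image.1 hz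
      have := (hM q).1 hq
      exact (T.pos_sticky h0 hst this.1 hy).trans this.2
    · exact hy.1

open Classical in
theorem integral_fib {s t : ℝ} (h0 : 0 ≤ s) (hst : s ≤ t) {x : ℝ} {M : Finset ℕ}
    (hM : ∀ q, q ∈ M ↔ d.D q ∧ T.c t q = x) {g : ℝ → ℝ} (hg : IntegrableOn g (T.fib t x)) :
    ∫ y in T.fib t x, g y =
      (∑ z ∈ M.image (T.c s), ∫ y in T.fib s z, g y) + ∫ y in T.inc s t x, g y := by
  have heq := T.fib_eq h0 hst hM
  have hsub1 : (⋃ z ∈ M.image (T.c s), T.fib s z) ⊆ T.fib t x := heq ▸ subset_union_left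
  have hsub2 : T.inc s t x ⊆ T.fib t x := heq ▸ subset_union_right
  have hdisj : Disjoint (⋃ z ∈ M.image (T.c s), T.fib s z) (T.inc s t x) := by
    rw [Set.disjoint_left]
    intro y hy hy'
    obtain ⟨z, hz, hy⟩ := mem_iUnion₂.1 hy
    obtain ⟨q, hq, rfl⟩ := Finset.mem_image.1 hz
    exact hy'.2 q ((hM q).1 hq).1 hy
  rw [heq, setIntegral_union hdisj (T.measurableSet_inc s t x) (hg.mono_set hsub1)
    (hg.mono_set hsub2), integral_biUnion_finset]
  · exact fun z _ => T.measurableSet_fib s z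
  · intro z _ z' _ hne
    exact Set.disjoint_left.2 fun y hy hy' => hne (hy.symm.trans hy')
  · intro z hz
    exact hg.mono_set ((subset_biUnion_of_mem (u := fun z => T.fib s z) hz).trans hsub1)

end Track
end StepData

namespace StepData

namespace Track

variable {d : StepData} (T : Track d)

/-! ### Conservation of momentum, up to a small error -/

/-- The momentum defect of the mass at `x`, if it moves with label `ℓ`. -/
def dev (t x ℓ : ℝ) : ℝ := ∫ y in T.fib t x, d.rho y * (d.lab y - ℓ)

theorem dev_eq_add {t : ℝ} (ht : 0 ≤ t) (x ℓ ℓ' : ℝ) :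
    T.dev t x ℓ' = T.dev t x ℓ + (ℓ - ℓ') * T.mass t x := by
  have hv := T.volume_fib_lt_top ht x
  rw [dev, dev, mass, ← integral_const_mul, ← integral_add (integrableOn_rho_lab hv ℓ)
    ((integrableOn_rho hv).const_mul _)]
  exact integral_congr_ae (Eventually.of_forall fun y => by simp only; ring)

theorem dev_eq_mul {t : ℝ} (ht : 0 ≤ t) (x ℓ : ℝ) :
    T.dev t x ℓ = (d.mean (T.c t) t x - ℓ) * T.mass t x := by
  rw [T.dev_eq_add ht x 0 ℓ]
  have h0 : T.dev t x 0 = ∫ y in T.fib t x, d.rho y * d.lab y := by simp [dev]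
  have hmean : d.mean (T.c t) t x = (∫ y in T.fib t x, d.rho y * d.lab y) / T.mass t x := rfl
  by_cases hm : T.mass t x = 0
  · have : |T.dev t x 0| ≤ d.Wb * T.mass t x := by
      rw [mass, ← integral_const_mul, ← Real.norm_eq_abs]
      refine norm_integral_le_of_norm_le
        ((integrableOn_rho (T.volume_fib_lt_top ht x)).const_mul _) (Eventually.of_forall fun y => ?_)
      rw [Real.norm_eq_abs, abs_mul, abs_of_pos (d.rho_pos y), sub_zero, mul_comm]
      exact mul_le_mul_of_nonneg_right (d.abs_lab_le y) (d.rho_pos y).le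
    rw [hm, mul_zero] at this
    rw [abs_nonpos_iff.1 this, hm]; ring
  · rw [h0, hmean]; field_simp; ring

/-- The mass that a wave absorbs between two updates. -/
def absMass (d : StepData) (B δ : ℝ) : ℝ := d.Vb * (2 * (d.L B * δ))

theorem absMass_nonneg (d : StepData) (B : ℝ) {δ : ℝ} (hδ : 0 ≤ δ) : 0 ≤ absMass d B δ :=
  mul_nonneg d.Vb_pos.le (by have := d.L_nonneg B; positivity)

theorem integral_inc_le {B s t δ : ℝ} (h0 : 0 ≤ s) (hst : s ≤ t) (ht : t ≤ B) (hδ : t ≤ s + δ)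
    (x : ℝ) : ∫ y in T.inc s t x, d.rho y ≤ absMass d B δ := by
  have hL := d.L_nonneg B
  have hδ0 : 0 ≤ δ := by linarith
  refine setIntegral_rho_le (by positivity)
    ((T.volume_inc_le h0 hst ht x).trans (ENNReal.ofReal_le_ofReal ?_))
  have := mul_le_mul_of_nonneg_left (show t - s ≤ δ by linarith) hL
  linarith

theorem integral_inc_nonneg (s t x : ℝ) : 0 ≤ ∫ y in T.inc s t x, d.rho y :=
  integral_nonneg fun y => (d.rho_pos y).le

theorem volume_inc_lt_top {s t : ℝ} (h0 : 0 ≤ s) (hst : s ≤ t) (x : ℝ) :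
    volume (T.inc s t x) < ⊤ :=
  (measure_mono fun _ hy => hy.1).trans_lt (T.volume_fib_lt_top (h0.trans hst) x)

theorem integral_inc_lab_le {s t : ℝ} (h0 : 0 ≤ s) (hst : s ≤ t) (x : ℝ) {σ ℓ C : ℝ}
    (h : ∀ y ∈ T.inc s t x, σ * (d.lab y - ℓ) ≤ C) :
    σ * ∫ y in T.inc s t x, d.rho y * (d.lab y - ℓ) ≤ C * ∫ y in T.inc s t x, d.rho y := by
  have hv := T.volume_inc_lt_top h0 hst x
  rw [← integral_const_mul, ← integral_const_mul]
  refine setIntegral_mono_on ((integrableOn_rho_lab hv ℓ).const_mul _)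
    ((integrableOn_rho hv).const_mul _) (T.measurableSet_inc s t x) fun y hy => ?_
  have := mul_le_mul_of_nonneg_left (h y hy) (d.rho_pos y).le
  linarith

theorem abs_mul_lab_sub_le {σ ℓ : ℝ} (hσ : |σ| ≤ 1) (hℓ : |ℓ| ≤ d.Wb) (y : ℝ) :
    σ * (d.lab y - ℓ) ≤ 2 * d.Wb := by
  refine (le_abs_self _).trans ?_
  rw [abs_mul]
  have := abs_lab_sub_le (d := d) y ℓ
  have h2 := mul_le_mul hσ this (abs_nonneg _) zero_le_one
  linarith

open Classical in
/-- How the momentum defect grows when the waves in `M` merge at `x`. If there are at least two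
of them, the error of order `δ` is charged to the merger. If there is only one, then either the
error starts from zero, or the wave moves with the extremal admissible label and the mass that it
absorbs does not increase the defect. The sign `σ` covers both directions. -/
theorem dev_step {s t B δ : ℝ} (h0 : 0 ≤ s) (hst : s ≤ t) (htB : t ≤ B) (hδ : t ≤ s + δ)
    {x : ℝ} {M : Finset ℕ} (hM : ∀ q, q ∈ M ↔ d.D q ∧ T.c t q = x) (hne : M.Nonempty)
    {σ ℓ' η η' u mb : ℝ} {lb : ℝ → ℝ} (hσ : |σ| ≤ 1) (hℓ' : |ℓ'| ≤ d.Wb) (hu : 0 ≤ u)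
    (hη : 0 ≤ η) (hη' : 0 ≤ η') (hmb : T.mass t x ≤ mb)
    (hz : ∀ z ∈ M.image (T.c s), σ * T.dev s z (lb z) ≤
      (2 * ((M.filter fun q => T.c s q = z).card : ℝ) - 1) * (2 * d.Wb * absMass d B δ) +
        ((M.filter fun q => T.c s q = z).card : ℝ) * u)
    (h1 : ∀ z ∈ M.image (T.c s), σ * lb z ≤ σ * ℓ' + η')
    (h2 : ∀ z, (∀ q ∈ M, T.c s q = z) → σ * T.dev s z (lb z) ≤ 0 ∨
      ∀ y ∈ T.inc s t x, σ * d.lab y ≤ σ * lb z + η) :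
    σ * T.dev t x ℓ' ≤ (2 * (M.card : ℝ) - 1) * (2 * d.Wb * absMass d B δ) + (M.card : ℝ) * u +
      (η + η') * mb := by
  set β := 2 * d.Wb * absMass d B δ with hβ
  set Z := M.image (T.c s)
  set I := T.inc s t x
  have hδ0 : 0 ≤ δ := by linarith
  have hβ0 : 0 ≤ β := mul_nonneg (by have := d.Wb_nonneg; linarith) (absMass_nonneg d B hδ0)
  have hv := T.volume_fib_lt_top (h0.trans hst) x
  have hdev : T.dev t x ℓ' = (∑ z ∈ Z, T.dev s z ℓ') + ∫ y in I, d.rho y * (d.lab y - ℓ') :=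
    T.integral_fib h0 hst hM (integrableOn_rho_lab hv ℓ')
  have hmass : T.mass t x = (∑ z ∈ Z, T.mass s z) + ∫ y in I, d.rho y :=
    T.integral_fib h0 hst hM (integrableOn_rho hv)
  set mI := ∫ y in I, d.rho y
  have hmI0 : 0 ≤ mI := T.integral_inc_nonneg s t x
  have hmI : mI ≤ absMass d B δ := T.integral_inc_le h0 hst htB hδ x
  have hcrude : σ * ∫ y in I, d.rho y * (d.lab y - ℓ') ≤ β := by
    refine (T.integral_inc_lab_le h0 hst x fun y _ => abs_mul_lab_sub_le hσ hℓ' y).trans ?_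
    exact mul_le_mul_of_nonneg_left hmI (by have := d.Wb_nonneg; linarith)
  have hzdev : ∀ z ∈ Z, σ * T.dev s z ℓ' ≤ σ * T.dev s z (lb z) + η' * T.mass s z := fun z hz => by
    rw [T.dev_eq_add h0 z (lb z) ℓ']
    have := mul_le_mul_of_nonneg_right (h1 z hz) (T.mass_nonneg s z)
    linarith
  have hZsum : 0 ≤ ∑ z ∈ Z, T.mass s z := Finset.sum_nonneg fun z _ => T.mass_nonneg s z
  have hM1 : (1 : ℝ) ≤ M.card := by exact_mod_cast hne.card_pos
  have hmu := mul_nonneg (zero_le_one.trans hM1) hu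
  rw [hdev, mul_add, Finset.mul_sum]
  -- the factor `2 * M.card - 1` leaves room for one more absorption when two groups merge
  by_cases hone : ∃ z, ∀ q ∈ M, T.c s q = z
  · obtain ⟨z, hz1⟩ := hone
    have hZ : Z = {z} := by
      refine Finset.eq_singleton_iff_unique_mem.2 ⟨?_, fun w hw => ?_⟩
      · obtain ⟨q, hq⟩ := hne
        exact hz1 q hq ▸ Finset.mem_image_of_mem _ hq
      · obtain ⟨q, hq, rfl⟩ := Finset.mem_image.1 hw
        exact hz1 q hq
    have hzZ : z ∈ Z := by rw [hZ]; simp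
    have hfil : (M.filter fun q => T.c s q = z) = M := Finset.filter_true_of_mem hz1
    have h3 := hz z hzZ
    have h4 := hzdev z hzZ
    rw [hfil] at h3
    rw [hZ, Finset.sum_singleton] at hmass ⊢
    have hmz := T.mass_nonneg s z
    have h6 : η' * T.mass s z + (η + η') * mI ≤ (η + η') * mb := by
      have := mul_le_mul_of_nonneg_left (hmass ▸ hmb) (add_nonneg hη hη')
      have := mul_nonneg hη hmz
      linarith
    have h7 : 0 ≤ (η + η') * mI := mul_nonneg (add_nonneg hη hη') hmI0
    rcases h2 z hz1 with h5 | h5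
    · have : β ≤ (2 * (M.card : ℝ) - 1) * β := le_mul_of_one_le_left hβ0 (by linarith)
      linarith
    · have := T.integral_inc_lab_le h0 hst x (σ := σ) (ℓ := ℓ') (C := η + η') fun y hy => by
        linarith [h5 y hy, h1 z hzZ]
      linarith
  · have hZ2 : (2 : ℝ) ≤ Z.card := by
      have : 1 < Z.card := by
        rw [Finset.one_lt_card]
        obtain ⟨q, hq⟩ := hne
        push Not at hone
        obtain ⟨q', hq', hne'⟩ := hone (T.c s q)
        exact ⟨_, Finset.mem_image_of_mem _ hq', _, Finset.mem_image_of_mem _ hq, hne'⟩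
      exact_mod_cast this
    have hcard : ∑ z ∈ Z, ((M.filter fun q => T.c s q = z).card : ℝ) = M.card := by
      rw [Finset.card_eq_sum_card_image (T.c s) M]
      push_cast
      rfl
    have hsum : ∑ z ∈ Z, σ * T.dev s z ℓ' ≤
        (2 * (M.card : ℝ) - Z.card) * β + M.card * u + η' * ∑ z ∈ Z, T.mass s z := by
      calc ∑ z ∈ Z, σ * T.dev s z ℓ' ≤ ∑ z ∈ Z,
            ((2 * ((M.filter fun q => T.c s q = z).card : ℝ) - 1) * β +
            ((M.filter fun q => T.c s q = z).card : ℝ) * u + η' * T.mass s z) :=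
            Finset.sum_le_sum fun z hz' => by linarith [hzdev z hz', hz z hz']
        _ = _ := by
          rw [Finset.sum_add_distrib, Finset.sum_add_distrib, ← Finset.sum_mul, ← Finset.sum_mul,
            Finset.sum_sub_distrib, ← Finset.mul_sum, ← Finset.mul_sum, hcard]
          simp
    have h6 : η' * ∑ z ∈ Z, T.mass s z ≤ (η + η') * mb := by
      have h8 : ∑ z ∈ Z, T.mass s z ≤ mb := by linarith
      have h9 := mul_le_mul_of_nonneg_left h8 hη'
      have h10 := mul_nonneg hη (hZsum.trans h8)
      linarith
    have h7 : (2 * (M.card : ℝ) - Z.card) * β ≤ (2 * (M.card : ℝ) - 2) * β :=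
      mul_le_mul_of_nonneg_right (by linarith) hβ0
    linarith

/-- A wave that is slower than the average label of its mass demands is held up by the state on
its left; the mass that it absorbs is not faster. -/
theorem lab_le_of_inc {s t : ℝ} (h0 : 0 ≤ s) (hst : s ≤ t) {p : ℕ} (hp : d.D p) {ℓ ℓ₁ : ℝ}
    (hz : ∀ q, d.D q → T.c t q = T.c t p → T.c s q = T.c s p)
    (hmove : T.c t p = T.c s p + (d.Phi ℓ t - d.Phi ℓ s))
    (hadm : ¬ d.LAdm (T.c s) s (T.c s p) ℓ₁) {y : ℝ} (hy : y ∈ T.inc s t (T.c t p)) :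
    d.lab y ≤ ℓ ∨ d.lab y ≤ ℓ₁ := by
  obtain ⟨hfree, hlow, hup⟩ := chi_free (T.mono_c s) hy.2
  have hyt : d.chi (T.c t) t y = T.c t p := hy.1
  have hne : d.X y s ≠ T.c s p := fun h => hy.2 p hp (hfree.trans h)
  by_contra hcon
  push Not at hcon
  rcases hne.lt_or_gt with hlt | hlt
  · simp only [LAdm] at hadm
    push Not at hadm
    obtain ⟨j, hj, hwj, hle⟩ := hadm
    have hij : d.idx y ≤ j := by
      by_contra hlt'
      have h1 := d.Y_lt_of_lt_idx (not_le.1 hlt')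
      have h2 := d.Phi_mono hcon.2.le h0
      simp only [X] at hlt
      linarith
    refine absurd (d.w_mono_of_not_D hij fun q hq1 hq2 hq => ?_) (not_le.2 (hwj.trans_lt hcon.2))
    have hqz : T.c s q < T.c s p := not_le.1 fun h => absurd (hj q hq h) (not_le.2 hq2)
    have hqp : q < p := not_le.1 fun h => absurd (T.mono_c s p q hp hq h) (not_le.2 hqz)
    have h1 := chi_le (T.mono_c t) (t := t) hq hq1
    rw [hyt] at h1
    have h2 := hz q hq (le_antisymm (T.mono_c t q p hq hp hqp.le) h1)
    exact absurd h2 hqz.ne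
  · have hX : T.c t p < d.X y t := by
      have := d.Phi_sub_le hcon.1.le hst
      simp only [X] at hlt ⊢
      linarith
    have hsucc : ∀ q, d.D q → d.idx y ≤ q → T.c t q ≠ T.c t p := fun q hq hi heq => by
      have := hz q hq heq
      linarith [hup q hq hi]
    rcases chi_cases (T.c t) t y with h | ⟨q, h1, h2, -⟩ | ⟨p₀, h1, h2, h3⟩
    · linarith
    · exact hsucc q h1.1 h1.2.1 (h2.symm.trans hyt)
    · by_cases hs : ∃ q, d.D q ∧ d.idx y ≤ q
      · obtain ⟨q, hq, hi⟩ := hs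
        obtain ⟨q', hq'⟩ := d.exists_isSucc hq hi
        rw [d.capUp_eq hq', ← h2, hyt, min_le_iff] at h3
        rcases h3 with h3 | h3
        · linarith
        · refine hsucc q' hq'.1 hq'.2.1 (le_antisymm h3 ?_)
          rw [← hyt]
          exact chi_le (T.mono_c t) hq'.1 hq'.2.1
      · push Not at hs
        rw [d.capUp_eq_self (fun q h1 h2 => absurd (hs q h1) (not_lt.2 h2)), ← h2, hyt] at h3
        linarith

/-- The counterpart of `lab_le_of_inc` on the right. -/
theorem le_lab_of_inc {s t : ℝ} (h0 : 0 ≤ s) (hst : s ≤ t) {p : ℕ} (hp : d.D p) {ℓ ℓ₁ : ℝ}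
    (hz : ∀ q, d.D q → T.c t q = T.c t p → T.c s q = T.c s p)
    (hmove : T.c t p = T.c s p + (d.Phi ℓ t - d.Phi ℓ s))
    (hadm : ¬ d.RAdm (T.c s) s (T.c s p) ℓ₁) {y : ℝ} (hy : y ∈ T.inc s t (T.c t p)) :
    ℓ ≤ d.lab y ∨ ℓ₁ ≤ d.lab y := by
  obtain ⟨hfree, hlow, hup⟩ := chi_free (T.mono_c s) hy.2
  have hyt : d.chi (T.c t) t y = T.c t p := hy.1
  have hne : d.X y s ≠ T.c s p := fun h => hy.2 p hp (hfree.trans h)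
  by_contra hcon
  push Not at hcon
  rcases hne.lt_or_gt with hlt | hlt
  · have hX : d.X y t < T.c t p := by
      have := d.Phi_sub_le hcon.1.le hst
      simp only [X] at hlt ⊢
      linarith
    rcases chi_cases (T.c t) t y with h | ⟨q, h1, h2, h3⟩ | ⟨p₀, h1, h2, -⟩
    · linarith
    · rw [← h2, hyt] at h3
      linarith
    · have := hz p₀ h1.1 (h2.symm.trans hyt)
      linarith [hlow p₀ h1.1 h1.2.1]
  · simp only [RAdm] at hadm
    push Not at hadm
    obtain ⟨j, hj, hwj, hle⟩ := hadm
    have hij : j < d.idx y := by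
      by_contra hle'
      have h1 := d.idx_le_iff.1 (not_lt.1 hle')
      have h2 := d.Phi_mono hcon.2.le h0
      simp only [X] at hlt
      linarith
    refine absurd (d.w_mono_of_not_D (show j + 1 ≤ d.idx y by omega) fun q hq1 hq2 hq => ?_)
      (not_le.2 (hcon.2.trans_le hwj))
    have hqz : T.c s p < T.c s q := not_le.1 fun h => absurd (hj q hq h) (by omega)
    have hpq : p < q := not_le.1 fun h => absurd (T.mono_c s q p hq hp h) (not_le.2 hqz)
    have h1 := chi_ge (T.mono_c t) (t := t) hq hq2
    rw [hyt] at h1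
    have h2 := hz q hq (le_antisymm h1 (T.mono_c t p q hp hq hpq.le))
    exact absurd h2 hqz.ne'

open Classical in
/-- The waves with index at most `N` that are at `x`. -/
def members (N : ℕ) (t x : ℝ) : Finset ℕ :=
  (Finset.range (N + 1)).filter fun q => d.D q ∧ T.c t q = x

theorem mem_members {N : ℕ} {t x : ℝ} {q : ℕ} :
    q ∈ T.members N t x ↔ q ≤ N ∧ d.D q ∧ T.c t q = x := by
  simp [members]

/-- A bound for the mass of a wave up to time `B`. -/
def massBound (d : StepData) (B : ℝ) : ℝ := d.Vb * (2 * (d.L B * B))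

variable {T} in
theorem Accurate.c_eq {N : ℕ} {δ e : ℝ} (hT : T.Accurate N δ e) {k : ℕ} {t : ℝ}
    (h1 : T.tick k ≤ t) (h2 : t ≤ T.tick (k + 1)) {p : ℕ} (hp : d.D p) (hpN : p ≤ N) :
    T.c t p = d.gam (T.c (T.tick k)) (T.tick k) (T.lbl k) t p := by
  rw [T.slab k t h1 h2]
  exact (hT.noColl k).adv_eq (T.mono_c _) hp hpN h1 h2

variable {T} in
/-- The momentum defect of a wave at an update time. The bound is proved by induction on the
updates: it grows only with the number of waves that have merged, not with the number of
updates. -/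
theorem Accurate.abs_dev_tick_le {N : ℕ} {δ e : ℝ} (hT : T.Accurate N δ e) (he : 0 < e)
    {B : ℝ} (k : ℕ) (hk : T.tick k ≤ B) {p : ℕ} (hp : d.D p)
    (hN : ∀ q, d.D q → T.c (T.tick k) q = T.c (T.tick k) p → q ≤ N) {σ : ℝ} (hσ : |σ| = 1) :
    σ * T.dev (T.tick k) (T.c (T.tick k) p) (T.lbl k (T.c (T.tick k) p)) ≤
      (2 * ((T.members N (T.tick k) (T.c (T.tick k) p)).card : ℝ) - 1) *
        (2 * d.Wb * absMass d B δ) +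
      ((T.members N (T.tick k) (T.c (T.tick k) p)).card : ℝ) *
        (4 * massBound d B * e * (1 - (1 / 2) ^ k)) := by
  have hδ : 0 ≤ δ := by linarith [T.tick_lt 0, hT.tick_le 0]
  have hβ0 : 0 ≤ 2 * d.Wb * absMass d B δ :=
    mul_nonneg (by have := d.Wb_nonneg; linarith) (absMass_nonneg d B hδ)
  have hB : 0 ≤ B := (T.tick_nonneg k).trans hk
  have hmb : 0 ≤ massBound d B :=
    mul_nonneg d.Vb_pos.le (by have := d.L_nonneg B; positivity)
  induction k generalizing p with
  | zero =>
    have hM1 : (1 : ℝ) ≤ (T.members N (T.tick 0) (T.c (T.tick 0) p)).card := by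
      have : 0 < (T.members N (T.tick 0) (T.c (T.tick 0) p)).card :=
        Finset.card_pos.2 ⟨p, T.mem_members.2 ⟨hN p hp rfl, hp, rfl⟩⟩
      exact_mod_cast this
    have hzero : T.dev (T.tick 0) (T.c (T.tick 0) p) (T.lbl 0 (T.c (T.tick 0) p)) = 0 := by
      have : T.fib (T.tick 0) (T.c (T.tick 0) p) = {T.c (T.tick 0) p} := by
        ext y; simp [fib, T.tick_zero, T.pos_zero]
      rw [dev, this]
      simp
    rw [hzero, mul_zero]
    have := mul_nonneg (show (0 : ℝ) ≤ 2 * ((T.members N (T.tick 0)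
      (T.c (T.tick 0) p)).card : ℝ) - 1 by linarith) hβ0
    simpa using this
  | succ k ih =>
    classical
    set s := T.tick k with hs
    set t := T.tick (k + 1) with ht
    set x := T.c t p with hx
    have h0 : 0 ≤ s := T.tick_nonneg k
    have hst : s ≤ t := (T.tick_lt k).le
    set M := T.members N t x with hMdef
    have hM : ∀ q, q ∈ M ↔ d.D q ∧ T.c t q = x := fun q => by
      rw [hMdef, T.mem_members]
      exact ⟨fun h => h.2, fun h => ⟨hN q h.1 h.2, h⟩⟩
    have hMN : ∀ q ∈ M, q ≤ N := fun q hq => (T.mem_members.1 hq).1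
    have hpM : p ∈ M := (hM p).2 ⟨hp, rfl⟩
    have hcq : ∀ q ∈ M, T.c t q = d.gam (T.c s) s (T.lbl k) t q := fun q hq =>
      hT.c_eq hst le_rfl ((hM q).1 hq).1 (hMN q hq)
    have hadm : ∀ q ∈ M, d.LAdm (T.c t) t x (T.lbl k (T.c s q)) ∧
        d.RAdm (T.c t) t x (T.lbl k (T.c s q)) := fun q hq => by
      have h1 := adv_adm (T.mono_c _) (τ := t) ((hM q).1 hq).1 (T.adm k q ((hM q).1 hq).1) (by
        rw [← T.slab k t hst le_rfl]; exact hcq q hq)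
      rwa [← T.slab k t hst le_rfl, ((hM q).1 hq).2] at h1
    set η := e * (1 / 2 : ℝ) ^ k with hη
    set η' := e * (1 / 2 : ℝ) ^ (k + 1) with hη'
    have hη0 : 0 < η := by positivity
    have hη0' : 0 < η' := by positivity
    have hηη : η' = η / 2 := by rw [hη', hη, pow_succ]; ring
    set u := 4 * massBound d B * e * (1 - (1 / 2 : ℝ) ^ k) with hu
    have hu0 : 0 ≤ u := mul_nonneg (by positivity)
      (sub_nonneg.2 (pow_le_one₀ (by norm_num) (by norm_num)))
    have huu : 4 * massBound d B * e * (1 - (1 / 2 : ℝ) ^ (k + 1)) =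
        u + 4 * massBound d B * η' := by
      rw [hu, hη', pow_succ]; ring
    have hM1 : (1 : ℝ) ≤ M.card := by exact_mod_cast Finset.card_pos.2 ⟨p, hpM⟩
    have hmass : T.mass t x ≤ massBound d B := T.mass_le (h0.trans hst) hk x
    have hnear := hT.near (k + 1) p hp
    rw [← ht, ← hx] at hnear
    set ℓ' := T.lbl (k + 1) x
    have hℓ' : |ℓ'| ≤ d.Wb := T.lbl_le _ _
    have hfinal : (2 * (M.card : ℝ) - 1) * (2 * d.Wb * absMass d B δ) + (M.card : ℝ) * u +
        (η + η') * massBound d B ≤ (2 * (M.card : ℝ) - 1) * (2 * d.Wb * absMass d B δ) +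
        (M.card : ℝ) * (4 * massBound d B * e * (1 - (1 / 2 : ℝ) ^ (k + 1))) := by
      rw [huu]
      have h3 : 4 * massBound d B * η' ≤ M.card * (4 * massBound d B * η') :=
        le_mul_of_one_le_left (by positivity) hM1
      have h4 : 0 ≤ massBound d B * η' := by positivity
      have : η = 2 * η' := by linarith
      rw [this]
      linarith
    have hdev0 : 0 ≤ (2 * (M.card : ℝ) - 1) * (2 * d.Wb * absMass d B δ) +
        (M.card : ℝ) * (4 * massBound d B * e * (1 - (1 / 2 : ℝ) ^ (k + 1))) := by
      rw [huu]
      have := mul_nonneg (show 0 ≤ 2 * (M.card : ℝ) - 1 by linarith) hβ0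
      positivity
    have hmean : T.dev t x ℓ' = (d.mean (T.c t) t x - ℓ') * T.mass t x :=
      T.dev_eq_mul (h0.trans hst) x ℓ'
    have hm0 := T.mass_nonneg t x
    have hIH : ∀ z ∈ M.image (T.c s), σ * T.dev s z (T.lbl k z) ≤
        (2 * ((M.filter fun q => T.c s q = z).card : ℝ) - 1) * (2 * d.Wb * absMass d B δ) +
          ((M.filter fun q => T.c s q = z).card : ℝ) * u := by
      intro z hz
      obtain ⟨q, hq, rfl⟩ := Finset.mem_image.1 hz
      have hqD := (hM q).1 hq
      have hstick : ∀ r, d.D r → T.c s r = T.c s q → r ∈ M := fun r hr heq =>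
        (hM r).2 ⟨hr, (T.sticky h0 hst hr hqD.1 heq).trans hqD.2⟩
      have h3 := ih (hst.trans hk) hqD.1 (fun r hr heq => hMN r (hstick r hr heq))
      have h4 : T.members N s (T.c s q) = M.filter fun r => T.c s r = T.c s q := by
        ext r
        rw [T.mem_members, Finset.mem_filter]
        exact ⟨fun h => ⟨hstick r h.2.1 h.2.2, h.2.2⟩,
          fun h => ⟨hMN r h.1, ((hM r).1 h.1).1, h.2⟩⟩
      rwa [h4] at h3
    have hsingle : ∀ z, (∀ q ∈ M, T.c s q = z) → z = T.c s p ∧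
        ∀ q, d.D q → T.c t q = T.c t p → T.c s q = T.c s p := fun z hz =>
      ⟨(hz p hpM).symm, fun q hq heq => by rw [hz q ((hM q).2 ⟨hq, heq⟩), hz p hpM]⟩
    have hmove : T.c t p = T.c s p + (d.Phi (T.lbl k (T.c s p)) t - d.Phi (T.lbl k (T.c s p)) s) :=
      hcq p hpM
    have hnear₀ := hT.near k p hp
    rw [← hs] at hnear₀
    have hmean₀ : T.dev s (T.c s p) (T.lbl k (T.c s p)) =
        (d.mean (T.c s) s (T.c s p) - T.lbl k (T.c s p)) * T.mass s (T.c s p) :=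
      T.dev_eq_mul h0 _ _
    have hm0' := T.mass_nonneg s (T.c s p)
    -- unless the momentum defect already has the favourable sign, the new label is extremal, and
    -- all labels with which the waves arrive are admissible, hence at most `η'` beyond it
    rcases eq_or_eq_neg_of_abs_eq hσ with rfl | rfl
    · by_cases hcase : ℓ' < d.mean (T.c t) t x
      · obtain ⟨ℓ₁, hℓ₁, hlt⟩ := hnear.of_lt hcase
        refine (T.dev_step h0 hst hk (hT.tick_le k) hM ⟨p, hpM⟩ (η := η) (η' := η') (mb := massBound d B)
          (by simp) hℓ' hu0 hη0.le hη0'.le hmass hIH ?_ ?_).trans hfinal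
        · intro z hz
          obtain ⟨q, hq, rfl⟩ := Finset.mem_image.1 hz
          have : T.lbl k (T.c s q) < ℓ₁ := not_le.1 fun h =>
            hℓ₁ ((hadm q hq).1.mono (h0.trans hst) h)
          linarith
        · intro z hz
          obtain ⟨rfl, hz'⟩ := hsingle z hz
          by_cases hcase₀ : T.lbl k (T.c s p) < d.mean (T.c s) s (T.c s p)
          · right
            intro y hy
            obtain ⟨ℓ₂, hℓ₂, hlt₂⟩ := hnear₀.of_lt hcase₀
            rcases T.lab_le_of_inc h0 hst hp hz' hmove hℓ₂ hy with h | h <;> linarith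
          · left
            rw [hmean₀, one_mul]
            exact mul_nonpos_of_nonpos_of_nonneg (by linarith) hm0'
      · refine le_trans ?_ hdev0
        rw [hmean, one_mul]
        exact mul_nonpos_of_nonpos_of_nonneg (by linarith) hm0
    · by_cases hcase : d.mean (T.c t) t x < ℓ'
      · obtain ⟨ℓ₁, hℓ₁, hlt⟩ := hnear.of_gt hcase
        refine (T.dev_step h0 hst hk (hT.tick_le k) hM ⟨p, hpM⟩ (η := η) (η' := η') (mb := massBound d B)
          (by simp) hℓ' hu0 hη0.le hη0'.le hmass hIH ?_ ?_).trans hfinal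
        · intro z hz
          obtain ⟨q, hq, rfl⟩ := Finset.mem_image.1 hz
          have : ℓ₁ < T.lbl k (T.c s q) := not_le.1 fun h =>
            hℓ₁ ((hadm q hq).2.mono (h0.trans hst) h)
          linarith
        · intro z hz
          obtain ⟨rfl, hz'⟩ := hsingle z hz
          by_cases hcase₀ : d.mean (T.c s) s (T.c s p) < T.lbl k (T.c s p)
          · right
            intro y hy
            obtain ⟨ℓ₂, hℓ₂, hlt₂⟩ := hnear₀.of_gt hcase₀
            rcases T.le_lab_of_inc h0 hst hp hz' hmove hℓ₂ hy with h | h <;> linarith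
          · left
            rw [hmean₀, neg_one_mul, neg_nonpos]
            exact mul_nonneg (by linarith) hm0'
      · refine le_trans ?_ hdev0
        rw [hmean, neg_one_mul, neg_nonpos]
        exact mul_nonneg (by linarith) hm0

/-- The bound for the momentum defect of a single wave. -/
def devBound (d : StepData) (N : ℕ) (δ e B : ℝ) : ℝ :=
  (N + 1) * (2 * (2 * d.Wb * absMass d B δ) + 4 * massBound d B * e)

variable {T} in
/-- The momentum defect between two updates is that at the last update, up to the mass absorbed
since then. -/
theorem Accurate.abs_dev_le {N : ℕ} {δ e : ℝ} (hT : T.Accurate N δ e) (he : 0 < e)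
    {B t : ℝ} (h0 : 0 ≤ t) (ht : t ≤ B) {p : ℕ} (hp : d.D p)
    (hN : ∀ q, d.D q → T.c t q = T.c t p → q ≤ N) :
    |T.dev t (T.c t p) (T.label t p)| ≤ devBound d N δ e B := by
  classical
  have hδ : 0 ≤ δ := by linarith [T.tick_lt 0, hT.tick_le 0]
  have hB : 0 ≤ B := h0.trans ht
  have hβ0 : 0 ≤ 2 * d.Wb * absMass d B δ :=
    mul_nonneg (by have := d.Wb_nonneg; linarith) (absMass_nonneg d B hδ)
  have hmb : 0 ≤ massBound d B :=
    mul_nonneg d.Vb_pos.le (by have := d.L_nonneg B; positivity)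
  obtain ⟨k, h1, h2⟩ := T.exists_slab h0
  have hs0 := T.tick_nonneg k
  have hiff : ∀ q, d.D q → (T.c t q = T.c t p ↔ T.c (T.tick k) q = T.c (T.tick k) p) := by
    intro q hq
    refine ⟨fun heq => ?_, fun heq => T.sticky hs0 h1 hq hp heq⟩
    have hqN := hN q hq heq
    have hpN := hN p hp rfl
    by_contra hne
    have e1 := hT.c_eq h1 h2.le hp hpN
    have e2 := hT.c_eq h1 h2.le hq hqN
    rcases lt_trichotomy p q with h | h | h
    · have := hT.noColl k p q hp hq h hqN
        (lt_of_le_of_ne (T.mono_c _ p q hp hq h.le) (Ne.symm hne)) t h1 h2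
      linarith
    · exact hne (by rw [h])
    · have := hT.noColl k q p hq hp h hpN
        (lt_of_le_of_ne (T.mono_c _ q p hq hp h.le) hne) t h1 h2
      linarith
  have hlab : T.label t p = T.lbl k (T.c (T.tick k) p) := by
    rw [label, T.slabIx_eq h1 h2, (hiff _ (T.lead_leader t hp).1).1 (T.c_leader t hp)]
  set M := T.members N t (T.c t p) with hMdef
  have hM : ∀ q, q ∈ M ↔ d.D q ∧ T.c t q = T.c t p := fun q => by
    rw [hMdef, T.mem_members]
    exact ⟨fun h => h.2, fun h => ⟨hN q h.1 h.2, h⟩⟩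
  have himg : M.image (T.c (T.tick k)) = {T.c (T.tick k) p} := by
    refine Finset.eq_singleton_iff_unique_mem.2 ⟨Finset.mem_image_of_mem _ ((hM p).2 ⟨hp, rfl⟩),
      fun w hw => ?_⟩
    obtain ⟨q, hq, rfl⟩ := Finset.mem_image.1 hw
    exact (hiff q ((hM q).1 hq).1).1 ((hM q).1 hq).2
  have hdev := T.integral_fib (g := fun y => d.rho y * (d.lab y - T.label t p)) hs0 h1 hM
    (integrableOn_rho_lab (d := d) (T.volume_fib_lt_top h0 _) (T.label t p))
  rw [himg, Finset.sum_singleton] at hdev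
  have hM' : ((T.members N (T.tick k) (T.c (T.tick k) p)).card : ℝ) ≤ N + 1 := by
    have : (T.members N (T.tick k) (T.c (T.tick k) p)).card ≤ N + 1 :=
      (Finset.card_filter_le _ _).trans (Finset.card_range _).le
    exact_mod_cast this
  have hpow : (0 : ℝ) ≤ (1 / 2) ^ k := by positivity
  have key : ∀ σ : ℝ, |σ| = 1 → σ * T.dev t (T.c t p) (T.label t p) ≤ devBound d N δ e B := by
    intro σ hσ
    have h3 := hT.abs_dev_tick_le he k (h1.trans ht) hp
      (fun q hq heq => hN q hq ((hiff q hq).2 heq)) hσ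
    have h4 := (T.integral_inc_lab_le hs0 h1 (T.c t p) fun y _ =>
      abs_mul_lab_sub_le hσ.le (T.abs_label_le t p) y).trans (mul_le_mul_of_nonneg_left
      (T.integral_inc_le hs0 h1 ht (h2.le.trans (hT.tick_le k)) (T.c t p))
      (show 0 ≤ 2 * d.Wb by have := d.Wb_nonneg; linarith))
    rw [← hlab] at h3
    rw [dev, hdev, mul_add]
    change σ * T.dev (T.tick k) (T.c (T.tick k) p) (T.label t p) + _ ≤ _
    set m : ℝ := ((T.members N (T.tick k) (T.c (T.tick k) p)).card : ℝ)
    have h5 : (2 * m - 1) * (2 * d.Wb * absMass d B δ) ≤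
        (2 * (N + 1 : ℝ) - 1) * (2 * d.Wb * absMass d B δ) :=
      mul_le_mul_of_nonneg_right (by linarith) hβ0
    have h6 : m * (4 * massBound d B * e * (1 - (1 / 2) ^ k)) ≤
        (N + 1) * (4 * massBound d B * e) := by
      refine mul_le_mul hM' ?_ ?_ (by positivity)
      · exact mul_le_of_le_one_right (by positivity) (by linarith)
      · exact mul_nonneg (by positivity)
          (sub_nonneg.2 (pow_le_one₀ (by norm_num) (by norm_num)))
    rw [devBound]
    linarith
  rw [abs_le]
  have h7 := key 1 (by simp)
  have h8 := key (-1) (by simp)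
  constructor <;> linarith

end Track
end StepData

/-! ### The widths of the shadow waves -/

/-- A continuous profile below `g` that is positive on an interval can be decreased so that it stays
below finitely many positive functions. -/
theorem exists_profile_lt {ι : Type*} (I : Finset ι) (F : ι → ℝ → ℝ) {s s' : ℝ}
    (hF : ∀ i ∈ I, Continuous (F i)) (hpos : ∀ i ∈ I, ∀ t ∈ Ioo s s', 0 < F i t)
    {g : ℝ → ℝ} (hg : Continuous g) (hg0 : ∀ t, 0 ≤ g t) (hgpos : ∀ t ∈ Ioo s s', 0 < g t) :
    ∃ h : ℝ → ℝ, Continuous h ∧ (∀ t, 0 ≤ h t) ∧ (∀ t, h t ≤ g t) ∧ (∀ t ∈ Ioo s s', 0 < h t) ∧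
      ∀ i ∈ I, ∀ t ∈ Ioo s s', h t < F i t := by
  classical
  induction I using Finset.induction_on with
  | empty => exact ⟨g, hg, hg0, fun _ => le_rfl, hgpos, by simp⟩
  | insert a I _ ih =>
    obtain ⟨h, h1, h2, h3, h4, h5⟩ := ih (fun i hi => hF i (Finset.mem_insert_of_mem hi))
      (fun i hi => hpos i (Finset.mem_insert_of_mem hi))
    have ha := hF a (Finset.mem_insert_self _ _)
    have ha' := hpos a (Finset.mem_insert_self _ _)
    have hlt : ∀ t ∈ Ioo s s', max 0 (min (h t) (F a t / 2)) = min (h t) (F a t / 2) :=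
      fun t ht => max_eq_right (le_min (h2 t) (by linarith [ha' t ht]))
    refine ⟨fun t => max 0 (min (h t) (F a t / 2)), by fun_prop, fun t => le_max_left _ _,
      fun t => max_le (hg0 t) ((min_le_left _ _).trans (h3 t)), fun t ht => ?_, fun i hi t ht => ?_⟩
    · dsimp only
      rw [hlt t ht]
      exact lt_min (h4 t ht) (by linarith [ha' t ht])
    · dsimp only
      rw [hlt t ht]
      rcases Finset.mem_insert.1 hi with rfl | hi
      · exact (min_le_right _ _).trans_lt (by linarith [ha' t ht])
      · exact (min_le_left _ _).trans_lt (h5 i hi t ht)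

namespace StepData

namespace Track

variable {d : StepData} (T : Track d)

/-- `h` is an admissible half width for wave `p` on the segment `[s, s']` of its life: the strip of
half width `h` around the wave is far from the other waves, and it separates the characteristics
with the label of the wave that start on its left and on its right. -/
structure IsWidth (p : ℕ) (s s' cap : ℝ) (h : ℝ → ℝ) : Prop where
  cont : Continuous h
  nonneg : ∀ t, 0 ≤ h t
  le_cap : ∀ t, h t ≤ cap
  pos : ∀ t ∈ Ioo s s', 0 < h t
  start : h s = 0
  sep : ∀ t ∈ Ioo s s', ∀ q, d.D q → T.c t q ≠ T.c t p → 3 * h t ≤ |T.c t q - T.c t p|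
  left : ∀ t ∈ Ioo s s', ∀ j ≤ p, d.w j ≤ T.label t p →
    d.Y j + d.Phi (T.label t p) t < T.c t p - h t
  right : ∀ t ∈ Ioo s s', ∀ j, (∀ q, d.D q → T.c t q ≤ T.c t p → q ≤ j) →
    T.label t p ≤ d.w (j + 1) → T.c t p + h t < d.Y j + d.Phi (T.label t p) t

variable {T} in
theorem IsSeg.le_iff {p q : ℕ} {s s' : ℝ} (h : T.IsSeg p s s') (hq : d.D q) {t t' : ℝ}
    (ht : t ∈ Ioo s s') (ht' : t' ∈ Ioo s s') : T.c t q ≤ T.c t p ↔ T.c t' q ≤ T.c t' p := by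
  rcases le_total q p with hqp | hqp
  · exact ⟨fun _ => T.mono_c _ q p hq h.hD hqp, fun _ => T.mono_c _ q p hq h.hD hqp⟩
  · have h1 := T.mono_c t p q h.hD hq hqp
    have h2 := T.mono_c t' p q h.hD hq hqp
    have := h.eq_iff hq ht ht'
    exact ⟨fun h' => (this.1 (le_antisymm h' h1)).le, fun h' => (this.2 (le_antisymm h' h2)).le⟩

variable {T} in
theorem IsSeg.exists_width {p : ℕ} {s s' : ℝ} (h : T.IsSeg p s s') {cap : ℝ} (hcap : 0 < cap) :
    ∃ w, T.IsWidth p s s' cap w := by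
  classical
  obtain ⟨ℓ, a, hℓ, -⟩ := h.exists_label
  set t₀ := (s + s') / 2 with ht₀
  have hlt := h.lt
  have hs0 := h.nonneg
  have ht₀' : t₀ ∈ Ioo s s' := ⟨by linarith, by linarith⟩
  have hℓb : |ℓ| ≤ d.Wb := hℓ t₀ ht₀' ▸ T.abs_label_le t₀ p
  have hLB : 0 ≤ d.L s' * s' := mul_nonneg (d.L_nonneg _) (hs0.trans hlt.le)
  have hcp : ∀ t ∈ Ioo s s', T.c t p ≤ d.Y p + d.L s' * s' := fun t ht => by
    linarith [(abs_le.1 (T.abs_c_sub_Y_le (hs0.trans ht.1.le) ht.2.le h.hD)).2]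
  have hPhi : ∀ t ∈ Ioo s s', |d.Phi ℓ t| ≤ d.L s' * s' := fun t ht => by
    have := d.abs_Phi_sub_le hℓb le_rfl (hs0.trans ht.1.le) ht.2.le
    rw [d.Phi_zero, sub_zero, sub_zero] at this
    exact this.trans (mul_le_mul_of_nonneg_left ht.2.le (d.L_nonneg _))
  obtain ⟨N, hN⟩ := d.exists_Y_gt (d.Y p + 2 * (d.L s' * s') + 1)
  have hcp' := T.continuous_c h.hD
  have hPhi' := d.continuous_Phi_right ℓ
  -- the base profile vanishes at both ends and keeps away from the waves with large index
  obtain ⟨h₀, c₀, n₀, le₀, pos₀, -⟩ := exists_profile_lt (∅ : Finset ℕ) (fun _ _ => 1) (s := s)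
    (s' := s') (by simp) (by simp)
    (g := fun t => max 0 (min (min (t - s) (s' - t)) (min cap (1 / 3)))) (by fun_prop)
    (fun t => le_max_left _ _) (fun t ht => lt_max_of_lt_right (lt_min (lt_min (by linarith [ht.1])
      (by linarith [ht.2])) (lt_min hcap (by norm_num))))
  obtain ⟨h₁, c₁, n₁, le₁, pos₁, lt₁⟩ := exists_profile_lt
    ((Finset.range N).filter fun q => d.D q ∧ T.c t₀ q ≠ T.c t₀ p)
    (fun q t => |T.c t q - T.c t p| / 3) (s := s) (s' := s')
    (fun q hq => by
      have := T.continuous_c (Finset.mem_filter.1 hq).2.1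
      fun_prop)
    (fun q hq t ht => by
      have hq' := (Finset.mem_filter.1 hq).2
      have : T.c t q ≠ T.c t p := fun he => hq'.2 ((h.eq_iff hq'.1 ht ht₀').1 he)
      have := abs_pos.2 (sub_ne_zero.2 this)
      positivity) c₀ n₀ pos₀
  obtain ⟨h₂, c₂, n₂, le₂, pos₂, lt₂⟩ := exists_profile_lt
    ((Finset.range (p + 1)).filter fun j => d.w j ≤ ℓ)
    (fun j t => T.c t p - (d.Y j + d.Phi ℓ t)) (s := s) (s' := s')
    (fun j _ => by fun_prop)
    (fun j hj t ht => by
      have hj' := Finset.mem_filter.1 hj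
      have := (T.label_adm (hs0.trans ht.1.le) h.hD).1 j (fun q hq hle => by
        by_contra hqj
        have hqp : q < p := by have := Finset.mem_range.1 hj'.1; omega
        exact (h.lead t ht).2 q hq hqp (le_antisymm (T.mono_c t q p hq h.hD hqp.le) hle))
        (by rw [hℓ t ht]; exact hj'.2)
      rw [hℓ t ht] at this
      linarith) c₁ n₁ pos₁
  obtain ⟨h₃, c₃, n₃, le₃, pos₃, lt₃⟩ := exists_profile_lt
    ((Finset.range N).filter fun j => (∀ q, d.D q → T.c t₀ q ≤ T.c t₀ p → q ≤ j) ∧ ℓ ≤ d.w (j + 1))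
    (fun j t => d.Y j + d.Phi ℓ t - T.c t p) (s := s) (s' := s')
    (fun j _ => by fun_prop)
    (fun j hj t ht => by
      have hj' := (Finset.mem_filter.1 hj).2
      have := (T.label_adm (hs0.trans ht.1.le) h.hD).2 j
        (fun q hq hle => hj'.1 q hq ((h.le_iff hq ht ht₀').1 hle)) (by rw [hℓ t ht]; exact hj'.2)
      rw [hℓ t ht] at this
      linarith) c₂ n₂ pos₂
  have hle : ∀ t, h₃ t ≤ h₀ t := fun t => (le₃ t).trans ((le₂ t).trans (le₁ t))
  have hm : ∀ t, 0 ≤ min (min (t - s) (s' - t)) (min cap (1 / 3)) →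
      h₀ t ≤ min (min (t - s) (s' - t)) (min cap (1 / 3)) := fun t ht => by
    have := le₀ t
    rwa [max_eq_right ht] at this
  have hcap' : ∀ t, h₀ t ≤ min cap (1 / 3) := fun t =>
    (le₀ t).trans (max_le (le_min hcap.le (by norm_num)) (min_le_right _ _))
  refine ⟨h₃, c₃, n₃, fun t => (hle t).trans ((hcap' t).trans (min_le_left _ _)), pos₃, ?_,
    fun t ht q hq hne => ?_, fun t ht j hj hw => ?_, fun t ht j hj hw => ?_⟩
  · refine le_antisymm ((hle s).trans ((le₀ s).trans (max_le le_rfl ?_))) (n₃ s)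
    exact (min_le_left _ _).trans ((min_le_left _ _).trans (by linarith))
  · by_cases hqN : q < N
    · have := lt₁ q (Finset.mem_filter.2 ⟨Finset.mem_range.2 hqN, hq,
        fun he => hne ((h.eq_iff hq ht ht₀').2 he)⟩) t ht
      linarith [le₂ t, le₃ t]
    · have h1 := (hle t).trans ((hcap' t).trans (min_le_right _ _))
      have h2 := (abs_le.1 (T.abs_c_sub_Y_le (hs0.trans ht.1.le) ht.2.le hq)).1
      have h3 := hN q (not_lt.1 hqN)
      have h4 := hcp t ht
      have h5 := le_abs_self (T.c t q - T.c t p)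
      linarith
  · rw [hℓ t ht] at hw ⊢
    have := lt₂ j (Finset.mem_filter.2 ⟨Finset.mem_range.2 (by omega), hw⟩) t ht
    linarith [le₃ t]
  · rw [hℓ t ht] at hw ⊢
    by_cases hjN : j < N
    · have := lt₃ j (Finset.mem_filter.2 ⟨Finset.mem_range.2 hjN,
        fun q hq hle => hj q hq ((h.le_iff hq ht ht₀').2 hle), hw⟩) t ht
      linarith
    · have h1 := (hle t).trans ((hcap' t).trans (min_le_right _ _))
      have h3 := hN j (not_lt.1 hjN)
      have h4 := hcp t ht
      have h5 := (abs_le.1 (hPhi t ht)).1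
      linarith

theorem continuousOn_mass {p : ℕ} {s s' : ℝ} (h : T.IsSeg p s s') :
    ContinuousOn (fun t => T.mass t (T.c t p)) (Ioo s s') := by
  have key : ∀ r ∈ Ioo s s', ∀ t ∈ Ioo s s', r ≤ t →
      |T.mass t (T.c t p) - T.mass r (T.c r p)| ≤ d.Vb * (2 * d.L s') * |t - r| := by
    intro r hr t ht hrt
    have hr0 : 0 ≤ r := h.nonneg.trans hr.1.le
    obtain ⟨N, hN⟩ := T.exists_far t (T.c t p)
    have hM : ∀ q, q ∈ T.members N t (T.c t p) ↔ d.D q ∧ T.c t q = T.c t p := fun q => by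
      rw [T.mem_members]
      refine ⟨fun h => h.2, fun h => ⟨not_lt.1 fun hlt => ?_, h⟩⟩
      linarith [hN q h.1 hlt.le t (hr0.trans hrt) le_rfl, h.2]
    have himg : (T.members N t (T.c t p)).image (T.c r) = {T.c r p} := by
      refine Finset.eq_singleton_iff_unique_mem.2
        ⟨Finset.mem_image_of_mem _ ((hM p).2 ⟨h.hD, rfl⟩), fun w hw => ?_⟩
      obtain ⟨q, hq, rfl⟩ := Finset.mem_image.1 hw
      exact (h.eq_iff ((hM q).1 hq).1 ht hr).1 ((hM q).1 hq).2
    have := T.integral_fib hr0 hrt hM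
      (integrableOn_rho (d := d) (T.volume_fib_lt_top (hr0.trans hrt) (T.c t p)))
    rw [himg, Finset.sum_singleton] at this
    rw [mass, mass, this, add_sub_cancel_left, abs_of_nonneg (sub_nonneg.2 hrt),
      abs_of_nonneg (integral_nonneg fun y => (d.rho_pos y).le)]
    refine (setIntegral_rho_le (mul_nonneg zero_le_two (mul_nonneg (d.L_nonneg s')
      (sub_nonneg.2 hrt))) (T.volume_inc_le hr0 hrt ht.2.le _)).trans (le_of_eq (by ring))
  refine (LipschitzOnWith.of_dist_le_mul (K := ⟨d.Vb * (2 * d.L s'), mul_nonneg d.Vb_pos.le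
    (mul_nonneg zero_le_two (d.L_nonneg _))⟩) fun r hr t ht => ?_).continuousOn
  rw [Real.dist_eq, Real.dist_eq]
  rcases le_total r t with hrt | hrt
  · rw [abs_sub_comm, abs_sub_comm r t]; exact key r hr t ht hrt
  · exact key t ht r hr hrt

/-! ### The family of shadow waves -/

/-- The half width of the shadow wave that represents wave `p` on the segment `[s, s']`. -/
def width (cap : ℝ) (p : ℕ) (s s' : ℝ) : ℝ → ℝ :=
  open Classical in if h : ∃ w, T.IsWidth p s s' cap w then h.choose else 0

variable {T} in
theorem IsSeg.isWidth {p : ℕ} {s s' : ℝ} (h : T.IsSeg p s s') {cap : ℝ} (hcap : 0 < cap) :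
    T.IsWidth p s s' cap (T.width cap p s s') := by
  rw [width, dif_pos (h.exists_width hcap)]
  exact (h.exists_width hcap).choose_spec

/-- The shadow wave that represents wave `p` on the segment `[s, s']`. The mass concentrated in the
wave is spread evenly over the strip; adding `1` keeps the density positive. -/
def wave {V : ℝ → ℝ → ℝ} (hV : ∀ ℓ, Continuous (V ℓ)) {cap : ℝ} (hcap : 0 < cap) {p : ℕ}
    {s s' : ℝ} (h : T.IsSeg p s s') : ShadowWave where
  birth := s
  death := s'
  center t := T.c t p
  left := T.width cap p s s'
  right := T.width cap p s s'
  mass t := T.mass t (T.c t p) / (2 * T.width cap p s s' t) + 1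
  vel t := V (T.label t p) t
  birth_nonneg := h.nonneg
  birth_lt_death := by exact_mod_cast h.lt
  center_cont := (T.continuous_c h.hD).continuousOn
  left_cont := (h.isWidth hcap).cont.continuousOn
  right_cont := (h.isWidth hcap).cont.continuousOn
  mass_cont := by
    simp only [EReal.coe_lt_coe_iff]
    refine ((T.continuousOn_mass h).div ((h.isWidth hcap).cont.continuousOn.const_mul 2)
      fun t ht => ?_).add continuousOn_const
    have := (h.isWidth hcap).pos t ht
    positivity
  vel_cont := by
    simp only [EReal.coe_lt_coe_iff]
    obtain ⟨ℓ, a, hℓ, -⟩ := h.exists_label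
    exact (hV ℓ).continuousOn.congr fun t ht => by rw [hℓ t ht]
  left_pos t h1 h2 := (h.isWidth hcap).pos t ⟨h1, by exact_mod_cast h2⟩
  right_pos t h1 h2 := (h.isWidth hcap).pos t ⟨h1, by exact_mod_cast h2⟩
  mass_pos t h1 h2 := by
    have h1 := (h.isWidth hcap).pos t ⟨h1, by exact_mod_cast h2⟩
    have h2 := T.mass_nonneg t (T.c t p)
    positivity

/-- All shadow waves. -/
def waves {V : ℝ → ℝ → ℝ} (hV : ∀ ℓ, Continuous (V ℓ)) {cap : ℝ} (hcap : 0 < cap) :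
    Set ShadowWave :=
  {w | ∃ (p : ℕ) (s s' : ℝ) (h : T.IsSeg p s s'), w = T.wave hV hcap h}

section waves

variable {V : ℝ → ℝ → ℝ} (hV : ∀ ℓ, Continuous (V ℓ)) {cap : ℝ} (hcap : 0 < cap)

variable {T} in
theorem IsSeg.alive_iff {p : ℕ} {s s' t : ℝ} (h : T.IsSeg p s s') :
    (T.wave hV hcap h).Alive t ↔ t ∈ Ioo s s' := by
  simp [ShadowWave.Alive, wave]

variable {T} in
theorem IsSeg.covers_iff {p : ℕ} {s s' x t : ℝ} (h : T.IsSeg p s s') :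
    (T.wave hV hcap h).Covers (x, t) ↔ t ∈ Icc s s' ∧ |x - T.c t p| ≤ T.width cap p s s' t := by
  simp only [ShadowWave.Covers, wave, EReal.coe_le_coe_iff, abs_le, mem_Icc]
  constructor
  · rintro ⟨h1, h2, h3, h4⟩; exact ⟨⟨h1, h2⟩, by linarith, by linarith⟩
  · rintro ⟨⟨h1, h2⟩, h3, h4⟩; exact ⟨h1, h2, by linarith, by linarith⟩

theorem waves_locally_finite (a b B : ℝ) :
    {w ∈ T.waves hV hcap | ∃ p ∈ Icc a b ×ˢ Icc 0 B, w.Covers p}.Finite := by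
  obtain ⟨N, hN⟩ := T.exists_far B (b + cap)
  have hfin : ∀ p, {s | d.D p ∧ T.Ev p s ∧ s ≤ B}.Finite := fun p => by
    by_cases hp : d.D p
    · simpa [hp] using T.finite_ev hp B
    · simp [hp]
  refine ((Finset.range N).finite_toSet.biUnion fun p _ => (hfin p).biUnion
    (t := fun s => {w | ∃ (s' : ℝ) (h : T.IsSeg p s s'), w = T.wave hV hcap h})
    fun s _ => Set.Subsingleton.finite ?_).subset ?_
  · rintro _ ⟨s', h, rfl⟩ _ ⟨s'', h', rfl⟩
    obtain rfl := h.end_unique h'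
    rfl
  · rintro _ ⟨⟨p, s, s', h, rfl⟩, ⟨x, t⟩, ⟨hx, ht⟩, hcov⟩
    rw [h.covers_iff] at hcov
    have h1 := (abs_le.1 hcov.2).1
    have h2 := (h.isWidth hcap).le_cap t
    have hpN : p < N := not_le.1 fun hle => by
      linarith [hN p h.hD hle t ht.1 ht.2, hx.2]
    simp only [mem_iUnion]
    exact ⟨p, by simpa using hpN, s, ⟨h.hD, h.ev, hcov.1.1.trans ht.2⟩, s', h, rfl⟩

theorem waves_disjoint : ∀ w ∈ T.waves hV hcap, ∀ w' ∈ T.waves hV hcap, w ≠ w' →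
    ∀ t : ℝ, w.Alive t → w'.Alive t → ∀ x : ℝ, ¬ (w.Covers (x, t) ∧ w'.Covers (x, t)) := by
  rintro _ ⟨p, s, s', h, rfl⟩ _ ⟨q, r, r', h', rfl⟩ hne t ht ht' x ⟨hc, hc'⟩
  rw [h.alive_iff] at ht
  rw [h'.alive_iff] at ht'
  rw [h.covers_iff] at hc
  rw [h'.covers_iff] at hc'
  by_cases hpq : T.c t q = T.c t p
  · obtain rfl := (h.lead t ht).eq_of_eq (h'.lead t ht') hpq.symm
    obtain ⟨rfl, rfl⟩ := h.unique h' ht ht'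
    exact hne rfl
  · have h1 := (h.isWidth hcap).sep t ht q h'.hD hpq
    have h2 := (h'.isWidth hcap).sep t ht' p h.hD (Ne.symm hpq)
    have h3 := abs_sub_comm (T.c t q) (T.c t p)
    have h4 := (h.isWidth hcap).pos t ht
    have h5 := abs_sub_le (T.c t q) x (T.c t p)
    have h6 := abs_sub_comm x (T.c t q)
    linarith [hc.2, hc'.2, abs_nonneg (T.c t q - T.c t p)]

theorem waves_origin : ∀ w ∈ T.waves hV hcap,
    (w.birth = 0 ∧ w.left 0 = 0 ∧ w.right 0 = 0 ∧
      ∃ i : ℕ, w.center 0 = d.Y i ∧ d.w (i + 1) < d.w i) ∨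
    (0 < w.birth ∧ ∃ w' ∈ T.waves hV hcap, w'.death = (w.birth : EReal) ∧
      w'.center w.birth = w.center w.birth) := by
  rintro _ ⟨p, s, s', h, rfl⟩
  rcases h.nonneg.eq_or_lt with rfl | hs
  · exact Or.inl ⟨rfl, (h.isWidth hcap).start, (h.isWidth hcap).start, p,
      by simp [wave, T.c_zero], h.hD⟩
  · obtain ⟨a, r, h', heq⟩ := T.exists_seg_until h.hD hs h.ev
    exact Or.inr ⟨hs, _, ⟨a, r, s, h', rfl⟩, rfl, heq⟩

theorem waves_continues : ∀ w ∈ T.waves hV hcap, ∀ s : ℝ, w.death = (s : EReal) →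
    ∃ w' ∈ T.waves hV hcap, w'.birth = s ∧ w'.center s = w.center s := by
  rintro _ ⟨p, s, s', h, rfl⟩ r hr
  obtain rfl : s' = r := by simpa [wave] using hr
  obtain ⟨a, ha, -, heq⟩ := T.exists_lead s' h.hD
  obtain ⟨r, h'⟩ := T.exists_seg_from ha (h.ev'.congr T h.hD ha.1 heq)
  exact ⟨_, ⟨a, s', r, h', rfl⟩, rfl, heq⟩

theorem covers_center {p : ℕ} (hp : d.D p) {t : ℝ} (ht : 0 ≤ t) :
    ∃ w ∈ T.waves hV hcap, w.Covers (T.c t p, t) := by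
  obtain ⟨a, s, s', h, hts, heq⟩ := T.exists_seg_covering hp ht
  refine ⟨_, ⟨a, s, s', h, rfl⟩, ?_⟩
  rw [h.covers_iff, heq]
  exact ⟨⟨hts.1, hts.2.le⟩, by simpa using (h.isWidth hcap).nonneg t⟩

theorem isClosed_covers {w : ShadowWave} (hw : w ∈ T.waves hV hcap) :
    IsClosed {p | w.Covers p} := by
  obtain ⟨p, s, s', h, rfl⟩ := hw
  have : {p | (T.wave hV hcap h).Covers p} =
      {q : ℝ × ℝ | q.2 ∈ Icc s s' ∧ |q.1 - T.c q.2 p| ≤ T.width cap p s s' q.2} := by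
    ext ⟨x, t⟩
    exact h.covers_iff hV hcap
  rw [this]
  have h1 := (T.continuous_c h.hD).comp (continuous_snd (X := ℝ))
  have h2 := (h.isWidth hcap).cont.comp (continuous_snd (X := ℝ))
  exact (isClosed_Icc.preimage continuous_snd).inter
    (isClosed_le (continuous_abs.comp (continuous_fst.sub h1)) h2)

theorem eventually_not_covers {p : ℝ × ℝ} (hp : ∀ w ∈ T.waves hV hcap, ¬ w.Covers p) :
    ∀ᶠ q in 𝓝[{q : ℝ × ℝ | 0 ≤ q.2}] p, ∀ w ∈ T.waves hV hcap, ¬ w.Covers q := by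
  set F := {w ∈ T.waves hV hcap | ∃ q ∈ Icc (p.1 - 1) (p.1 + 1) ×ˢ Icc 0 (p.2 + 1), w.Covers q}
    with hFdef
  have hF : F.Finite := T.waves_locally_finite hV hcap _ _ _
  have h1 : ∀ᶠ q in 𝓝[{q : ℝ × ℝ | 0 ≤ q.2}] p, ∀ w ∈ F, ¬ w.Covers q := by
    rw [hF.eventually_all]
    intro w hw
    exact nhdsWithin_le_nhds ((T.isClosed_covers hV hcap hw.1).isOpen_compl.mem_nhds (hp w hw.1))
  have h2 : ∀ᶠ q in 𝓝[{q : ℝ × ℝ | 0 ≤ q.2}] p,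
      q ∈ Icc (p.1 - 1) (p.1 + 1) ×ˢ Icc 0 (p.2 + 1) := by
    have h3 : ∀ᶠ q : ℝ × ℝ in 𝓝[{q : ℝ × ℝ | 0 ≤ q.2}] p,
        q ∈ Ioo (p.1 - 1) (p.1 + 1) ×ˢ Iio (p.2 + 1) := nhdsWithin_le_nhds
      ((isOpen_Ioo.prod isOpen_Iio).mem_nhds ⟨⟨by linarith, by linarith⟩, by simp⟩)
    filter_upwards [h3, self_mem_nhdsWithin] with q hq hq0
    exact ⟨⟨hq.1.1.le, hq.1.2.le⟩, hq0, le_of_lt hq.2⟩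
  filter_upwards [h1, h2] with q hq1 hq2 w hw hcov
  exact hq1 w ⟨hw, q, hq2, hcov⟩ hcov

theorem waves_countable : (T.waves hV hcap).Countable := by
  have : T.waves hV hcap ⊆ ⋃ n : ℕ, {w ∈ T.waves hV hcap |
      ∃ p ∈ Icc (-n : ℝ) n ×ˢ Icc 0 (n : ℝ), w.Covers p} := by
    rintro _ ⟨p, s, s', h, rfl⟩
    obtain ⟨n, hn⟩ := exists_nat_ge (max |T.c s p| s)
    have h1 := abs_le.1 ((le_max_left _ _).trans hn)
    refine mem_iUnion.2 ⟨n, ⟨p, s, s', h, rfl⟩, (T.c s p, s),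
      ⟨h1, h.nonneg, (le_max_right _ _).trans hn⟩, ?_⟩
    rw [h.covers_iff]
    exact ⟨⟨le_rfl, h.lt.le⟩, by simpa using (h.isWidth hcap).nonneg s⟩
  exact (countable_iUnion fun n => (T.waves_locally_finite hV hcap _ _ _).countable).mono this

end waves

end Track

end StepData

namespace StepData

/-! ### The vacuum in a rarefaction fan -/

section Fan

variable (d : StepData) (V : ℝ → ℝ → ℝ)

open Classical in
/-- The label of the characteristic from `Y i` through the point `x` at time `t`. -/
def zeta (i : ℕ) (x t : ℝ) : ℝ := if h : ∃ ℓ, d.Y i + d.Phi ℓ t = x then h.choose else 0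

/-- The velocity in the vacuum that opens at `Y i`. -/
def fanVel (i : ℕ) (p : ℝ × ℝ) : ℝ := V (d.zeta i p.1 p.2) p.2

/-- The Riemann solution at a jump `Y i` where the velocity does not jump down. -/
def fan (i : ℕ) (p : ℝ × ℝ) : ℝ × ℝ :=
  if p.1 ≤ d.Y i + d.Phi (d.w i) p.2 then (d.v i, V (d.w i) p.2)
  else if p.1 < d.Y i + d.Phi (d.w (i + 1)) p.2 then (0, d.fanVel V i p)
  else (d.v (i + 1), V (d.w (i + 1)) p.2)

variable {d V}

theorem le_of_Phi_le {ℓ ℓ' t : ℝ} (ht : 0 < t) (h : d.Phi ℓ t ≤ d.Phi ℓ' t) : ℓ ≤ ℓ' :=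
  not_lt.1 fun hlt => absurd (d.Phi_lt hlt ht) (not_lt.2 h)

theorem lt_of_Phi_lt {ℓ ℓ' t : ℝ} (ht : 0 ≤ t) (h : d.Phi ℓ t < d.Phi ℓ' t) : ℓ < ℓ' :=
  not_le.1 fun hle => absurd (d.Phi_mono hle ht) (not_le.2 h)

theorem zeta_eq {i : ℕ} {x t ℓ : ℝ} (ht : 0 < t) (h : d.Y i + d.Phi ℓ t = x) :
    d.zeta i x t = ℓ := by
  have he : ∃ ℓ, d.Y i + d.Phi ℓ t = x := ⟨ℓ, h⟩
  rw [zeta, dif_pos he]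
  have := he.choose_spec
  exact le_antisymm (le_of_Phi_le ht (by linarith)) (le_of_Phi_le ht (by linarith))

theorem zeta_spec {i : ℕ} {x t : ℝ} (ht : 0 < t) (h1 : d.Y i + d.Phi (d.w i) t ≤ x)
    (h2 : x ≤ d.Y i + d.Phi (d.w (i + 1)) t) : d.Y i + d.Phi (d.zeta i x t) t = x ∧
      d.w i ≤ d.zeta i x t ∧ d.zeta i x t ≤ d.w (i + 1) := by
  obtain ⟨ℓ, hℓ⟩ := mem_range_of_exists_le_of_exists_ge
    (continuous_const.add (d.continuous_Phi_left t)) ⟨_, h1⟩ ⟨_, h2⟩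
  have h3 : d.Y i + d.Phi ℓ t = x := hℓ
  rw [zeta_eq ht h3]
  exact ⟨h3, le_of_Phi_le ht (by linarith), le_of_Phi_le ht (by linarith)⟩

theorem abs_zeta_le {i : ℕ} {x t : ℝ} (ht : 0 < t) (h1 : d.Y i + d.Phi (d.w i) t ≤ x)
    (h2 : x ≤ d.Y i + d.Phi (d.w (i + 1)) t) : |d.zeta i x t| ≤ d.Wb := by
  obtain ⟨-, h3, h4⟩ := zeta_spec ht h1 h2
  have h5 := abs_le.1 (d.w_le i)
  have h6 := abs_le.1 (d.w_le (i + 1))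
  exact abs_le.2 ⟨by linarith, by linarith⟩

variable (d) in
/-- The closed vacuum region at `Y i`. -/
def fanRegion (i : ℕ) : Set (ℝ × ℝ) :=
  {p | 0 < p.2 ∧ d.Y i + d.Phi (d.w i) p.2 ≤ p.1 ∧ p.1 ≤ d.Y i + d.Phi (d.w (i + 1)) p.2}

theorem continuousOn_zeta (i : ℕ) :
    ContinuousOn (fun p : ℝ × ℝ => d.zeta i p.1 p.2) (d.fanRegion i) := by
  intro p hp
  have h0 := (zeta_spec hp.1 hp.2.1 hp.2.2).1
  set ζ := d.zeta i p.1 p.2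
  have hc : ∀ ℓ, Continuous fun q : ℝ × ℝ => d.Y i + d.Phi ℓ q.2 := fun ℓ =>
    continuous_const.add ((d.continuous_Phi_right ℓ).comp continuous_snd)
  refine tendsto_order.2 ⟨fun a ha => ?_, fun b hb => ?_⟩
  · have : ∀ᶠ q : ℝ × ℝ in 𝓝[d.fanRegion i] p, d.Y i + d.Phi a q.2 < q.1 := nhdsWithin_le_nhds
      ((isOpen_lt (hc a) continuous_fst).mem_nhds (by
        have := d.Phi_lt ha hp.1
        change d.Y i + d.Phi a p.2 < p.1
        linarith))
    filter_upwards [this, self_mem_nhdsWithin] with q hq hqm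
    have := (zeta_spec hqm.1 hqm.2.1 hqm.2.2).1
    exact lt_of_Phi_lt hqm.1.le (by linarith)
  · have : ∀ᶠ q : ℝ × ℝ in 𝓝[d.fanRegion i] p, q.1 < d.Y i + d.Phi b q.2 := nhdsWithin_le_nhds
      ((isOpen_lt continuous_fst (hc b)).mem_nhds (by
        have := d.Phi_lt hb hp.1
        change p.1 < d.Y i + d.Phi b p.2
        linarith))
    filter_upwards [this, self_mem_nhdsWithin] with q hq hqm
    have := (zeta_spec hqm.1 hqm.2.1 hqm.2.2).1
    exact lt_of_Phi_lt hqm.1.le (by linarith)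

theorem continuousOn_fanVel (hV : Continuous fun p : ℝ × ℝ => V p.1 p.2) (i : ℕ) :
    ContinuousOn (d.fanVel V i) (d.fanRegion i) :=
  hV.comp_continuousOn ((continuousOn_zeta i).prodMk continuousOn_snd)

theorem measurableSet_fanRegion (i : ℕ) : MeasurableSet (d.fanRegion i) := by
  have hc : ∀ ℓ, Continuous fun q : ℝ × ℝ => d.Y i + d.Phi ℓ q.2 := fun ℓ =>
    continuous_const.add ((d.continuous_Phi_right ℓ).comp continuous_snd)
  exact (measurableSet_lt measurable_const measurable_snd).inter
    ((measurableSet_le (hc _).measurable measurable_fst).inter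
      (measurableSet_le measurable_fst (hc _).measurable))

end Fan

namespace Track

variable {d : StepData} (T : Track d)

/-! ### The solution between the shadow waves -/

/-- State `i` is a candidate for the state at `x`: all waves to the left of `x` separate earlier
states, and `x` is not to the right of the last characteristic of state `i`. -/
def Cand (x t : ℝ) (i : ℕ) : Prop :=
  (∀ p, d.D p → T.c t p < x → p < i) ∧ x ≤ d.Y i + d.Phi (d.w i) t

/-- The index of the state at `x` (or to the right of the vacuum at `x`). -/
def outIdx (x t : ℝ) : ℕ := sInf {i | T.Cand x t i}

/-- The solution outside the shadow waves. -/
def out (V : ℝ → ℝ → ℝ) (p : ℝ × ℝ) : ℝ × ℝ :=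
  if 0 < T.outIdx p.1 p.2 ∧ p.1 < d.Y (T.outIdx p.1 p.2 - 1) + d.Phi (d.w (T.outIdx p.1 p.2)) p.2
  then (0, d.fanVel V (T.outIdx p.1 p.2 - 1) p)
  else (d.v (T.outIdx p.1 p.2), V (d.w (T.outIdx p.1 p.2)) p.2)

variable {T} {V : ℝ → ℝ → ℝ}

theorem exists_cand (x : ℝ) {t : ℝ} (ht : 0 ≤ t) : ∃ i, T.Cand x t i := by
  obtain ⟨N, hN⟩ := T.exists_far t x
  obtain ⟨M, hM⟩ := d.exists_Y_gt (x + d.L t * t)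
  refine ⟨max N M, fun p hp hlt => not_le.1 fun hle => ?_, ?_⟩
  · linarith [hN p hp ((le_max_left _ _).trans hle) t ht le_rfl]
  · have h1 := hM (max N M) (le_max_right _ _)
    have h2 := d.abs_Phi_sub_le (d.w_le (max N M)) le_rfl ht le_rfl
    rw [d.Phi_zero, sub_zero, sub_zero] at h2
    linarith [(abs_le.1 h2).1]

theorem cand_outIdx (x : ℝ) {t : ℝ} (ht : 0 ≤ t) : T.Cand x t (T.outIdx x t) :=
  Nat.sInf_mem (exists_cand x ht)

theorem outIdx_le {x t : ℝ} {i : ℕ} (h : T.Cand x t i) : T.outIdx x t ≤ i := Nat.sInf_le h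

theorem lt_outIdx_iff {x t : ℝ} (ht : 0 ≤ t) {p : ℕ} (hp : d.D p) :
    p < T.outIdx x t ↔ T.c t p < x := by
  refine ⟨fun h => not_le.1 fun hle => ?_, (cand_outIdx x ht).1 p hp⟩
  -- the leader of the waves at `c t p` would be a smaller candidate
  obtain ⟨a, ha, hap, heq⟩ := T.exists_lead t hp
  have : T.Cand x t a := by
    refine ⟨fun q hq hlt => not_le.1 fun haq => ?_, ?_⟩
    · linarith [T.mono_c t a q ha.1 hq haq]
    · linarith [ha.c_le ht]
  have := outIdx_le this
  omega

/-- The waves to the left of `x` are those with index less than `i`. -/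
def Splits (T : Track d) (x t : ℝ) (i : ℕ) : Prop := ∀ p, d.D p → (p < i ↔ T.c t p < x)

theorem Splits.outIdx_eq {x t : ℝ} (ht : 0 ≤ t) {i : ℕ} (h : T.Splits x t i)
    (hx : x ≤ d.Y i + d.Phi (d.w i) t)
    (hx' : ∀ k, i = k + 1 → d.Y k + d.Phi (d.w k) t < x ∨ d.Y k + d.Phi (d.w i) t < x) :
    T.outIdx x t = i := by
  refine le_antisymm (outIdx_le ⟨fun p hp hlt => (h p hp).2 hlt, hx⟩) (not_lt.1 fun hlt => ?_)
  obtain ⟨k, rfl⟩ : ∃ k, i = k + 1 := ⟨i - 1, by omega⟩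
  have hc := cand_outIdx (T := T) x ht
  set j := T.outIdx x t
  have hD : ∀ q, j ≤ q → q < k + 1 → ¬ d.D q := fun q hjq hq hDq => by
    have := (lt_outIdx_iff ht hDq).2 ((h q hDq).1 hq)
    omega
  have h1 : d.w j ≤ d.w k := d.w_mono_of_not_D (by omega) fun q hq hqk => hD q hq (by omega)
  have h2 : d.w j ≤ d.w (k + 1) := d.w_mono_of_not_D (by omega) hD
  have h3 : d.Y j ≤ d.Y k := d.Y_strictMono.monotone (by omega)
  have h4 := d.Phi_mono h1 ht
  have h5 := d.Phi_mono h2 ht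
  rcases hx' k rfl with h | h <;> linarith [hc.2]

theorem out_eq_state {x t : ℝ} {i : ℕ} (h : T.outIdx x t = i)
    (hx : ∀ k, i = k + 1 → d.Y k + d.Phi (d.w i) t ≤ x) :
    T.out V (x, t) = (d.v i, V (d.w i) t) := by
  rw [out]
  simp only [h]
  refine if_neg ?_
  rintro ⟨h0, hlt⟩
  have := hx (i - 1) (by omega)
  linarith

theorem Splits.out_eq_fan {x t : ℝ} (ht : 0 ≤ t) {k : ℕ} (hk : ¬ d.D k)
    (h : T.Splits x t (k + 1)) (hl : ∀ j, k = j + 1 → d.Y j + d.Phi (d.w k) t < x)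
    (hr : x ≤ d.Y (k + 1) + d.Phi (d.w (k + 1)) t) : T.out V (x, t) = d.fan V k (x, t) := by
  rw [fan]
  dsimp only
  by_cases h1 : x ≤ d.Y k + d.Phi (d.w k) t
  · have h2 : T.Splits x t k := fun p hp => by
      rw [← h p hp]
      have : p ≠ k := fun he => hk (he ▸ hp)
      omega
    rw [if_pos h1]
    exact out_eq_state (h2.outIdx_eq ht h1 fun j hj => Or.inr (hl j hj)) fun j hj => (hl j hj).le
  · have h2 : T.outIdx x t = k + 1 := h.outIdx_eq ht hr fun j hj => by
      obtain rfl : k = j := by omega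
      exact Or.inl (not_le.1 h1)
    rw [if_neg h1]
    split_ifs with h3
    · rw [out]
      simp only [h2]
      exact if_pos ⟨by omega, h3⟩
    · refine out_eq_state h2 fun j hj => ?_
      obtain rfl : k = j := by omega
      exact not_lt.1 h3

theorem splits_outIdx (x : ℝ) {t : ℝ} (ht : 0 ≤ t) : T.Splits x t (T.outIdx x t) :=
  fun _ hp => lt_outIdx_iff ht hp

theorem Splits.Y_le_of_succ {x t : ℝ} (ht : 0 ≤ t) {k : ℕ} (h : T.Splits x t (k + 1))
    (hk : d.D k) : d.Y k + d.Phi (d.w (k + 1)) t < x := by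
  have h1 := (h k hk).1 (Nat.lt_succ_self k)
  refine (T.le_c_of_last ht hk fun q hq hkq heq => ?_).trans_lt h1
  have := (h q hq).2 (heq ▸ h1)
  omega

theorem Splits.lt_Y_of {x t : ℝ} (ht : 0 ≤ t) {k : ℕ} (h : T.Splits x t k)
    (hne : ∀ q, d.D q → T.c t q ≠ x) (hk : d.D k) : x < d.Y k + d.Phi (d.w k) t := by
  have h1 : x < T.c t k :=
    lt_of_le_of_ne (not_lt.1 fun hlt => lt_irrefl k ((h k hk).2 hlt)) (hne k hk).symm
  refine h1.trans_le (Lead.c_le ht ⟨hk, fun q hq hqk heq => ?_⟩)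
  linarith [(h q hq).1 hqk]

theorem Splits.eventually {x t : ℝ} {i : ℕ} (h : T.Splits x t i)
    (hne : ∀ q, d.D q → T.c t q ≠ x) :
    ∀ᶠ q in 𝓝[{q : ℝ × ℝ | 0 ≤ q.2}] (x, t), T.Splits q.1 q.2 i := by
  obtain ⟨N, hN⟩ := T.exists_far (t + 1) (x + 1)
  have h1 : ∀ᶠ q : ℝ × ℝ in 𝓝 (x, t), ∀ p ∈ Finset.range (max N i), d.D p →
      (p < i ↔ T.c q.2 p < q.1) := by
    rw [Filter.eventually_all_finset]
    intro p _
    by_cases hp : d.D p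
    · have hc := (T.continuous_c hp).comp (continuous_snd (X := ℝ))
      rcases lt_or_gt_of_ne (hne p hp) with hlt | hlt
      · filter_upwards [(isOpen_lt hc continuous_fst).mem_nhds (show T.c t p < x from hlt)]
          with q hq _
        exact iff_of_true ((h p hp).2 hlt) hq
      · filter_upwards [(isOpen_lt continuous_fst hc).mem_nhds (show x < T.c t p from hlt)]
          with q hq _
        exact iff_of_false (fun hpi => absurd ((h p hp).1 hpi) (not_lt.2 hlt.le))
          (not_lt.2 (le_of_lt hq))
    · exact Eventually.of_forall fun _ h => absurd h hp
  have h2 : ∀ᶠ q : ℝ × ℝ in 𝓝 (x, t), q.1 < x + 1 ∧ q.2 < t + 1 :=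
    ((isOpen_lt continuous_fst continuous_const).inter
      (isOpen_lt continuous_snd continuous_const)).mem_nhds
      (show x < x + 1 ∧ t < t + 1 from ⟨by linarith, by linarith⟩)
  filter_upwards [nhdsWithin_le_nhds h1, nhdsWithin_le_nhds h2, self_mem_nhdsWithin]
    with q h1 h2 h3 p hp
  by_cases hpN : p < max N i
  · exact h1 p (Finset.mem_range.2 hpN) hp
  · have hNp : N ≤ p := (le_max_left _ _).trans (not_lt.1 hpN)
    have hip : i ≤ p := (le_max_right _ _).trans (not_lt.1 hpN)
    refine iff_of_false (not_lt.2 hip) (not_lt.2 ?_)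
    linarith [hN p hp hNp q.2 h3 h2.2.le]

/-- Away from the waves, the solution is locally one of the states, or a fan. Here `i` is the index
of the state, or `k` that of the left state of the fan. -/
theorem eventually_out_eq {x t : ℝ} (ht : 0 ≤ t) (hne : ∀ q, d.D q → T.c t q ≠ x) :
    (∃ i, T.Splits x t i ∧ x ≤ d.Y i + d.Phi (d.w i) t ∧
      (∀ k, i = k + 1 → d.Y k + d.Phi (d.w i) t ≤ x) ∧
      ∀ᶠ q in 𝓝[{q : ℝ × ℝ | 0 ≤ q.2}] (x, t), T.out V q = (d.v i, V (d.w i) q.2)) ∨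
    (∃ k, ¬ d.D k ∧ T.Splits x t (k + 1) ∧
      (∀ j, k = j + 1 → d.Y j + d.Phi (d.w k) t < x) ∧
      x < d.Y (k + 1) + d.Phi (d.w (k + 1)) t ∧
      ∀ᶠ q in 𝓝[{q : ℝ × ℝ | 0 ≤ q.2}] (x, t), T.out V q = d.fan V k q) := by
  have hc : ∀ j ℓ, Continuous fun q : ℝ × ℝ => d.Y j + d.Phi ℓ q.2 := fun j ℓ =>
    continuous_const.add ((d.continuous_Phi_right ℓ).comp continuous_snd)
  have hR : ∀ j ℓ, x < d.Y j + d.Phi ℓ t →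
      ∀ᶠ q in 𝓝[{q : ℝ × ℝ | 0 ≤ q.2}] (x, t), q.1 < d.Y j + d.Phi ℓ q.2 := fun j ℓ h =>
    nhdsWithin_le_nhds ((isOpen_lt continuous_fst (hc j ℓ)).mem_nhds h)
  have hL : ∀ i, (∀ j, i = j + 1 → d.Y j + d.Phi (d.w i) t < x) →
      ∀ᶠ q in 𝓝[{q : ℝ × ℝ | 0 ≤ q.2}] (x, t),
        ∀ j, i = j + 1 → d.Y j + d.Phi (d.w i) q.2 < q.1 := fun i h => by
    cases i with
    | zero => exact Eventually.of_forall fun q j hj => by omega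
    | succ k =>
      filter_upwards [nhdsWithin_le_nhds
        ((isOpen_lt (hc k (d.w (k + 1))) continuous_fst).mem_nhds (h k rfl))] with q hq j hj
      obtain rfl : k = j := by omega
      exact hq
  have hfan : ∀ k, ¬ d.D k → T.Splits x t (k + 1) →
      (∀ j, k = j + 1 → d.Y j + d.Phi (d.w k) t < x) →
      x < d.Y (k + 1) + d.Phi (d.w (k + 1)) t →
      ∀ᶠ q in 𝓝[{q : ℝ × ℝ | 0 ≤ q.2}] (x, t), T.out V q = d.fan V k q := by
    intro k hk hs hl hr
    filter_upwards [hs.eventually hne, hL k hl, hR _ _ hr, self_mem_nhdsWithin]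
      with q h1 h2 h3 h4
    exact h1.out_eq_fan h4 hk h2 h3.le
  have hs := splits_outIdx (T := T) x ht
  have hc := cand_outIdx (T := T) x ht
  set i := T.outIdx x t with hi
  by_cases hl : ∀ j, i = j + 1 → d.Y j + d.Phi (d.w i) t < x
  · rcases hc.2.lt_or_eq with hr | hr
    · refine Or.inl ⟨i, hs, hc.2, fun k hk => (hl k hk).le, ?_⟩
      filter_upwards [hs.eventually hne, hL i hl, hR _ _ hr, self_mem_nhdsWithin]
        with q h1 h2 h3 h4
      exact out_eq_state (h1.outIdx_eq h4 h3.le fun j hj => Or.inr (h2 j hj))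
        fun j hj => (h2 j hj).le
    · have hD : ¬ d.D i := fun hD => by linarith [hs.lt_Y_of ht hne hD]
      have hs' : T.Splits x t (i + 1) := fun p hp => by
        rw [← hs p hp]
        have : p ≠ i := fun he => hD (he ▸ hp)
        omega
      have hr' : x < d.Y (i + 1) + d.Phi (d.w (i + 1)) t := by
        linarith [d.Y_lt_succ i, d.Phi_mono (not_lt.1 hD) ht]
      exact Or.inr ⟨i, hD, hs', hl, hr', hfan i hD hs' hl hr'⟩
  · push Not at hl
    obtain ⟨k, hk, hx⟩ := hl
    rw [hk] at hs hx hc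
    have hD : ¬ d.D k := fun hD => by linarith [hs.Y_le_of_succ ht hD]
    -- state `k` is not a candidate, hence `x` lies to the right of its last characteristic
    have hxk : d.Y k + d.Phi (d.w k) t ≤ x := by
      by_contra hlt
      have : T.Cand x t k := ⟨fun p hp hpx => by
        have := (hs p hp).2 hpx
        have : p ≠ k := fun he => hD (he ▸ hp)
        omega, (not_le.1 hlt).le⟩
      have := outIdx_le this
      omega
    have hl' : ∀ j, k = j + 1 → d.Y j + d.Phi (d.w k) t < x := fun j hj => by
      have := d.Y_lt_succ j
      rw [← hj] at this
      linarith
    have hr' : x < d.Y (k + 1) + d.Phi (d.w (k + 1)) t := by linarith [d.Y_lt_succ k]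
    exact Or.inr ⟨k, hD, hs, hl', hr', hfan k hD hs hl' hr'⟩

theorem tendsto_slice {x t : ℝ} (ht : 0 ≤ t) (S : Set ℝ) :
    Tendsto (fun y : ℝ => (y, t)) (𝓝[S] x) (𝓝[{q : ℝ × ℝ | 0 ≤ q.2}] (x, t)) :=
  tendsto_nhdsWithin_iff.2 ⟨((continuous_id.prodMk continuous_const).tendsto x).mono_left
    nhdsWithin_le_nhds, Eventually.of_forall fun _ => ht⟩

theorem tendsto_fanVel (hV : Continuous fun p : ℝ × ℝ => V p.1 p.2) {k : ℕ} {x t : ℝ}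
    (hx : (x, t) ∈ d.fanRegion k) {S : Set ℝ} (hS : ∀ᶠ y in 𝓝[S] x, (y, t) ∈ d.fanRegion k) :
    Tendsto (fun y => ((0 : ℝ), d.fanVel V k (y, t))) (𝓝[S] x)
      (𝓝 (0, V (d.zeta k x t) t)) := by
  refine tendsto_const_nhds.prodMk_nhds ((continuousOn_fanVel hV k (x, t) hx).tendsto.comp
    (tendsto_nhdsWithin_iff.2 ⟨((continuous_id.prodMk continuous_const).tendsto x).mono_left
      nhdsWithin_le_nhds, hS⟩))

theorem exists_left_limit (hV : Continuous fun p : ℝ × ℝ => V p.1 p.2) {x t : ℝ} (ht : 0 < t)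
    (hne : ∀ q, d.D q → T.c t q ≠ x) : ∃ (v ℓ : ℝ) (j : ℕ),
      Tendsto (fun y => T.out V (y, t)) (𝓝[<] x) (𝓝 (v, V ℓ t)) ∧
      (∀ p, d.D p → x ≤ T.c t p → j ≤ p) ∧ d.w j ≤ ℓ ∧ x ≤ d.Y j + d.Phi ℓ t := by
  rcases eventually_out_eq (V := V) ht.le hne with
    ⟨i, hs, hr, -, hev⟩ | ⟨k, hk, hs, hl, hr, hev⟩
  · refine ⟨d.v i, d.w i, i, ?_, fun p hp hle => not_lt.1 fun hlt => ?_, le_rfl, hr⟩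
    · exact tendsto_const_nhds.congr' (((tendsto_slice ht.le _).eventually hev).mono
        fun y hy => hy.symm)
    · linarith [(hs p hp).1 hlt]
  · have hev' := (tendsto_slice (x := x) ht.le (Iio x)).eventually hev
    have hkp : ∀ p, d.D p → x ≤ T.c t p → k + 1 ≤ p := fun p hp hle => not_lt.1 fun hlt => by
      linarith [(hs p hp).1 hlt]
    by_cases h1 : x ≤ d.Y k + d.Phi (d.w k) t
    · refine ⟨d.v k, d.w k, k, ?_, fun p hp hle => by have := hkp p hp hle; omega, le_rfl, h1⟩
      refine tendsto_const_nhds.congr' ?_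
      filter_upwards [hev', self_mem_nhdsWithin] with y hy hyx
      rw [hy, fan, if_pos ((le_of_lt hyx).trans h1)]
    · have h1' : ∀ᶠ y in 𝓝[<] x, d.Y k + d.Phi (d.w k) t < y :=
        nhdsWithin_le_nhds (lt_mem_nhds (not_le.1 h1))
      by_cases h2 : x ≤ d.Y k + d.Phi (d.w (k + 1)) t
      · have h3 := zeta_spec ht (not_le.1 h1).le h2
        refine ⟨0, d.zeta k x t, k, ?_, fun p hp hle => by have := hkp p hp hle; omega,
          h3.2.1, h3.1.ge⟩
        refine (tendsto_fanVel hV (⟨ht, (not_le.1 h1).le, h2⟩ : (x, t) ∈ d.fanRegion k) ?_).congr'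
          ?_
        · filter_upwards [h1', self_mem_nhdsWithin] with y hy hyx
          exact ⟨ht, hy.le, (le_of_lt hyx).trans h2⟩
        · filter_upwards [h1', hev', self_mem_nhdsWithin] with y h4 h5 h6
          rw [h5, fan, if_neg (not_le.2 h4), if_pos (lt_of_lt_of_le h6 h2)]
      · refine ⟨d.v (k + 1), d.w (k + 1), k + 1, ?_, hkp, le_rfl, hr.le⟩
        refine tendsto_const_nhds.congr' ?_
        filter_upwards [h1', hev', nhdsWithin_le_nhds (lt_mem_nhds (not_le.1 h2))] with y h4 h5 h6
        rw [h5, fan, if_neg (not_le.2 h4), if_neg (not_lt.2 (le_of_lt h6))]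

theorem exists_right_limit (hV : Continuous fun p : ℝ × ℝ => V p.1 p.2) {x t : ℝ} (ht : 0 < t)
    (hne : ∀ q, d.D q → T.c t q ≠ x) (hex : ∃ p, d.D p ∧ T.c t p < x) : ∃ (v ℓ : ℝ) (j : ℕ),
      Tendsto (fun y => T.out V (y, t)) (𝓝[>] x) (𝓝 (v, V ℓ t)) ∧
      (∀ p, d.D p → T.c t p < x → p ≤ j) ∧ ℓ ≤ d.w (j + 1) ∧ d.Y j + d.Phi ℓ t ≤ x := by
  obtain ⟨p₀, hp₀, hp₀x⟩ := hex
  rcases eventually_out_eq (V := V) ht.le hne with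
    ⟨i, hs, hr, hl, hev⟩ | ⟨k, hk, hs, hl, hr, hev⟩
  · have := (hs p₀ hp₀).2 hp₀x
    obtain ⟨j, rfl⟩ : ∃ j, i = j + 1 := ⟨i - 1, by omega⟩
    refine ⟨d.v (j + 1), d.w (j + 1), j, ?_, fun p hp hlt => ?_, le_rfl, hl j rfl⟩
    · exact tendsto_const_nhds.congr' (((tendsto_slice ht.le _).eventually hev).mono
        fun y hy => hy.symm)
    · have := (hs p hp).2 hlt
      omega
  · have hev' := (tendsto_slice (x := x) ht.le (Ioi x)).eventually hev
    have hkp : ∀ p, d.D p → T.c t p < x → p < k := fun p hp hlt => by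
      have := (hs p hp).2 hlt
      have : p ≠ k := fun he => hk (he ▸ hp)
      omega
    have := hkp p₀ hp₀ hp₀x
    by_cases h1 : x < d.Y k + d.Phi (d.w k) t
    · obtain ⟨j, rfl⟩ : ∃ j, k = j + 1 := ⟨k - 1, by omega⟩
      refine ⟨d.v (j + 1), d.w (j + 1), j, ?_,
        fun p hp hle => by have := hkp p hp hle; omega, le_rfl, (hl j rfl).le⟩
      refine tendsto_const_nhds.congr' ?_
      filter_upwards [hev', nhdsWithin_le_nhds (gt_mem_nhds h1)] with y hy hyx
      rw [hy, fan, if_pos (le_of_lt hyx)]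
    · have h1 := not_lt.1 h1
      by_cases h2 : x < d.Y k + d.Phi (d.w (k + 1)) t
      · have h3 := zeta_spec ht h1 h2.le
        refine ⟨0, d.zeta k x t, k, ?_, fun p hp hle => (hkp p hp hle).le, h3.2.2, h3.1.le⟩
        have h2' : ∀ᶠ y in 𝓝[>] x, y < d.Y k + d.Phi (d.w (k + 1)) t :=
          nhdsWithin_le_nhds (gt_mem_nhds h2)
        refine (tendsto_fanVel hV (⟨ht, h1, h2.le⟩ : (x, t) ∈ d.fanRegion k) ?_).congr' ?_
        · filter_upwards [h2', self_mem_nhdsWithin] with y hy hyx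
          exact ⟨ht, h1.trans (le_of_lt hyx), hy.le⟩
        · filter_upwards [h2', hev', self_mem_nhdsWithin] with y h4 h5 h6
          rw [h5, fan, if_neg (not_le.2 (lt_of_le_of_lt h1 h6)), if_pos h4]
      · have h2 := not_lt.1 h2
        refine ⟨d.v (k + 1), d.w (k + 1), k, ?_, fun p hp hle => (hkp p hp hle).le, le_rfl, h2⟩
        refine tendsto_const_nhds.congr' ?_
        filter_upwards [hev', self_mem_nhdsWithin] with y h5 h6
        rw [h5, fan, if_neg (not_le.2 (lt_of_le_of_lt h1 h6)),
          if_neg (not_lt.2 (h2.trans (le_of_lt h6)))]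

end Track

end StepData

namespace StepData

namespace Track

variable {d : StepData} {T : Track d} {V : ℝ → ℝ → ℝ}

theorem mem_fanRegion {x t : ℝ} (ht : 0 ≤ t) {k : ℕ} (hk : T.outIdx x t = k + 1)
    (hx : x < d.Y k + d.Phi (d.w (k + 1)) t) : (x, t) ∈ d.fanRegion k := by
  have hs := splits_outIdx (T := T) x ht
  rw [hk] at hs
  have hD : ¬ d.D k := fun hD => by linarith [hs.Y_le_of_succ ht hD]
  have hxk : d.Y k + d.Phi (d.w k) t < x := by
    by_contra hlt
    have : T.Cand x t k := ⟨fun p hp hpx => by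
      have := (hs p hp).2 hpx
      have : p ≠ k := fun he => hD (he ▸ hp)
      omega, not_lt.1 hlt⟩
    have := outIdx_le this
    omega
  refine ⟨lt_of_le_of_ne ht fun h0 => ?_, hxk.le, hx.le⟩
  have h0 : 0 = t := h0
  rw [← h0, d.Phi_zero] at hx hxk
  linarith

theorem out_cases (T : Track d) (V : ℝ → ℝ → ℝ) (x : ℝ) {t : ℝ} (ht : 0 ≤ t) :
    (∃ ℓ, |ℓ| ≤ d.Wb ∧ T.out V (x, t) = (0, V ℓ t)) ∨
    ∃ i, T.Splits x t i ∧ x ≤ d.Y i + d.Phi (d.w i) t ∧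
      (∀ k, i = k + 1 → d.Y k + d.Phi (d.w i) t ≤ x) ∧ T.out V (x, t) = (d.v i, V (d.w i) t) := by
  have hs := splits_outIdx (T := T) x ht
  have hc := (cand_outIdx (T := T) x ht).2
  by_cases h : 0 < T.outIdx x t ∧
      x < d.Y (T.outIdx x t - 1) + d.Phi (d.w (T.outIdx x t)) t
  · obtain ⟨k, hk⟩ : ∃ k, T.outIdx x t = k + 1 := ⟨T.outIdx x t - 1, by omega⟩
    refine Or.inl ⟨d.zeta k x t, ?_, ?_⟩
    · have h2 := h.2
      rw [hk] at h2
      have := mem_fanRegion ht hk h2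
      exact abs_zeta_le this.1 this.2.1 this.2.2
    · rw [out]
      simp only
      rw [if_pos h, hk, fanVel]
      rfl
  · refine Or.inr ⟨_, hs, hc, fun k hk => not_lt.1 fun hlt => h ⟨by omega, ?_⟩, ?_⟩
    · rwa [show T.outIdx x t - 1 = k by omega]
    · rw [out]
      exact if_neg h

theorem out_zero (x : ℝ) : T.out V (x, 0) = (d.rho x, V (d.lab x) 0) := by
  have hs : T.Splits x 0 (d.idx x) := fun p _ => by rw [T.c_zero, d.lt_idx_iff]
  have h : T.outIdx x 0 = d.idx x := by
    refine hs.outIdx_eq le_rfl ?_ fun k hk => Or.inl ?_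
    · rw [d.Phi_zero, add_zero]; exact d.le_Y_idx x
    · rw [d.Phi_zero, add_zero]; exact d.Y_lt_of_lt_idx (by omega)
  refine out_eq_state h fun k hk => ?_
  rw [d.Phi_zero, add_zero]
  exact (d.Y_lt_of_lt_idx (by omega)).le

theorem out_X {y t : ℝ} (ht : 0 ≤ t) (hy : y ∈ Free d (T.c t) t) :
    T.out V (d.X y t, t) = (d.rho y, V (d.lab y) t) := by
  obtain ⟨-, h2, h3⟩ := chi_free (T.mono_c t) hy.1
  have hs : T.Splits (d.X y t) t (d.idx y) := fun p hp =>
    ⟨fun h => h2 p hp h, fun h => not_le.1 fun hle => by linarith [h3 p hp hle]⟩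
  have h4 : ∀ k, d.idx y = k + 1 → d.Y k + d.Phi (d.w (d.idx y)) t < d.X y t := fun k hk => by
    have := d.Y_lt_of_lt_idx (y := y) (j := k) (by omega)
    rw [X, lab]
    linarith
  refine out_eq_state (hs.outIdx_eq ht ?_ fun k hk => Or.inr (h4 k hk)) fun k hk => (h4 k hk).le
  have := d.le_Y_idx y
  rw [X, lab]
  linarith

/-- Off the waves and up to countably many points, the density vanishes unless the point lies on
the characteristic of a label that is still free. -/
theorem out_eq_zero_or {x t : ℝ} (ht : 0 ≤ t) (hne : ∀ q, d.D q → T.c t q ≠ x)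
    (hc : ∀ i j, x ≠ d.Y i + d.Phi (d.w j) t) :
    (T.out V (x, t)).1 = 0 ∨ ∃ y ∈ Free d (T.c t) t, d.X y t = x := by
  rcases out_cases T V x ht with ⟨ℓ, -, h⟩ | ⟨i, hs, h1, h2, -⟩
  · exact Or.inl (by rw [h])
  · right
    set y := x - d.Phi (d.w i) t with hy
    have hi : d.idx y = i := by
      refine d.idx_eq_iff.2 ⟨by linarith, fun j hj => ?_⟩
      obtain ⟨k, rfl⟩ : ∃ k, i = k + 1 := ⟨i - 1, by omega⟩
      have h3 := lt_of_le_of_ne (h2 k rfl) (hc _ _).symm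
      have h4 := d.Y_strictMono.monotone (show j ≤ k by omega)
      linarith
    have hX : d.X y t = x := by rw [X, lab, hi, hy]; ring
    have hchi : d.chi (T.c t) t y = x := by
      rw [chi_eq_X, hX]
      · intro p hp hpi; rw [hX]; exact ((hs p hp).1 (hi ▸ hpi)).le
      · intro q hq hqi
        rw [hX]
        exact not_lt.1 fun hlt => by have := (hs q hq).2 hlt; omega
    refine ⟨y, ⟨fun q hq h => hne q hq (h ▸ hchi), fun j hj => hc j i ?_⟩, hX⟩
    rw [← hj, hy]; ring

theorem measurable_outIdx : Measurable fun p : ℝ × ℝ => T.outIdx p.1 p.2 := by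
  have hP : ∀ i, MeasurableSet {p : ℝ × ℝ | T.Cand p.1 p.2 i} := fun i => by
    have : {p : ℝ × ℝ | T.Cand p.1 p.2 i} =
        (⋂ q : ℕ, {p : ℝ × ℝ | d.D q → T.c p.2 q < p.1 → q < i}) ∩
          {p | p.1 ≤ d.Y i + d.Phi (d.w i) p.2} := by
      ext p; simp [Cand]
    rw [this]
    refine (MeasurableSet.iInter fun q => ?_).inter (measurableSet_le measurable_fst
      (measurable_const.add ((d.continuous_Phi_right _).measurable.comp measurable_snd)))
    by_cases hq : d.D q
    · by_cases hqi : q < i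
      · simp [hqi]
      · simpa [hq, hqi] using measurableSet_le (measurable_fst (α := ℝ) (β := ℝ))
          ((T.continuous_c hq).measurable.comp measurable_snd)
    · simp [hq]
  refine measurable_to_countable' fun i => ?_
  have : (fun p : ℝ × ℝ => T.outIdx p.1 p.2) ⁻¹' {i} =
      ({p | T.Cand p.1 p.2 i} ∩ ⋂ j : ℕ, {p | j < i → ¬ T.Cand p.1 p.2 j}) ∪
      {p | i = 0 ∧ ∀ j : ℕ, ¬ T.Cand p.1 p.2 j} := by
    ext p
    simp only [mem_preimage, mem_singleton_iff, mem_union, mem_inter_iff, mem_iInter]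
    constructor
    · rintro rfl
      by_cases h : ∃ j, T.Cand p.1 p.2 j
      · exact Or.inl ⟨Nat.sInf_mem h, fun j hj => Nat.notMem_of_lt_sInf hj⟩
      · push Not at h
        refine Or.inr ⟨?_, h⟩
        have : {i | T.Cand p.1 p.2 i} = ∅ := eq_empty_iff_forall_notMem.2 h
        simp [outIdx, this]
    · rintro (⟨h1, h2⟩ | ⟨rfl, h⟩)
      · exact le_antisymm (outIdx_le h1) (not_lt.1 fun hlt => h2 _ hlt (Nat.sInf_mem ⟨i, h1⟩))
      · have : {i | T.Cand p.1 p.2 i} = ∅ := eq_empty_iff_forall_notMem.2 h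
        simp [outIdx, this]
  rw [this]
  refine ((hP i).inter (MeasurableSet.iInter fun j => ?_)).union ?_
  · by_cases hj : j < i
    · simp only [hj, true_imp_iff]
      exact (hP j).compl
    · simp [hj]
  · by_cases hi : i = 0
    · have : {p : ℝ × ℝ | i = 0 ∧ ∀ j : ℕ, ¬ T.Cand p.1 p.2 j} =
          ⋂ j : ℕ, {p : ℝ × ℝ | T.Cand p.1 p.2 j}ᶜ := by
        ext p; simp [hi]
      rw [this]
      exact MeasurableSet.iInter fun j => (hP j).compl
    · simp [hi]

open Classical in
theorem measurable_out (hV : Continuous fun p : ℝ × ℝ => V p.1 p.2) :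
    Measurable fun p : ℝ × ℝ => if 0 ≤ p.2 then T.out V p else 0 := by
  have hc : ∀ ℓ, Measurable fun p : ℝ × ℝ => V ℓ p.2 := fun ℓ =>
    (hV.comp (continuous_const.prodMk continuous_snd)).measurable
  let g : (ℝ × ℝ) × ℕ → ℝ × ℝ := fun q => if 0 ≤ q.1.2 then
    (if 0 < q.2 ∧ q.1.1 < d.Y (q.2 - 1) + d.Phi (d.w q.2) q.1.2
    then (0, (d.fanRegion (q.2 - 1)).piecewise (d.fanVel V (q.2 - 1)) 0 q.1)
    else (d.v q.2, V (d.w q.2) q.1.2)) else 0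
  have hg : Measurable g := by
    refine measurable_from_prod_countable_left fun i => ?_
    refine Measurable.ite (measurableSet_le measurable_const measurable_snd)
      (Measurable.ite ?_ ?_ ?_) measurable_const
    · by_cases hi : 0 < i
      · simpa [hi] using measurableSet_lt (measurable_fst (α := ℝ) (β := ℝ))
          (measurable_const.add ((d.continuous_Phi_right (d.w i)).measurable.comp measurable_snd))
      · simp [hi]
    · have := (continuousOn_fanVel (d := d) hV (i - 1)).measurable_piecewise
        (continuousOn_const (c := (0 : ℝ))) (measurableSet_fanRegion (i - 1))
      exact measurable_const.prodMk this
    · exact (measurable_const (a := d.v i)).prodMk (hc (d.w i))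
  convert hg.comp (measurable_id.prodMk (measurable_outIdx (T := T))) using 1
  ext1 p
  simp only [Function.comp, g, id]
  by_cases hp : 0 ≤ p.2
  · rw [if_pos hp, if_pos hp, out]
    split_ifs with h
    · obtain ⟨k, hk⟩ : ∃ k, T.outIdx p.1 p.2 = k + 1 := ⟨T.outIdx p.1 p.2 - 1, by omega⟩
      have h2 := h.2
      rw [hk, Nat.add_sub_cancel] at h2
      rw [hk, Nat.add_sub_cancel, piecewise_eq_of_mem _ _ _ (mem_fanRegion hp hk h2)]
    · rfl
  · rw [if_neg hp, if_neg hp]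

/-! ### The approximate solution -/

section field

variable (hV : Continuous fun p : ℝ × ℝ => V p.1 p.2)

theorem continuous_right (hV : Continuous fun p : ℝ × ℝ => V p.1 p.2) (ℓ : ℝ) :
    Continuous (V ℓ) := hV.comp (continuous_const.prodMk continuous_id)

variable {cap : ℝ} (hcap : 0 < cap)

variable (T) in
/-- The point `p` lies in the open strip of the shadow wave `w`. -/
def InStrip (w : ShadowWave) (p : ℝ × ℝ) : Prop :=
  w.Alive p.2 ∧ p.1 ∈ Ioo (w.center p.2 - w.left p.2) (w.center p.2 + w.right p.2)

theorem InStrip.covers {w : ShadowWave} {p : ℝ × ℝ} (h : InStrip w p) : w.Covers p :=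
  ⟨h.1.1.le, h.1.2.le, h.2.1.le, h.2.2.le⟩

variable (T) in
open Classical in
/-- The approximate solution. -/
def field (p : ℝ × ℝ) : ℝ × ℝ :=
  if h : ∃ w ∈ T.waves (continuous_right hV) hcap, InStrip w p then
    (h.choose.mass p.2, h.choose.vel p.2)
  else if 0 ≤ p.2 then T.out V p else 0

theorem field_inner {w : ShadowWave} (hw : w ∈ T.waves (continuous_right hV) hcap) {p : ℝ × ℝ}
    (h : InStrip w p) : T.field hV hcap p = (w.mass p.2, w.vel p.2) := by
  have hex : ∃ w ∈ T.waves (continuous_right hV) hcap, InStrip w p := ⟨w, hw, h⟩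
  have heq : hex.choose = w := by
    by_contra hne
    exact T.waves_disjoint (continuous_right hV) hcap _ hex.choose_spec.1 w hw hne p.2
      hex.choose_spec.2.1 h.1 p.1 ⟨hex.choose_spec.2.covers, h.covers⟩
  rw [field, dif_pos hex, heq]

theorem field_outer {p : ℝ × ℝ} (hp : 0 ≤ p.2)
    (h : ∀ w ∈ T.waves (continuous_right hV) hcap, ¬ InStrip w p) :
    T.field hV hcap p = T.out V p := by
  rw [field, dif_neg (by rintro ⟨w, hw, h'⟩; exact h w hw h'), if_pos hp]

theorem field_zero (x : ℝ) : T.field hV hcap (x, 0) = (d.rho x, V (d.lab x) 0) := by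
  rw [field_outer hV hcap le_rfl, out_zero]
  intro w _ h
  exact absurd h.1.1 (not_lt.2 w.birth_nonneg)

variable (T) in
/-- The open strip of wave `p` on the segment `[s, s']` of its life. -/
def strip (cap : ℝ) (p : ℕ) (s s' : ℝ) : Set (ℝ × ℝ) :=
  {q | q.2 ∈ Ioo s s' ∧ |q.1 - T.c q.2 p| < T.width cap p s s' q.2}

theorem IsSeg.inStrip_iff {p : ℕ} {s s' : ℝ} (h : T.IsSeg p s s') {q : ℝ × ℝ} :
    InStrip (T.wave (continuous_right hV) hcap h) q ↔ q ∈ T.strip cap p s s' := by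
  rw [InStrip, h.alive_iff]
  simp only [wave, strip, mem_ofPred_eq, abs_lt, mem_Ioo]
  constructor
  · rintro ⟨h1, h2, h3⟩; exact ⟨h1, by linarith, by linarith⟩
  · rintro ⟨h1, h2, h3⟩; exact ⟨h1, by linarith, by linarith⟩

theorem IsSeg.isOpen_strip {p : ℕ} {s s' : ℝ} (h : T.IsSeg p s s') (hcap : 0 < cap) :
    IsOpen (T.strip cap p s s') := by
  have h1 := (T.continuous_c h.hD).comp (continuous_snd (X := ℝ))
  have h2 := (h.isWidth hcap).cont.comp (continuous_snd (X := ℝ))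
  exact (isOpen_Ioo.preimage continuous_snd).inter
    (isOpen_lt (continuous_abs.comp (continuous_fst.sub h1)) h2)

theorem measurable_field : Measurable (T.field hV hcap) := by
  classical
  have hW := T.waves_countable (continuous_right hV) hcap
  have hS : ∀ w ∈ T.waves (continuous_right hV) hcap, MeasurableSet {p | InStrip w p} ∧
      ∃ g : ℝ × ℝ → ℝ × ℝ, Measurable g ∧ ∀ p, InStrip w p → T.field hV hcap p = g p := by
    intro w hw
    have hfi := @field_inner d T V hV cap hcap w hw
    obtain ⟨p, s, s', h, rfl⟩ := hw
    refine ⟨?_, fun q => ((Ioo s s').piecewise (T.wave (continuous_right hV) hcap h).mass 0 q.2,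
      (Ioo s s').piecewise (T.wave (continuous_right hV) hcap h).vel 0 q.2), ?_, fun q hq => ?_⟩
    · simp only [h.inStrip_iff hV hcap]
      exact (h.isOpen_strip hcap).measurableSet
    · have h1 := (T.wave (continuous_right hV) hcap h).mass_cont
      have h2 := (T.wave (continuous_right hV) hcap h).vel_cont
      have h3 : {t : ℝ | (T.wave (continuous_right hV) hcap h).birth < t ∧
          (t : EReal) < (T.wave (continuous_right hV) hcap h).death} = Ioo s s' := by
        ext t; exact h.alive_iff (continuous_right hV) hcap
      rw [h3] at h1 h2
      exact ((h1.measurable_piecewise continuousOn_const measurableSet_Ioo).comp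
        measurable_snd).prodMk ((h2.measurable_piecewise continuousOn_const
        measurableSet_Ioo).comp measurable_snd)
    · have := (h.alive_iff (continuous_right hV) hcap).1 hq.1
      rw [hfi hq]
      dsimp only
      rw [piecewise_eq_of_mem _ _ _ this, piecewise_eq_of_mem _ _ _ this]
  choose hm g hg hfg using hS
  intro A hA
  have : T.field hV hcap ⁻¹' A =
      (⋃ w ∈ T.waves (continuous_right hV) hcap, {p | InStrip w p} ∩ T.field hV hcap ⁻¹' A) ∪
      ((⋃ w ∈ T.waves (continuous_right hV) hcap, {p | InStrip w p})ᶜ ∩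
        (fun p : ℝ × ℝ => if 0 ≤ p.2 then T.out V p else 0) ⁻¹' A) := by
    ext p
    by_cases h : ∃ w ∈ T.waves (continuous_right hV) hcap, InStrip w p
    · simp only [mem_union, mem_iUnion, mem_inter_iff, mem_compl_iff, exists_prop]
      constructor
      · intro hp
        obtain ⟨w, hw, h⟩ := h
        exact Or.inl ⟨w, hw, h, hp⟩
      · rintro (⟨w, hw, -, hp⟩ | ⟨h', -⟩)
        · exact hp
        · exact absurd h h'
    · have heq : T.field hV hcap p = if 0 ≤ p.2 then T.out V p else 0 := by rw [field, dif_neg h]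
      simp only [mem_union, mem_iUnion, mem_inter_iff, mem_compl_iff, exists_prop, mem_preimage,
        heq]
      constructor
      · intro hp; exact Or.inr ⟨h, hp⟩
      · rintro (⟨w, hw, -, hp⟩ | ⟨-, hp⟩) <;> exact hp
  rw [this]
  refine (MeasurableSet.biUnion hW fun w hw => ?_).union
    ((MeasurableSet.biUnion hW fun w hw => hm w hw).compl.inter (measurable_out hV hA))
  have h2 : {p | InStrip w p} ∩ T.field hV hcap ⁻¹' A = {p | InStrip w p} ∩ g w hw ⁻¹' A := by
    ext p
    simp only [mem_inter_iff, mem_preimage]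
    exact and_congr_right fun hp => by rw [hfg w hw p hp]
  rw [h2]
  exact (hm w hw).inter (hg w hw hA)

theorem field_vel {p : ℝ × ℝ} (hp : 0 ≤ p.2) :
    ∃ ℓ, |ℓ| ≤ d.Wb ∧ (T.field hV hcap p).2 = V ℓ p.2 := by
  by_cases h : ∃ w ∈ T.waves (continuous_right hV) hcap, InStrip w p
  · obtain ⟨w, hw, hs⟩ := h
    rw [field_inner hV hcap hw hs]
    obtain ⟨q, s, s', h, rfl⟩ := hw
    exact ⟨T.label p.2 q, T.abs_label_le _ _, rfl⟩
  · push Not at h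
    rw [field_outer hV hcap hp h]
    rcases out_cases T V p.1 hp with ⟨ℓ, h1, h2⟩ | ⟨i, -, -, -, h2⟩
    · exact ⟨ℓ, h1, by rw [h2]⟩
    · exact ⟨d.w i, d.w_le i, by rw [h2]⟩

theorem out_dens (T : Track d) (V : ℝ → ℝ → ℝ) {p : ℝ × ℝ} (hp : 0 ≤ p.2) :
    0 ≤ (T.out V p).1 ∧ (T.out V p).1 ≤ d.Vb := by
  rcases out_cases T V p.1 hp with ⟨ℓ, h1, h2⟩ | ⟨i, -, -, -, h2⟩
  · rw [h2]; exact ⟨le_rfl, d.Vb_pos.le⟩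
  · rw [h2]; exact ⟨(d.v_pos i).le, d.v_le i⟩

end field

end Track

end StepData

namespace StepData

namespace Track

variable {d : StepData} {T : Track d} {V : ℝ → ℝ → ℝ}
  (hV : Continuous fun p : ℝ × ℝ => V p.1 p.2) {cap : ℝ} (hcap : 0 < cap)

/-! ### Regularity of the approximate solution -/

theorem strip_slice {p : ℕ} {s s' t : ℝ} (ht : t ∈ Ioo s s') :
    {x | (x, t) ∈ T.strip cap p s s'} =
      Ioo (T.c t p - T.width cap p s s' t) (T.c t p + T.width cap p s s' t) := by
  ext x
  simp only [strip, mem_ofPred_eq, abs_lt, mem_Ioo]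
  exact ⟨fun h => ⟨by linarith [h.2.1], by linarith [h.2.2]⟩,
    fun h => ⟨ht, by linarith [h.1], by linarith [h.2]⟩⟩

theorem IsSeg.field_eq {p : ℕ} {s s' : ℝ} (h : T.IsSeg p s s') {q : ℝ × ℝ}
    (hq : q ∈ T.strip cap p s s') : T.field hV hcap q =
      (T.mass q.2 (T.c q.2 p) / (2 * T.width cap p s s' q.2) + 1, V (T.label q.2 p) q.2) :=
  field_inner hV hcap ⟨p, s, s', h, rfl⟩ ((h.inStrip_iff hV hcap).2 hq)

theorem field_dens_nonneg {p : ℝ × ℝ} (hp : 0 ≤ p.2) : 0 ≤ (T.field hV hcap p).1 := by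
  by_cases h : ∃ w ∈ T.waves (continuous_right hV) hcap, InStrip w p
  · obtain ⟨w, hw, hs⟩ := h
    rw [field_inner hV hcap hw hs]
    exact (w.mass_pos p.2 hs.1.1 hs.1.2).le
  · push Not at h
    rw [field_outer hV hcap hp h]
    exact (out_dens T V hp).1

theorem IsSeg.width_mul_mass {p : ℕ} {s s' t : ℝ} (h : T.IsSeg p s s') (hcap : 0 < cap)
    (ht : t ∈ Ioo s s') : 2 * T.width cap p s s' t *
      (T.mass t (T.c t p) / (2 * T.width cap p s s' t) + 1) =
      T.mass t (T.c t p) + 2 * T.width cap p s s' t := by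
  have := (h.isWidth hcap).pos t ht
  field_simp

theorem IsSeg.integrableOn_strip {p : ℕ} {s s' : ℝ} (h : T.IsSeg p s s') (B : ℝ) :
    IntegrableOn (fun q => (T.field hV hcap q).1) (T.strip cap p s s' ∩ {q | q.2 ≤ B}) := by
  have hS : MeasurableSet (T.strip cap p s s' ∩ {q | q.2 ≤ B}) :=
    (h.isOpen_strip hcap).measurableSet.inter (measurableSet_le measurable_snd measurable_const)
  rw [← integrable_indicator_iff hS]
  have hm : AEStronglyMeasurable ((T.strip cap p s s' ∩ {q | q.2 ≤ B}).indicator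
      fun q => (T.field hV hcap q).1) (volume.prod volume) :=
    ((measurable_field hV hcap).fst.indicator hS).aestronglyMeasurable
  have hslice : ∀ t, (fun x => (T.strip cap p s s' ∩ {q | q.2 ≤ B}).indicator
      (fun q => (T.field hV hcap q).1) (x, t)) = if t ∈ Ioo s s' ∧ t ≤ B then
        (Ioo (T.c t p - T.width cap p s s' t) (T.c t p + T.width cap p s s' t)).indicator
        fun _ => T.mass t (T.c t p) / (2 * T.width cap p s s' t) + 1 else 0 := by
    intro t
    ext x
    by_cases ht : t ∈ Ioo s s' ∧ t ≤ B
    · rw [if_pos ht, ← strip_slice ht.1]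
      by_cases hx : (x, t) ∈ T.strip cap p s s'
      · rw [indicator_of_mem (show (x, t) ∈ T.strip cap p s s' ∩ {q : ℝ × ℝ | q.2 ≤ B} from
          ⟨hx, ht.2⟩), indicator_of_mem (show x ∈ {x | (x, t) ∈ T.strip cap p s s'} from hx),
          h.field_eq hV hcap hx]
      · rw [indicator_of_notMem (fun h => hx h.1),
          indicator_of_notMem (show x ∉ {x | (x, t) ∈ T.strip cap p s s'} from hx)]
    · rw [if_neg ht, indicator_of_notMem (fun h => ht ⟨h.1.1, h.2⟩)]
      rfl
  rw [Measure.volume_eq_prod, integrable_prod_iff' hm]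
  refine ⟨Eventually.of_forall fun t => ?_, ?_⟩
  · rw [hslice t]
    split_ifs with ht
    · exact (integrable_indicator_iff measurableSet_Ioo).2 (integrableOn_const (by simp))
    · exact integrable_zero _ _ _
  · have hint : IntegrableOn (fun _ : ℝ => massBound d B + 2 * cap) (Icc 0 B) :=
      integrableOn_const (by simp)
    refine ((integrable_indicator_iff measurableSet_Icc).2 hint).mono'
      (hm.norm.prod_swap.integral_prod_right') (Eventually.of_forall fun t => ?_)
    have h0 : ∀ x, ‖(T.strip cap p s s' ∩ {q : ℝ × ℝ | q.2 ≤ B}).indicator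
      (fun q => (T.field hV hcap q).1) (x, t)‖ = (T.strip cap p s s' ∩ {q : ℝ × ℝ | q.2 ≤ B}).indicator
      (fun q => (T.field hV hcap q).1) (x, t) := fun x => by
      rw [Real.norm_of_nonneg]
      by_cases hx : (x, t) ∈ T.strip cap p s s' ∩ {q : ℝ × ℝ | q.2 ≤ B}
      · rw [indicator_of_mem hx]
        exact field_dens_nonneg hV hcap (h.nonneg.trans hx.1.1.1.le)
      · rw [indicator_of_notMem hx]
    rw [Real.norm_of_nonneg (integral_nonneg fun x => norm_nonneg _)]
    simp only [h0]
    rw [hslice t]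
    split_ifs with ht
    · have hw := (h.isWidth hcap).pos t ht.1
      have ht0 : 0 ≤ t := h.nonneg.trans ht.1.1.le
      rw [integral_indicator measurableSet_Ioo, setIntegral_const, smul_eq_mul,
        measureReal_def, Real.volume_Ioo, ENNReal.toReal_ofReal (by linarith),
        show T.c t p + T.width cap p s s' t - (T.c t p - T.width cap p s s' t) =
          2 * T.width cap p s s' t by ring, h.width_mul_mass hcap ht.1,
        indicator_of_mem (show t ∈ Icc 0 B from ⟨ht0, ht.2⟩)]
      have h1 := (h.isWidth hcap).le_cap t
      have h2 : T.mass t (T.c t p) ≤ massBound d B := T.mass_le ht0 ht.2 _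
      linarith
    · have : ∫ x : ℝ, (0 : ℝ → ℝ) x = 0 := by simp
      rw [this]
      refine indicator_nonneg (fun t ht => ?_) t
      have := d.Vb_pos
      have := d.L_nonneg B
      have : 0 ≤ B := ht.1.trans ht.2
      rw [massBound]
      positivity

theorem integrableOn_dens (a b B : ℝ) :
    IntegrableOn (fun q => (T.field hV hcap q).1) (Icc a b ×ˢ Icc 0 B) := by
  have hF := T.waves_locally_finite (continuous_right hV) hcap a b B
  set F := {w ∈ T.waves (continuous_right hV) hcap | ∃ p ∈ Icc a b ×ˢ Icc 0 B, w.Covers p}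
  have hbox : MeasurableSet (Icc a b ×ˢ Icc 0 B : Set (ℝ × ℝ)) :=
    measurableSet_Icc.prod measurableSet_Icc
  have h1 : IntegrableOn (fun q => (T.field hV hcap q).1)
      (⋃ w ∈ F, {q | InStrip w q} ∩ {q | q.2 ≤ B}) := by
    rw [integrableOn_finite_biUnion hF]
    rintro _ ⟨⟨p, s, s', h, rfl⟩, -⟩
    simp only [h.inStrip_iff hV hcap]
    exact h.integrableOn_strip hV hcap B
  have hm : MeasurableSet (⋃ w ∈ F, {q | InStrip w q} ∩ {q | q.2 ≤ B}) := by
    refine MeasurableSet.biUnion hF.countable ?_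
    rintro _ ⟨⟨p, s, s', h, rfl⟩, -⟩
    simp only [h.inStrip_iff hV hcap]
    exact (h.isOpen_strip hcap).measurableSet.inter
      (measurableSet_le measurable_snd measurable_const)
  have h2 : IntegrableOn (fun q => (T.field hV hcap q).1)
      ((Icc a b ×ˢ Icc 0 B) \ ⋃ w ∈ F, {q | InStrip w q} ∩ {q | q.2 ≤ B}) := by
    have hfin : volume (Icc a b ×ˢ Icc 0 B : Set (ℝ × ℝ)) < ⊤ :=
      (isCompact_Icc.prod isCompact_Icc).measure_lt_top
    refine Measure.integrableOn_of_bounded (M := d.Vb)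
      ((measure_mono sdiff_subset).trans_lt hfin).ne
      (measurable_field hV hcap).fst.aestronglyMeasurable ?_
    refine (ae_restrict_mem (hbox.diff hm)).mono fun q hq => ?_
    have hq0 : 0 ≤ q.2 := hq.1.2.1
    rw [Real.norm_of_nonneg (field_dens_nonneg hV hcap hq0), field_outer hV hcap hq0]
    · exact (out_dens T V hq0).2
    · intro w hw hs
      refine hq.2 (mem_iUnion₂.2 ⟨w, ⟨hw, q, hq.1, hs.covers⟩, hs, hq.1.2.2⟩)
  refine (h1.union h2).mono_set fun q hq => ?_
  by_cases hq' : q ∈ ⋃ w ∈ F, {q | InStrip w q} ∩ {q | q.2 ≤ B}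
  · exact Or.inl hq'
  · exact Or.inr ⟨hq, hq'⟩

theorem isLocallyRegular_field : IsLocallyRegular (T.field hV hcap) := by
  refine ⟨measurable_field hV hcap, fun p hp => ?_, fun B => ?_⟩
  · refine ⟨Icc (p.1 - 1) (p.1 + 1) ×ˢ Icc 0 (p.2 + 1), ?_, integrableOn_dens hV hcap _ _ _⟩
    have h3 : ∀ᶠ q : ℝ × ℝ in 𝓝[{q : ℝ × ℝ | 0 ≤ q.2}] p,
        q ∈ Ioo (p.1 - 1) (p.1 + 1) ×ˢ Iio (p.2 + 1) := nhdsWithin_le_nhds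
      ((isOpen_Ioo.prod isOpen_Iio).mem_nhds ⟨⟨by linarith, by linarith⟩, by simp⟩)
    filter_upwards [h3, self_mem_nhdsWithin] with q hq hq0
    exact ⟨⟨hq.1.1.le, hq.1.2.le⟩, hq0, le_of_lt hq.2⟩
  · obtain ⟨M, hM⟩ := ((isCompact_Icc (a := -d.Wb) (b := d.Wb)).prod
      (isCompact_Icc (a := (0 : ℝ)) (b := B))).exists_bound_of_continuousOn hV.continuousOn
    refine ⟨M, fun x t ht => ?_⟩
    obtain ⟨ℓ, h1, h2⟩ := field_vel hV hcap (T := T) (p := (x, t)) ht.1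
    rw [h2]
    exact hM (ℓ, t) ⟨abs_le.1 h1, ht⟩

/-! ### Admissibility -/

variable {hV hcap} in
theorem IsSeg.eventually_not_inStrip {p : ℕ} {s s' t x : ℝ} (h : T.IsSeg p s s')
    (ht : t ∈ Ioo s s') (hx : (T.wave (continuous_right hV) hcap h).Covers (x, t)) :
    ∀ᶠ y in 𝓝 x, ∀ w ∈ T.waves (continuous_right hV) hcap,
      w ≠ T.wave (continuous_right hV) hcap h → ¬ InStrip w (y, t) := by
  have hF := T.waves_locally_finite (continuous_right hV) hcap (x - 1) (x + 1) t
  set F := {w ∈ T.waves (continuous_right hV) hcap |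
    ∃ p ∈ Icc (x - 1) (x + 1) ×ˢ Icc 0 t, w.Covers p} with hFdef
  have h1 : ∀ᶠ y in 𝓝 x, ∀ w ∈ F, w ≠ T.wave (continuous_right hV) hcap h →
      ¬ InStrip w (y, t) := by
    rw [hF.eventually_all]
    intro w hw
    by_cases hc : w.Covers (x, t)
    · refine Eventually.of_forall fun y hne hs => ?_
      exact T.waves_disjoint _ hcap w hw.1 _ ⟨p, s, s', h, rfl⟩ hne t hs.1
        ((h.alive_iff (continuous_right hV) hcap).2 ht) x ⟨hc, hx⟩
    · have hcl := (T.isClosed_covers (continuous_right hV) hcap hw.1).isOpen_compl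
      have : ∀ᶠ y in 𝓝 x, ((y, t) : ℝ × ℝ) ∈ {p | w.Covers p}ᶜ :=
        (continuous_id.prodMk continuous_const).continuousAt.eventually (hcl.mem_nhds hc)
      exact this.mono fun y hy _ hs => hy hs.covers
  filter_upwards [h1, Icc_mem_nhds (show x - 1 < x by linarith) (show x < x + 1 by linarith)]
    with y hy hyx w hw hne hs
  exact hy w ⟨hw, (y, t), ⟨hyx, h.nonneg.trans ht.1.le, le_rfl⟩, hs.covers⟩ hne hs

theorem isOvercompressive_field {f : ℝ → ℝ} (hf : StrictMono f)
    (hVm : ∀ t, StrictMono fun ℓ => V ℓ t) :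
    IsOvercompressive f (T.waves (continuous_right hV) hcap) (T.field hV hcap) := by
  rintro _ ⟨p, s, s', h, rfl⟩ t ht
  rw [h.alive_iff] at ht
  have hw := h.isWidth hcap
  have hpos := hw.pos t ht
  have ht0 : 0 < t := h.nonneg.trans_lt ht.1
  set r := T.width cap p s s' t with hr
  set ℓ := T.label t p with hℓ
  have hne : ∀ σ : ℝ, |σ| = 1 → ∀ q, d.D q → T.c t q ≠ T.c t p + σ * r := by
    intro σ hσ q hq heq
    have h1 : |T.c t q - T.c t p| = r := by
      rw [heq, add_sub_cancel_left, abs_mul, hσ, one_mul, abs_of_pos hpos]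
    by_cases he : T.c t q = T.c t p
    · rw [he, sub_self, abs_zero] at h1; linarith
    · linarith [hw.sep t ht q hq he]
  have hcov : ∀ x, |x - T.c t p| ≤ r → (T.wave (continuous_right hV) hcap h).Covers (x, t) :=
    fun x hx => (h.covers_iff _ hcap).2 ⟨⟨ht.1.le, ht.2.le⟩, hx⟩
  have hlabel : ∀ x y, x = T.c t p + y → |y| ≤ r → ∀ S : Set ℝ,
      (∀ z ∈ S, z ∉ Ioo (T.c t p - r) (T.c t p + r)) →
      ∀ᶠ z in 𝓝[S] x, T.out V (z, t) = T.field hV hcap (z, t) := by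
    intro x y hx hy S hS
    have := h.eventually_not_inStrip (hV := hV) (hcap := hcap) ht
      (hcov x (by rw [hx, add_sub_cancel_left]; exact hy))
    filter_upwards [nhdsWithin_le_nhds this, self_mem_nhdsWithin] with z hz hzS
    refine (field_outer hV hcap ht0.le fun w hw' hs => ?_).symm
    by_cases hwne : w = T.wave (continuous_right hV) hcap h
    · subst hwne
      exact hS z hzS hs.2
    · exact hz w hw' hwne hs
  obtain ⟨v, ℓ₁, j, h1, h2, h3, h4⟩ := exists_left_limit (V := V) hV ht0
    (hne (-1) (by norm_num))
  obtain ⟨v', ℓ₂, j', h1', h2', h3', h4'⟩ := exists_right_limit (V := V) hV ht0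
    (hne 1 (by norm_num)) ⟨p, h.hD, by linarith⟩
  have hlt : ℓ < ℓ₁ := by
    by_contra hle
    have h5 := hw.left t ht j (h2 p h.hD (by linarith)) (h3.trans (not_lt.1 hle))
    have h6 := d.Phi_mono (not_lt.1 hle) ht0.le
    linarith
  have hlt' : ℓ₂ < ℓ := by
    by_contra hle
    have h5 := hw.right t ht j' (fun q hq hqp => h2' q hq (by linarith)) ((not_lt.1 hle).trans h3')
    have h6 := d.Phi_mono (not_lt.1 hle) ht0.le
    linarith
  refine ⟨(v, V ℓ₁ t), (v', V ℓ₂ t), ?_, ?_, hf (hVm t hlt'), hf (hVm t hlt)⟩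
  · change Tendsto _ (𝓝[<] (T.c t p - r)) _
    have hx : T.c t p - r = T.c t p + -1 * r := by ring
    rw [hx]
    refine h1.congr' (hlabel _ (-1 * r) rfl (by rw [neg_one_mul, abs_neg, abs_of_pos hpos]) _
      fun z hz hz' => ?_)
    rw [← hx] at hz
    exact absurd hz'.1 (not_lt.2 (le_of_lt hz))
  · change Tendsto _ (𝓝[>] (T.c t p + r)) _
    have hx : T.c t p + r = T.c t p + 1 * r := by ring
    rw [hx]
    refine h1'.congr' (hlabel _ (1 * r) rfl (by rw [one_mul, abs_of_pos hpos]) _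
      fun z hz hz' => ?_)
    rw [← hx] at hz
    exact absurd hz'.2 (not_lt.2 (le_of_lt hz))

/-! ### The structure of the approximate solution -/

theorem isShadowWaveTracking_field {f κ ua : ℝ → ℝ} {st : ℕ → ℝ × ℝ}
    (hst : ∀ i, st i = (d.v i, d.w i)) (hG : ∀ ℓ t, d.G ℓ t = f (V ℓ t))
    (hvel : ∀ ℓ t, 0 ≤ t → velocity κ ua ℓ t = V ℓ t) (hV0 : ∀ ℓ, V ℓ 0 = ℓ)
    (hchar : ∀ y ℓ t, 0 ≤ t → charLine f κ ua y ℓ t = y + d.Phi ℓ t) :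
    IsShadowWaveTracking f κ ua d.Y st (T.waves (continuous_right hV) hcap)
      (T.field hV hcap) where
  initial_left x hx := by
    have : d.idx x = 0 := Nat.le_zero.1 (d.idx_le_iff.2 hx)
    rw [field_zero, hV0, rho, lab, this, hst]
  initial i x hx := by
    have : d.idx x = i + 1 := d.idx_eq_iff.2 ⟨hx.2, fun j hj =>
      (d.Y_strictMono.monotone (Nat.lt_succ_iff.1 hj)).trans_lt hx.1⟩
    rw [field_zero, hV0, rho, lab, this, hst]
  locally_finite := T.waves_locally_finite _ hcap
  disjoint := T.waves_disjoint _ hcap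
  origin w hw := by simpa only [hst] using T.waves_origin _ hcap w hw
  continues := T.waves_continues _ hcap
  inner w hw t ht x hx := field_inner hV hcap hw (p := (x, t)) ⟨ht, hx⟩
  speed := by
    rintro _ ⟨p, s, s', h, rfl⟩ t ht
    rw [h.alive_iff] at ht
    have := h.hasDerivAt ht
    rwa [hG] at this
  outer := by
    refine ⟨fun i => d.fanVel V i, fun i hi => ⟨?_, fun t ht => ?_⟩, fun p hp hcov => ?_⟩
    · refine (continuousOn_fanVel hV i).mono fun p hp => ?_
      obtain ⟨h1, h2, h3⟩ := hp
      rw [hchar _ _ _ h1.le, hst] at h2 h3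
      exact ⟨h1, h2, h3⟩
    · rw [hchar _ _ _ ht.le, hchar _ _ _ ht.le, hvel _ _ ht.le, hvel _ _ ht.le, hst, hst]
      simp only [fanVel]
      rw [zeta_eq ht rfl, zeta_eq ht rfl]
      exact ⟨rfl, rfl⟩
    · have hne : ∀ q, d.D q → T.c p.2 q ≠ p.1 := fun q hq heq => by
        obtain ⟨w, hw, hc⟩ := T.covers_center (continuous_right hV) hcap hq hp
        rw [heq] at hc
        exact hcov w hw hc
      have hout : ∀ᶠ q in 𝓝[{q : ℝ × ℝ | 0 ≤ q.2}] p, T.field hV hcap q = T.out V q := by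
        filter_upwards [T.eventually_not_covers (continuous_right hV) hcap hcov,
          self_mem_nhdsWithin] with q hq hq0
        exact field_outer hV hcap hq0 fun w hw hs => hq w hw hs.covers
      rcases eventually_out_eq (V := V) hp hne with
        ⟨i, -, -, -, hev⟩ | ⟨k, hk, -, -, -, hev⟩
      · refine Or.inl ⟨i, ?_⟩
        filter_upwards [hout, hev, self_mem_nhdsWithin] with q h1 h2 h3
        rw [h1, h2, hst, hvel _ _ h3]
      · refine Or.inr ⟨k, by rw [hst, hst]; exact not_lt.1 hk, ?_⟩
        filter_upwards [hout, hev, self_mem_nhdsWithin] with q h1 h2 h3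
        rw [h1, h2, fan, elementaryWave, hchar _ _ _ h3, hchar _ _ _ h3, hvel _ _ h3,
          hvel _ _ h3, hst, hst]

end Track

end StepData

namespace StepData

namespace Track

variable {d : StepData} {T : Track d} {V : ℝ → ℝ → ℝ}

/-! ### The mass at a fixed time, in label coordinates -/

variable (T) in
/-- The labels that have not been absorbed by a wave. -/
def alone (t : ℝ) : Set ℝ := {y | ∀ q, d.D q → T.pos t y ≠ T.c t q}

theorem measurableSet_alone (t : ℝ) : MeasurableSet (T.alone t) := by
  have : T.alone t = ⋂ q : ℕ, {y | d.D q → T.pos t y ≠ T.c t q} := by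
    ext y; simp [alone]
  rw [this]
  refine MeasurableSet.iInter fun q => ?_
  by_cases hq : d.D q
  · simp only [hq, true_imp_iff]
    exact (T.measurableSet_fib t (T.c t q)).compl
  · simp [hq]

theorem free_eq (t : ℝ) : Free d (T.c t) t = T.alone t ∩ {y | ∀ i, y ≠ d.Y i} := rfl

theorem measurableSet_free (t : ℝ) : MeasurableSet (Free d (T.c t) t) := by
  rw [free_eq]
  refine (measurableSet_alone t).inter ?_
  have : {y | ∀ i, y ≠ d.Y i} = (range d.Y)ᶜ := by
    ext y
    simp only [mem_ofPred_eq, mem_compl_iff, mem_range, not_exists]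
    exact forall_congr' fun i => ne_comm
  rw [this]
  exact (countable_range d.Y).measurableSet.compl

/-- The solution outside the waves, extended to all of `ℝ`, carries the mass of the labels that are
still free. -/
theorem integral_out {t : ℝ} (ht : 0 ≤ t) (Θ : ℝ → ℝ → ℝ) :
    ∫ x, (T.out V (x, t)).1 * Θ (T.out V (x, t)).2 x =
      ∫ y in T.alone t, d.rho y * Θ (V (d.lab y) t) (T.pos t y) := by
  set S := Free d (T.c t) t with hS
  have hSm : MeasurableSet S := measurableSet_free t
  have h1 : ∫ x, (T.out V (x, t)).1 * Θ (T.out V (x, t)).2 x =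
      ∫ x in (fun y => d.X y t) '' S, (T.out V (x, t)).1 * Θ (T.out V (x, t)).2 x := by
    refine (setIntegral_eq_integral_of_ae_compl_eq_zero ?_).symm
    have hc1 : ∀ᵐ x : ℝ, ∀ q, T.c t q ≠ x := by
      rw [ae_all_iff]
      intro q
      filter_upwards [(countable_singleton (T.c t q)).ae_notMem volume] with x hx h
      exact hx h.symm
    have hc2 : ∀ᵐ x : ℝ, ∀ i j, x ≠ d.Y i + d.Phi (d.w j) t := by
      rw [ae_all_iff]
      intro i
      rw [ae_all_iff]
      intro j
      filter_upwards [(countable_singleton (d.Y i + d.Phi (d.w j) t)).ae_notMem volume] with x hx h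
      exact hx h
    filter_upwards [hc1, hc2] with x h1 h2 hx
    rcases out_eq_zero_or (V := V) ht (fun q _ => h1 q) h2 with h | ⟨y, hy, h⟩
    · rw [h, zero_mul]
    · exact absurd ⟨y, hy, h⟩ hx
  rw [h1, integral_image_eq_integral_abs_deriv_smul hSm
    (fun y hy => (hasDerivAt_X hy.2 t).hasDerivWithinAt)
    (strictMonoOn_X (T.mono_c t) ht).injOn]
  have h2 : ∫ y in S, |(1 : ℝ)| • ((T.out V (d.X y t, t)).1 * Θ (T.out V (d.X y t, t)).2 (d.X y t)) =
      ∫ y in S, d.rho y * Θ (V (d.lab y) t) (T.pos t y) := by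
    refine setIntegral_congr_fun hSm fun y hy => ?_
    have h3 : T.pos t y = d.X y t := (chi_free (T.mono_c t) hy.1).1
    simp only [abs_one, one_smul, out_X ht hy, h3]
  rw [h2]
  refine setIntegral_congr_set ?_
  filter_upwards [ae_ne_Y d] with y hy
  exact propext ⟨fun h => h.1, fun h => ⟨h, hy⟩⟩

variable (T) in
open Classical in
/-- The label that determines the speed of the mass from `y` at time `t`: that of the wave that has
absorbed it, or its own. -/
def posLabel (t y : ℝ) : ℝ :=
  if h : ∃ q, d.D q ∧ T.pos t y = T.c t q then T.label t h.choose else d.lab y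

theorem posLabel_eq {t y : ℝ} {q : ℕ} (hq : d.D q) (h : T.pos t y = T.c t q) :
    T.posLabel t y = T.label t q := by
  have hex : ∃ q, d.D q ∧ T.pos t y = T.c t q := ⟨q, hq, h⟩
  rw [posLabel, dif_pos hex]
  exact T.label_congr hex.choose_spec.1 hq (hex.choose_spec.2.symm.trans h)

theorem posLabel_of_alone {t y : ℝ} (h : y ∈ T.alone t) : T.posLabel t y = d.lab y :=
  dif_neg (by rintro ⟨q, hq, h'⟩; exact h q hq h')

theorem measurable_posLabel (t : ℝ) : Measurable (T.posLabel t) := by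
  intro A hA
  have : T.posLabel t ⁻¹' A = (⋃ q : ℕ, {y | (d.D q ∧ T.label t q ∈ A) ∧ T.pos t y = T.c t q}) ∪
      (T.alone t ∩ d.lab ⁻¹' A) := by
    ext y
    simp only [mem_preimage, mem_union, mem_iUnion, mem_ofPred_eq, mem_inter_iff]
    by_cases h : ∃ q, d.D q ∧ T.pos t y = T.c t q
    · obtain ⟨q, hq, h⟩ := h
      rw [posLabel_eq hq h]
      constructor
      · intro hA; exact Or.inl ⟨q, ⟨hq, hA⟩, h⟩
      · rintro (⟨q', ⟨hq', hA⟩, h'⟩ | ⟨ha, -⟩)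
        · rwa [T.label_congr hq hq' (h.symm.trans h')]
        · exact absurd h (ha q hq)
    · have ha : y ∈ T.alone t := fun q hq h' => h ⟨q, hq, h'⟩
      rw [posLabel_of_alone ha]
      constructor
      · intro hA; exact Or.inr ⟨ha, hA⟩
      · rintro (⟨q, ⟨hq, -⟩, h'⟩ | ⟨-, hA⟩)
        · exact absurd ⟨q, hq, h'⟩ h
        · exact hA
  rw [this]
  refine (MeasurableSet.iUnion fun q => ?_).union
    ((measurableSet_alone t).inter (d.measurable_lab hA))
  by_cases hq : d.D q ∧ T.label t q ∈ A
  · simp only [hq, true_and]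
    exact T.measurableSet_fib t (T.c t q)
  · simp [hq]

theorem continuous_X (y : ℝ) : Continuous fun t => d.X y t :=
  continuous_const.add (d.continuous_Phi_right _)

theorem pos_eventuallyEq_X {t y : ℝ} (h : y ∈ T.alone t) :
    ∀ᶠ r in 𝓝 t, T.pos r y = d.X y r := by
  obtain ⟨-, h1, h2⟩ := chi_free (T.mono_c t) h
  have e1 : ∀ᶠ r in 𝓝 t, ∀ p, d.D p → p < d.idx y → T.c r p ≤ d.X y r := by
    by_cases hex : ∃ p, d.D p ∧ p < d.idx y
    · obtain ⟨p, hp, hi⟩ := hex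
      obtain ⟨p', hp'⟩ := d.exists_isPred hp hi
      filter_upwards [(isOpen_lt (T.continuous_c hp'.1) (continuous_X y)).mem_nhds
        (h1 p' hp'.1 hp'.2.1)] with r hr q hq hqi
      exact (T.mono_c r q p' hq hp'.1 (hp'.2.2 q hq hqi)).trans (le_of_lt hr)
    · exact Eventually.of_forall fun r p hp hi => absurd ⟨p, hp, hi⟩ hex
  have e2 : ∀ᶠ r in 𝓝 t, ∀ q, d.D q → d.idx y ≤ q → d.X y r ≤ T.c r q := by
    by_cases hex : ∃ q, d.D q ∧ d.idx y ≤ q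
    · obtain ⟨q, hq, hi⟩ := hex
      obtain ⟨q', hq'⟩ := d.exists_isSucc hq hi
      filter_upwards [(isOpen_lt (continuous_X y) (T.continuous_c hq'.1)).mem_nhds
        (h2 q' hq'.1 hq'.2.1)] with r hr p hp hpi
      exact (le_of_lt hr).trans (T.mono_c r q' p hq'.1 hp (hq'.2.2 p hp hpi))
    · exact Eventually.of_forall fun r q hq hi => absurd ⟨q, hq, hi⟩ hex
  filter_upwards [e1, e2] with r h1 h2
  exact chi_eq_X h1 h2

theorem ae_absorbed_before {t : ℝ} (ht : 0 < t) : ∀ᵐ y : ℝ, y ∉ T.alone t →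
    ∃ s, 0 ≤ s ∧ s < t ∧ y ∉ T.alone s := by
  -- the labels absorbed during `[s, t]` fill a set of measure at most `2 L (t - s)`
  have key : ∀ q, d.D q → volume {y | T.pos t y = T.c t q ∧ ∀ s, 0 ≤ s → s < t → y ∈ T.alone s}
      = 0 := by
    intro q hq
    refine le_antisymm ?_ bot_le
    have hlim : Tendsto (fun s => ENNReal.ofReal (2 * (d.L t * (t - s)))) (𝓝[<] t) (𝓝 0) := by
      have : Tendsto (fun s : ℝ => 2 * (d.L t * (t - s))) (𝓝[<] t) (𝓝 (2 * (d.L t * (t - t)))) :=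
        (Continuous.tendsto (by fun_prop) t).mono_left nhdsWithin_le_nhds
      rw [sub_self, mul_zero, mul_zero] at this
      simpa using ENNReal.tendsto_ofReal this
    refine ge_of_tendsto hlim ?_
    filter_upwards [Ioo_mem_nhdsLT ht] with s hs
    exact (measure_mono (t := T.inc s t (T.c t q)) fun y hy => ⟨hy.1, hy.2 s hs.1.le hs.2⟩).trans
      (T.volume_inc_le hs.1.le hs.2.le le_rfl (T.c t q))
  have : ∀ᵐ y : ℝ, ∀ q, d.D q →
      ¬ (T.pos t y = T.c t q ∧ ∀ s, 0 ≤ s → s < t → y ∈ T.alone s) := by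
    rw [ae_all_iff]
    intro q
    by_cases hq : d.D q
    · have h := key q hq
      filter_upwards [measure_eq_zero_iff_ae_notMem.1 h] with y hy _ h'
      exact hy h'
    · exact Eventually.of_forall fun y h => absurd h hq
  filter_upwards [this] with y hy hal
  simp only [alone, mem_ofPred_eq, not_forall, not_not] at hal
  obtain ⟨q, hq, h⟩ := hal
  have := hy q hq
  by_contra hcon
  push Not at hcon
  exact this ⟨h, fun s h0 hs => hcon s h0 hs⟩

/-- The mass moves with the speed that belongs to `posLabel`. -/
theorem ae_hasDerivAt_pos {t : ℝ} (ht : 0 < t) (hev : ∀ p, d.D p → ¬ T.Ev p t) :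
    ∀ᵐ y : ℝ, HasDerivAt (fun r => T.pos r y) (d.G (T.posLabel t y) t) t := by
  filter_upwards [ae_absorbed_before (T := T) ht] with y hy
  by_cases hal : y ∈ T.alone t
  · rw [posLabel_of_alone hal]
    exact ((d.hasDerivAt_Phi (d.lab y) t).const_add y).congr_of_eventuallyEq
      (pos_eventuallyEq_X hal)
  · obtain ⟨s, h0, hst, hs⟩ := hy hal
    simp only [alone, mem_ofPred_eq, not_forall, not_not] at hs
    obtain ⟨q, hq, h⟩ := hs
    rw [posLabel_eq hq (T.pos_sticky h0 hst.le hq h)]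
    refine (T.hasDerivAt_c hq ht.le (hev q hq)).congr_of_eventuallyEq ?_
    filter_upwards [lt_mem_nhds hst] with r hr
    exact T.pos_sticky h0 hr.le hq h

theorem ae_not_ev : ∀ᵐ t : ℝ, ∀ p, d.D p → ¬ T.Ev p t := by
  rw [ae_all_iff]
  intro p
  by_cases hp : d.D p
  · have : {t | T.Ev p t}.Countable := by
      have h : {t | T.Ev p t} ⊆ ⋃ n : ℕ, {t | T.Ev p t ∧ t ≤ n} := fun t ht => by
        obtain ⟨n, hn⟩ := exists_nat_ge t
        exact mem_iUnion.2 ⟨n, ht, hn⟩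
      exact (countable_iUnion fun n : ℕ => (T.finite_ev hp n).countable).mono h
    filter_upwards [this.ae_notMem volume] with t ht _
    exact ht
  · exact Eventually.of_forall fun t h => absurd h hp

end Track

end StepData

/-! ### Test functions and conserved quantities -/

/-- `φ` is a differentiable test function with support in `|x| < K`, `t < B`; the constant `M`
bounds `φ`, its first derivatives, and their Lipschitz constants. -/
structure IsTest (φ : ℝ × ℝ → ℝ) (K B M : ℝ) : Prop where
  diff : Differentiable ℝ φ
  cont_t : Continuous fun p => fderiv ℝ φ p (0, 1)
  cont_x : Continuous fun p => fderiv ℝ φ p (1, 0)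
  supp : ∀ p : ℝ × ℝ, K ≤ |p.1| ∨ B ≤ p.2 →
    φ p = 0 ∧ fderiv ℝ φ p (0, 1) = 0 ∧ fderiv ℝ φ p (1, 0) = 0
  bound : ∀ p, |φ p| ≤ M ∧ |fderiv ℝ φ p (0, 1)| ≤ M ∧ |fderiv ℝ φ p (1, 0)| ≤ M
  lip : ∀ p q, |φ p - φ q| ≤ M * dist p q ∧
    |fderiv ℝ φ p (0, 1) - fderiv ℝ φ q (0, 1)| ≤ M * dist p q ∧
    |fderiv ℝ φ p (1, 0) - fderiv ℝ φ q (1, 0)| ≤ M * dist p q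

/-- A quantity carried by the mass: a unit of mass with label `ℓ` carries `a t + ℓ * b t` at
time `t`, which changes at the rate `sa t + ℓ * sb t`. Mass and momentum are of this form. -/
structure Weight where
  a : ℝ → ℝ
  b : ℝ → ℝ
  sa : ℝ → ℝ
  sb : ℝ → ℝ

/-- The regularity of a quantity carried by the mass up to time `B`, with bounds `C`. -/
structure Weight.IsGood (ϖ : Weight) (B C : ℝ) : Prop where
  bound : ∀ t ∈ Icc 0 B, |ϖ.a t| ≤ C ∧ |ϖ.b t| ≤ C ∧ |ϖ.sa t| ≤ C ∧ |ϖ.sb t| ≤ C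
  lip : ∀ s ∈ Icc 0 B, ∀ t ∈ Icc 0 B, |ϖ.a t - ϖ.a s| ≤ C * |t - s| ∧
    |ϖ.b t - ϖ.b s| ≤ C * |t - s|
  deriv : ∀ᵐ t, t ∈ Ioo 0 B → HasDerivAt ϖ.a (ϖ.sa t) t ∧ HasDerivAt ϖ.b (ϖ.sb t) t

namespace Weight

variable (ϖ : Weight)

/-- The amount carried by a unit of mass with label `ℓ`. -/
def A (ℓ t : ℝ) : ℝ := ϖ.a t + ℓ * ϖ.b t

/-- The rate of change of the amount carried by a unit of mass with label `ℓ`. -/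
def S (ℓ t : ℝ) : ℝ := ϖ.sa t + ℓ * ϖ.sb t

/-- The density of the weak form for mass with label `ℓ` that moves with the speed of label `σ`. -/
def flux (G : ℝ → ℝ → ℝ) (φ : ℝ × ℝ → ℝ) (σ ℓ x t : ℝ) : ℝ :=
  ϖ.A ℓ t * (fderiv ℝ φ (x, t) (0, 1) + G σ t * fderiv ℝ φ (x, t) (1, 0)) + ϖ.S ℓ t * φ (x, t)

variable {ϖ}

theorem abs_affine_le {a b ℓ C W : ℝ} (ha : |a| ≤ C) (hb : |b| ≤ C) (hℓ : |ℓ| ≤ W) :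
    |a + ℓ * b| ≤ C * (1 + W) := by
  refine (abs_add_le _ _).trans ?_
  rw [abs_mul]
  have := mul_le_mul hℓ hb (abs_nonneg _) ((abs_nonneg _).trans hℓ)
  linarith

theorem abs_flux_le' {A S φt φx φ g N M L : ℝ} (hA : |A| ≤ N) (hS : |S| ≤ N) (hg : |g| ≤ L)
    (ht : |φt| ≤ M) (hx : |φx| ≤ M) (hφ : |φ| ≤ M) :
    |A * (φt + g * φx) + S * φ| ≤ N * M * (2 + L) := by
  have hN := (abs_nonneg _).trans hA
  have hM := (abs_nonneg _).trans ht
  have hL := (abs_nonneg _).trans hg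
  have h1 : |φt + g * φx| ≤ M + L * M := by
    refine (abs_add_le _ _).trans (add_le_add ht ?_)
    rw [abs_mul]
    exact mul_le_mul hg hx (abs_nonneg _) hL
  refine (abs_add_le _ _).trans ?_
  rw [abs_mul, abs_mul]
  have h2 := mul_le_mul hA h1 (abs_nonneg _) hN
  have h3 := mul_le_mul hS hφ (abs_nonneg _) hN
  linarith

variable {B C : ℝ} (hϖ : ϖ.IsGood B C)

include hϖ

theorem IsGood.abs_A_le {ℓ t W : ℝ} (ht : t ∈ Icc 0 B) (hℓ : |ℓ| ≤ W) :
    |ϖ.A ℓ t| ≤ C * (1 + W) :=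
  abs_affine_le (hϖ.bound t ht).1 (hϖ.bound t ht).2.1 hℓ

theorem IsGood.abs_S_le {ℓ t W : ℝ} (ht : t ∈ Icc 0 B) (hℓ : |ℓ| ≤ W) :
    |ϖ.S ℓ t| ≤ C * (1 + W) :=
  abs_affine_le (hϖ.bound t ht).2.2.1 (hϖ.bound t ht).2.2.2 hℓ

theorem IsGood.lip_A {ℓ s t W : ℝ} (hs : s ∈ Icc 0 B) (ht : t ∈ Icc 0 B) (hℓ : |ℓ| ≤ W) :
    |ϖ.A ℓ t - ϖ.A ℓ s| ≤ C * (1 + W) * |t - s| := by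
  have := abs_affine_le (hϖ.lip s hs t ht).1 (hϖ.lip s hs t ht).2 hℓ
  rw [A, A, show ϖ.a t + ℓ * ϖ.b t - (ϖ.a s + ℓ * ϖ.b s) =
    ϖ.a t - ϖ.a s + ℓ * (ϖ.b t - ϖ.b s) by ring]
  linarith

theorem IsGood.nonneg (hB : 0 ≤ B) : 0 ≤ C :=
  (abs_nonneg _).trans (hϖ.bound 0 ⟨le_rfl, hB⟩).1

end Weight

namespace StepData

namespace Track

variable {d : StepData} {T : Track d} {ϖ : Weight} {φ : ℝ × ℝ → ℝ} {K B M C : ℝ}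

/-! ### Conservation in label coordinates -/

/-- The common bound for the densities of the weak form. -/
def fluxBound (d : StepData) (B M C : ℝ) : ℝ := C * (1 + d.Wb) * M * (2 + d.L B)

variable (T ϖ φ) in
/-- The weighted amount carried by the mass from `y`. -/
def carried (y t : ℝ) : ℝ := ϖ.A (d.lab y) t * φ (T.pos t y, t)

variable (T ϖ φ) in
/-- The rate of change of `carried`. -/
def rate (t y : ℝ) : ℝ := ϖ.flux d.G φ (T.posLabel t y) (d.lab y) (T.pos t y) t

theorem abs_flux_le (hφ : IsTest φ K B M) (hϖ : ϖ.IsGood B C) {σ ℓ x t : ℝ} (ht : t ∈ Icc 0 B)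
    (hσ : |σ| ≤ d.Wb) (hℓ : |ℓ| ≤ d.Wb) : |ϖ.flux d.G φ σ ℓ x t| ≤ fluxBound d B M C :=
  Weight.abs_flux_le' (hϖ.abs_A_le ht hℓ) (hϖ.abs_S_le ht hℓ) (d.abs_G_le hσ ht)
    (hφ.bound _).2.1 (hφ.bound _).2.2 (hφ.bound _).1

theorem lip_flux (hφ : IsTest φ K B M) (hϖ : ϖ.IsGood B C) {σ ℓ x x' t : ℝ} (ht : t ∈ Icc 0 B)
    (hσ : |σ| ≤ d.Wb) (hℓ : |ℓ| ≤ d.Wb) :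
    |ϖ.flux d.G φ σ ℓ x t - ϖ.flux d.G φ σ ℓ x' t| ≤ fluxBound d B M C * |x - x'| := by
  have h := hφ.lip (x, t) (x', t)
  have hd : dist ((x, t) : ℝ × ℝ) (x', t) = |x - x'| := by
    rw [Prod.dist_eq, dist_self, Real.dist_eq, max_eq_left (abs_nonneg _)]
  rw [hd] at h
  have := Weight.abs_flux_le' (hϖ.abs_A_le ht hℓ) (hϖ.abs_S_le ht hℓ) (d.abs_G_le hσ ht)
    h.2.1 h.2.2 h.1
  rw [fluxBound]
  refine (le_of_eq ?_).trans (this.trans (le_of_eq (by ring)))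
  rw [Weight.flux, Weight.flux]
  congr 1
  ring

theorem carried_hasDerivAt (hφ : IsTest φ K B M) {t y : ℝ} (ha : HasDerivAt ϖ.a (ϖ.sa t) t)
    (hb : HasDerivAt ϖ.b (ϖ.sb t) t)
    (hp : HasDerivAt (fun r => T.pos r y) (d.G (T.posLabel t y) t) t) :
    HasDerivAt (T.carried ϖ φ y) (T.rate ϖ φ t y) t := by
  have h1 : HasDerivAt (fun r => φ (T.pos r y, r))
      (fderiv ℝ φ (T.pos t y, t) (d.G (T.posLabel t y) t, 1)) t :=
    HasFDerivAt.comp_hasDerivAt (f := fun r => (T.pos r y, r)) t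
      (hφ.diff (T.pos t y, t)).hasFDerivAt (hp.prodMk (hasDerivAt_id t))
  have h2 : HasDerivAt (fun r => ϖ.A (d.lab y) r) (ϖ.S (d.lab y) t) t := ha.add (hb.const_mul _)
  have h3 : fderiv ℝ φ (T.pos t y, t) (d.G (T.posLabel t y) t, 1) =
      fderiv ℝ φ (T.pos t y, t) (0, 1) +
        d.G (T.posLabel t y) t * fderiv ℝ φ (T.pos t y, t) (1, 0) := by
    rw [← smul_eq_mul, ← map_smul, ← map_add]
    simp
  rw [h3] at h1
  have h4 := h2.mul h1
  rw [add_comm] at h4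
  exact h4

theorem lip_carried (hφ : IsTest φ K B M) (hϖ : ϖ.IsGood B C) (y : ℝ) {s t : ℝ}
    (hs : s ∈ Icc 0 B) (ht : t ∈ Icc 0 B) :
    |T.carried ϖ φ y t - T.carried ϖ φ y s| ≤ fluxBound d B M C * |t - s| := by
  have hL := d.L_nonneg B
  have hM := (abs_nonneg _).trans (hφ.bound 0).1
  have hpos : |T.pos t y - T.pos s y| ≤ d.L B * |t - s| := by
    rcases le_total s t with h | h
    · rw [abs_of_nonneg (sub_nonneg.2 h)]; exact T.lip_pos hs.1 h ht.2 y
    · rw [abs_sub_comm, abs_sub_comm t, abs_of_nonneg (sub_nonneg.2 h)]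
      exact T.lip_pos ht.1 h hs.2 y
  have h1 : |φ (T.pos t y, t) - φ (T.pos s y, s)| ≤ M * ((1 + d.L B) * |t - s|) := by
    refine (hφ.lip _ _).1.trans (mul_le_mul_of_nonneg_left ?_ hM)
    rw [Prod.dist_eq, Real.dist_eq, Real.dist_eq]
    have := abs_nonneg (t - s)
    refine max_le (hpos.trans ?_) ?_
    · linarith
    · have := mul_nonneg hL this
      dsimp only
      linarith
  have h2 := hϖ.lip_A hs ht (d.abs_lab_le y)
  have h3 := hϖ.abs_A_le hs (d.abs_lab_le y)
  rw [carried, carried, show ϖ.A (d.lab y) t * φ (T.pos t y, t) - ϖ.A (d.lab y) s * φ (T.pos s y, s)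
    = (ϖ.A (d.lab y) t - ϖ.A (d.lab y) s) * φ (T.pos t y, t) +
      ϖ.A (d.lab y) s * (φ (T.pos t y, t) - φ (T.pos s y, s)) by ring]
  refine (abs_add_le _ _).trans ?_
  rw [abs_mul, abs_mul]
  have h4 := mul_le_mul h2 (hφ.bound (T.pos t y, t)).1 (abs_nonneg _) ((abs_nonneg _).trans h2)
  have h5 := mul_le_mul h3 h1 (abs_nonneg _) ((abs_nonneg _).trans h3)
  rw [fluxBound]
  linarith

theorem carried_eq_zero (hφ : IsTest φ K B M) {y t : ℝ} (ht : t ∈ Icc 0 B)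
    (hy : y ∉ Icc (-(K + d.L B * B)) (K + d.L B * B)) : T.carried ϖ φ y t = 0 := by
  have h1 := abs_le.1 (T.abs_pos_sub_le ht.1 ht.2 y)
  have h2 : K ≤ |T.pos t y| := by
    by_contra hlt
    have h3 := abs_lt.1 (not_le.1 hlt)
    exact hy ⟨by linarith, by linarith⟩
  rw [carried, (hφ.supp (T.pos t y, t) (Or.inl h2)).1, mul_zero]

theorem measurable_carried (hφ : IsTest φ K B M) (t : ℝ) :
    Measurable fun y => T.carried ϖ φ y t :=
  (measurable_const.add (d.measurable_lab.mul measurable_const)).mul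
    (hφ.diff.continuous.measurable.comp ((T.measurable_pos_right t).prodMk measurable_const))

theorem measurable_rate (hφ : IsTest φ K B M) (t : ℝ) : Measurable (T.rate ϖ φ t) := by
  have hp : Measurable fun y => (T.pos t y, t) :=
    (T.measurable_pos_right t).prodMk measurable_const
  have hG : Measurable fun y => d.G (T.posLabel t y) t :=
    d.cont.measurable.comp ((measurable_posLabel t).prodMk measurable_const)
  have h1 : ∀ a b : ℝ, Measurable fun y => a + d.lab y * b := fun a b =>
    measurable_const.add (d.measurable_lab.mul measurable_const)
  exact ((h1 _ _).mul ((hφ.cont_t.measurable.comp hp).add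
    (hG.mul (hφ.cont_x.measurable.comp hp)))).add
    ((h1 _ _).mul (hφ.diff.continuous.measurable.comp hp))

variable (T ϖ φ) in
/-- The total weighted amount. -/
def total (t : ℝ) : ℝ := ∫ y, d.rho y * T.carried ϖ φ y t

theorem integrable_window (R c : ℝ) :
    Integrable ((Icc (-R) R).indicator fun _ : ℝ => c) :=
  (integrable_indicator_iff measurableSet_Icc).2 (integrableOn_const (by simp))

theorem integrable_carried (hφ : IsTest φ K B M) (hϖ : ϖ.IsGood B C) {t : ℝ} (ht : t ∈ Icc 0 B) :
    Integrable fun y => d.rho y * T.carried ϖ φ y t := by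
  refine (integrable_window (K + d.L B * B) (d.Vb * (C * (1 + d.Wb) * M))).mono'
    (d.measurable_rho.mul (measurable_carried hφ t)).aestronglyMeasurable
    (Eventually.of_forall fun y => ?_)
  by_cases hy : y ∈ Icc (-(K + d.L B * B)) (K + d.L B * B)
  · rw [indicator_of_mem hy, norm_mul]
    refine mul_le_mul (abs_rho_le y) ?_ (norm_nonneg _) d.Vb_pos.le
    rw [carried, norm_mul]
    exact mul_le_mul (hϖ.abs_A_le ht (d.abs_lab_le y)) (hφ.bound _).1 (abs_nonneg _)
      ((abs_nonneg _).trans (hϖ.abs_A_le ht (d.abs_lab_le y)))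
  · rw [indicator_of_notMem hy, carried_eq_zero hφ ht hy, mul_zero, norm_zero]

theorem lip_rho_carried (hφ : IsTest φ K B M) (hϖ : ϖ.IsGood B C) (y : ℝ) {s t : ℝ}
    (hs : s ∈ Icc 0 B) (ht : t ∈ Icc 0 B) :
    |d.rho y * T.carried ϖ φ y t - d.rho y * T.carried ϖ φ y s| ≤
      (Icc (-(K + d.L B * B)) (K + d.L B * B)).indicator
        (fun _ => d.Vb * fluxBound d B M C) y * |t - s| := by
  by_cases hy : y ∈ Icc (-(K + d.L B * B)) (K + d.L B * B)
  · rw [indicator_of_mem hy, ← mul_sub, abs_mul, mul_assoc]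
    exact mul_le_mul (abs_rho_le y) (lip_carried hφ hϖ y hs ht) (abs_nonneg _) d.Vb_pos.le
  · rw [indicator_of_notMem hy, carried_eq_zero hφ hs hy, carried_eq_zero hφ ht hy]
    simp

theorem fluxBound_nonneg (hφ : IsTest φ K B M) (hϖ : ϖ.IsGood B C) (hB : 0 ≤ B) :
    0 ≤ fluxBound d B M C :=
  (abs_nonneg _).trans (abs_flux_le (x := 0) (t := 0) (σ := d.lab 0) (ℓ := d.lab 0) hφ hϖ
    ⟨le_rfl, hB⟩ (d.abs_lab_le 0) (d.abs_lab_le 0))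

theorem hasDerivAt_total (hφ : IsTest φ K B M) (hϖ : ϖ.IsGood B C) {t : ℝ} (ht : t ∈ Ioo 0 B)
    (hev : ∀ p, d.D p → ¬ T.Ev p t) (ha : HasDerivAt ϖ.a (ϖ.sa t) t)
    (hb : HasDerivAt ϖ.b (ϖ.sb t) t) :
    Integrable (fun y => d.rho y * T.rate ϖ φ t y) ∧
      HasDerivAt (T.total ϖ φ) (∫ y, d.rho y * T.rate ϖ φ t y) t := by
  have hQ := fluxBound_nonneg (d := d) hφ hϖ (ht.1.le.trans ht.2.le)
  refine hasDerivAt_integral_of_dominated_loc_of_lip (Ioo_mem_nhds ht.1 ht.2)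
    (Eventually.of_forall fun r =>
      (d.measurable_rho.mul (measurable_carried hφ r)).aestronglyMeasurable)
    (integrable_carried hφ hϖ ⟨ht.1.le, ht.2.le⟩)
    (d.measurable_rho.mul (measurable_rate hφ t)).aestronglyMeasurable
    (Eventually.of_forall fun y => ?_)
    (integrable_window (K + d.L B * B) (d.Vb * fluxBound d B M C)) ?_
  · refine LipschitzOnWith.of_dist_le_mul fun s hs r hr => ?_
    rw [Real.dist_eq, Real.dist_eq, Real.coe_nnabs]
    refine (lip_rho_carried hφ hϖ y ⟨hr.1.le, hr.2.le⟩ ⟨hs.1.le, hs.2.le⟩).trans ?_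
    exact mul_le_mul_of_nonneg_right (le_abs_self _) (abs_nonneg _)
  · filter_upwards [ae_hasDerivAt_pos (T := T) ht.1 hev] with y hy
    exact (carried_hasDerivAt hφ ha hb hy).const_mul _

/-- The weak form is satisfied exactly in label coordinates. -/
theorem integral_rate (T : Track d) (hφ : IsTest φ K B M) (hϖ : ϖ.IsGood B C) (hB : 0 < B) :
    IntegrableOn (fun t => ∫ y, d.rho y * T.rate ϖ φ t y) (Ioo 0 B) ∧
    ∫ t in Ioo 0 B, ∫ y, d.rho y * T.rate ϖ φ t y =
      -∫ y, d.rho y * (ϖ.A (d.lab y) 0 * φ (y, 0)) := by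
  have hQ := fluxBound_nonneg (d := d) hφ hϖ hB.le
  have hlip : LipschitzOnWith (Real.toNNReal (∫ y, (Icc (-(K + d.L B * B))
      (K + d.L B * B)).indicator (fun _ => d.Vb * fluxBound d B M C) y)) (T.total ϖ φ)
      (uIcc 0 B) := by
    rw [uIcc_of_le hB.le]
    refine LipschitzOnWith.of_dist_le_mul fun s hs r hr => ?_
    rw [Real.coe_toNNReal _ (integral_nonneg fun y => indicator_nonneg
      (fun y _ => mul_nonneg d.Vb_pos.le hQ) y), Real.dist_eq, Real.dist_eq, total, total,
      ← integral_sub (integrable_carried hφ hϖ hs) (integrable_carried hφ hϖ hr),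
      ← integral_mul_const, ← Real.norm_eq_abs]
    exact norm_integral_le_of_norm_le ((integrable_window _ _).mul_const _)
      (Eventually.of_forall fun y => lip_rho_carried hφ hϖ y hr hs)
  have h1 := hlip.absolutelyContinuousOnInterval.integral_deriv_eq_sub
  have h4 := hlip.absolutelyContinuousOnInterval.intervalIntegrable_deriv
  have h2 : T.total ϖ φ B = 0 := by
    rw [total]
    simp [carried, (hφ.supp (_, B) (Or.inr le_rfl)).1]
  rw [h2, zero_sub, intervalIntegral.integral_of_le hB.le, integral_Ioc_eq_integral_Ioo] at h1
  rw [intervalIntegrable_iff_integrableOn_Ioo_of_le hB.le] at h4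
  have h3 : T.total ϖ φ 0 = ∫ y, d.rho y * (ϖ.A (d.lab y) 0 * φ (y, 0)) := by
    simp only [total, carried, T.pos_zero]
  have h5 : ∀ᵐ t, t ∈ Ioo 0 B → deriv (T.total ϖ φ) t = ∫ y, d.rho y * T.rate ϖ φ t y := by
    filter_upwards [hϖ.deriv, ae_not_ev (T := T)] with t h4 h5 ht
    exact (hasDerivAt_total hφ hϖ ht h5 (h4 ht).1 (h4 ht).2).2.deriv
  rw [← h3, ← h1]
  exact ⟨h4.congr_fun_ae ((ae_restrict_iff' measurableSet_Ioo).2 h5),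
    (setIntegral_congr_ae measurableSet_Ioo h5).symm⟩

end Track

end StepData

namespace StepData

namespace Track

variable {d : StepData} {T : Track d} {V : ℝ → ℝ → ℝ}
  (hV : Continuous fun p : ℝ × ℝ => V p.1 p.2) {cap : ℝ} (hcap : 0 < cap)
  {ϖ : Weight} {φ : ℝ × ℝ → ℝ} {K B M C : ℝ}

/-! ### The defect at a fixed time -/

variable (T cap) in
/-- At time `t`, which is not an event time, the strips of the waves have the half widths `r`. -/
structure IsRadius (t : ℝ) (r : ℕ → ℝ) : Prop where
  pos : ∀ p, T.Lead t p → 0 < r p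
  le_cap : ∀ p, T.Lead t p → r p ≤ cap
  sep : ∀ p, T.Lead t p → ∀ q, T.Lead t q → p ≠ q → ∀ x,
    ¬ (|x - T.c t p| < r p ∧ |x - T.c t q| < r q)
  mem_strip : ∀ p x, T.Lead t p → |x - T.c t p| < r p → ∃ s s', T.IsSeg p s s' ∧
    (x, t) ∈ T.strip cap p s s' ∧ T.width cap p s s' t = r p
  of_strip : ∀ p x s s', T.IsSeg p s s' → (x, t) ∈ T.strip cap p s s' →
    T.Lead t p ∧ |x - T.c t p| < r p

include hcap in
theorem exists_isRadius {t : ℝ} (ht : 0 ≤ t) (hev : ∀ p, d.D p → ¬ T.Ev p t) :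
    ∃ r, T.IsRadius cap t r := by
  classical
  have h : ∀ p, ∃ r : ℝ, T.Lead t p → ∃ s s', T.IsSeg p s s' ∧ t ∈ Ioo s s' ∧
      T.width cap p s s' t = r := by
    intro p
    by_cases hl : T.Lead t p
    · obtain ⟨s, s', h, hts⟩ := T.exists_seg_at hl ht (hev p hl.1)
      exact ⟨_, fun _ => ⟨s, s', h, hts, rfl⟩⟩
    · exact ⟨0, fun h => absurd h hl⟩
  choose r hr using h
  refine ⟨r, fun p hp => ?_, fun p hp => ?_, fun p hp q hq hpq x hx => ?_, fun p x hp hx => ?_,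
    fun p x s s' h hx => ?_⟩
  · obtain ⟨s, s', h, hts, he⟩ := hr p hp
    rw [← he]; exact (h.isWidth hcap).pos t hts
  · obtain ⟨s, s', h, hts, he⟩ := hr p hp
    rw [← he]; exact (h.isWidth hcap).le_cap t
  · obtain ⟨s, s', h, hts, he⟩ := hr p hp
    obtain ⟨s₁, s₁', h₁, hts₁, he₁⟩ := hr q hq
    have hne : T.c t q ≠ T.c t p := fun heq => hpq (hp.eq_of_eq hq heq.symm)
    have h2 := (h.isWidth hcap).sep t hts q hq.1 hne
    have h3 := (h₁.isWidth hcap).sep t hts₁ p hp.1 hne.symm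
    rw [he] at h2
    rw [he₁] at h3
    have h4 := abs_sub_comm (T.c t q) (T.c t p)
    have h5 := abs_sub_le (T.c t q) x (T.c t p)
    have h6 := abs_sub_comm x (T.c t q)
    linarith [hx.1, hx.2, abs_nonneg (T.c t q - T.c t p)]
  · obtain ⟨s, s', h, hts, he⟩ := hr p hp
    exact ⟨s, s', h, ⟨hts, by simpa only [he] using hx⟩, he⟩
  · have hl := h.lead t hx.1
    obtain ⟨s₁, s₁', h₁, hts₁, he₁⟩ := hr p hl
    obtain ⟨rfl, rfl⟩ := h.unique h₁ hx.1 hts₁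
    refine ⟨hl, ?_⟩
    rw [← he₁]
    exact hx.2

theorem IsRadius.field_eq_out {t : ℝ} {r : ℕ → ℝ} (hr : T.IsRadius cap t r) (ht : 0 ≤ t) {x : ℝ}
    (hx : ∀ p, T.Lead t p → ¬ |x - T.c t p| < r p) :
    T.field hV hcap (x, t) = T.out V (x, t) := by
  refine field_outer hV hcap ht ?_
  rintro _ ⟨p, s, s', h, rfl⟩ hs
  obtain ⟨h1, h2⟩ := hr.of_strip p x s s' h ((h.inStrip_iff hV hcap).1 hs)
  exact hx p h1 h2

theorem IsRadius.field_eq {t : ℝ} {r : ℕ → ℝ} (hr : T.IsRadius cap t r) {x : ℝ} {p : ℕ}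
    (hp : T.Lead t p) (hx : |x - T.c t p| < r p) :
    T.field hV hcap (x, t) = (T.mass t (T.c t p) / (2 * r p) + 1, V (T.label t p) t) := by
  obtain ⟨s, s', h, hs, he⟩ := hr.mem_strip p x hp hx
  rw [h.field_eq hV hcap hs, he]

variable (ϖ φ) in
/-- The effect of the deviation of a label on the rate of change. -/
def labelRate (d : StepData) (ℓ x t : ℝ) : ℝ :=
  ϖ.b t * (fderiv ℝ φ (x, t) (0, 1) + d.G ℓ t * fderiv ℝ φ (x, t) (1, 0)) + ϖ.sb t * φ (x, t)

theorem abs_labelRate_le (hφ : IsTest φ K B M) (hϖ : ϖ.IsGood B C) {ℓ x t : ℝ}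
    (ht : t ∈ Icc 0 B) (hℓ : |ℓ| ≤ d.Wb) : |labelRate ϖ φ d ℓ x t| ≤ fluxBound d B M C := by
  have hC := hϖ.nonneg (ht.1.trans ht.2)
  have hle : C ≤ C * (1 + d.Wb) := le_mul_of_one_le_right hC (by linarith [d.Wb_nonneg])
  exact Weight.abs_flux_le' ((hϖ.bound t ht).2.1.trans hle) ((hϖ.bound t ht).2.2.2.trans hle)
    (d.abs_G_le hℓ ht) (hφ.bound _).2.1 (hφ.bound _).2.2 (hφ.bound _).1

theorem flux_eq_add (σ ℓ x t : ℝ) : ϖ.flux d.G φ σ ℓ x t =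
    ϖ.flux d.G φ σ σ x t + (ℓ - σ) * labelRate ϖ φ d σ x t := by
  simp only [Weight.flux, Weight.A, Weight.S, labelRate]
  ring

theorem flux_eq_zero (hφ : IsTest φ K B M) {σ ℓ x t : ℝ} (hx : K ≤ |x|) :
    ϖ.flux d.G φ σ ℓ x t = 0 := by
  have := hφ.supp (x, t) (Or.inl hx)
  simp [Weight.flux, this.1, this.2.1, this.2.2]

theorem continuous_flux (hφ : IsTest φ K B M) (σ ℓ t : ℝ) :
    Continuous fun x => ϖ.flux d.G φ σ ℓ x t := by
  have h : Continuous fun x : ℝ => (x, t) := continuous_id.prodMk continuous_const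
  exact (continuous_const.mul ((hφ.cont_t.comp h).add
    (continuous_const.mul (hφ.cont_x.comp h)))).add
    (continuous_const.mul (hφ.diff.continuous.comp h))

/-- The momentum that an absorbed label loses is accounted for by `dev`. -/
theorem integral_fib_rate {t : ℝ} (ht : 0 ≤ t)
    {p : ℕ} (hp : d.D p) :
    ∫ y in T.fib t (T.c t p), d.rho y * T.rate ϖ φ t y =
      T.mass t (T.c t p) * ϖ.flux d.G φ (T.label t p) (T.label t p) (T.c t p) t +
      T.dev t (T.c t p) (T.label t p) * labelRate ϖ φ d (T.label t p) (T.c t p) t := by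
  set x := T.c t p
  set ℓ := T.label t p
  have h1 : ∀ y ∈ T.fib t x, d.rho y * T.rate ϖ φ t y =
      d.rho y * ϖ.flux d.G φ ℓ ℓ x t + d.rho y * (d.lab y - ℓ) * labelRate ϖ φ d ℓ x t := by
    intro y hy
    have hy' : T.pos t y = x := hy
    rw [rate, posLabel_eq hp hy, hy', flux_eq_add]
    ring
  have hv := T.volume_fib_lt_top ht x
  have i1 := (integrableOn_rho (d := d) hv).mul_const (ϖ.flux d.G φ ℓ ℓ x t)
  have i2 := (integrableOn_rho_lab (d := d) hv ℓ).mul_const (labelRate ϖ φ d ℓ x t)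
  rw [setIntegral_congr_fun (T.measurableSet_fib t x) h1, integral_add i1 i2, integral_mul_const,
    integral_mul_const]
  rfl

/-- The error made by one shadow wave. -/
def stripBound (d : StepData) (N : ℕ) (δ e cap B M C : ℝ) : ℝ :=
  fluxBound d B M C *
    ((massBound d B + 2 * cap) * cap + 2 * cap + 2 * cap * d.Vb + devBound d N δ e B)

/-- Replacing the point mass of a wave by the state in its strip costs the oscillation of the test
function over the strip, the added density `1`, the mass that the strip displaces, and the momentum
defect. -/
theorem abs_strip_sub_fib_le (hφ : IsTest φ K B M) (hϖ : ϖ.IsGood B C) {N : ℕ} {δ e : ℝ}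
    (hT : T.Accurate N δ e) (he : 0 < e) {t : ℝ} (ht : t ∈ Icc 0 B) {p : ℕ} (hp : d.D p)
    (hN : ∀ q, d.D q → T.c t q = T.c t p → q ≤ N) {r : ℝ} (hr0 : 0 < r) (hr : r ≤ cap)
    {F : ℝ → ℝ} (hF : ∀ x, |F x| ≤ d.Vb * fluxBound d B M C) :
    |(T.mass t (T.c t p) / (2 * r) + 1) * (∫ x in Ioo (T.c t p - r) (T.c t p + r),
        ϖ.flux d.G φ (T.label t p) (T.label t p) x t) -
      (∫ x in Ioo (T.c t p - r) (T.c t p + r), F x) -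
      ∫ y in T.fib t (T.c t p), d.rho y * T.rate ϖ φ t y| ≤ stripBound d N δ e cap B M C := by
  rw [integral_fib_rate ht.1 hp]
  have hdev := hT.abs_dev_le he ht.1 ht.2 hp hN
  have hℓ := T.abs_label_le t p
  set x₀ := T.c t p
  set ℓ := T.label t p
  set Q := fluxBound d B M C with hQdef
  set m := T.mass t x₀
  have hm0 : 0 ≤ m := T.mass_nonneg _ _
  have hm : m ≤ massBound d B := T.mass_le ht.1 ht.2 _
  have hQ : 0 ≤ Q := fluxBound_nonneg hφ hϖ (ht.1.trans ht.2)
  have hvol : volume (Ioo (x₀ - r) (x₀ + r)) < ⊤ := by simp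
  have hreal : volume.real (Ioo (x₀ - r) (x₀ + r)) = 2 * r := by
    rw [measureReal_def, Real.volume_Ioo, ENNReal.toReal_ofReal (by linarith)]
    ring
  have hfl : |ϖ.flux d.G φ ℓ ℓ x₀ t| ≤ Q := abs_flux_le hφ hϖ ht hℓ hℓ
  have hF' : |∫ x in Ioo (x₀ - r) (x₀ + r), F x| ≤ d.Vb * Q * (2 * r) := by
    rw [← hreal, ← Real.norm_eq_abs]
    exact norm_setIntegral_le_of_norm_le_const hvol fun x _ => hF x
  have hint : IntegrableOn (fun x => ϖ.flux d.G φ ℓ ℓ x t) (Ioo (x₀ - r) (x₀ + r)) :=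
    ((continuous_flux hφ ℓ ℓ t).integrableOn_Icc).mono_set Ioo_subset_Icc_self
  have hI : |(∫ x in Ioo (x₀ - r) (x₀ + r), ϖ.flux d.G φ ℓ ℓ x t) -
      2 * r * ϖ.flux d.G φ ℓ ℓ x₀ t| ≤ Q * r * (2 * r) := by
    have h1 : (∫ x in Ioo (x₀ - r) (x₀ + r), ϖ.flux d.G φ ℓ ℓ x t) -
        2 * r * ϖ.flux d.G φ ℓ ℓ x₀ t = ∫ x in Ioo (x₀ - r) (x₀ + r),
          (ϖ.flux d.G φ ℓ ℓ x t - ϖ.flux d.G φ ℓ ℓ x₀ t) := by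
      rw [integral_sub hint (integrableOn_const hvol.ne), setIntegral_const, hreal, smul_eq_mul]
    rw [h1, ← hreal, ← Real.norm_eq_abs]
    refine norm_setIntegral_le_of_norm_le_const hvol fun x hx => ?_
    refine (lip_flux hφ hϖ ht hℓ hℓ).trans (mul_le_mul_of_nonneg_left ?_ hQ)
    exact (abs_lt.2 ⟨by linarith [hx.1], by linarith [hx.2]⟩).le
  have hβ : |T.dev t x₀ ℓ * labelRate ϖ φ d ℓ x₀ t| ≤ devBound d N δ e B * Q := by
    rw [abs_mul]
    exact mul_le_mul hdev (abs_labelRate_le hφ hϖ ht hℓ) (abs_nonneg _)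
      ((abs_nonneg _).trans hdev)
  have hMp : 0 ≤ m / (2 * r) + 1 := by positivity
  have h1 : |(m / (2 * r) + 1) * ((∫ x in Ioo (x₀ - r) (x₀ + r), ϖ.flux d.G φ ℓ ℓ x t) -
      2 * r * ϖ.flux d.G φ ℓ ℓ x₀ t)| ≤ (m + 2 * r) * (Q * r) := by
    rw [abs_mul, abs_of_nonneg hMp]
    refine (mul_le_mul_of_nonneg_left hI hMp).trans (le_of_eq ?_)
    field_simp
  have h2 : |2 * r * ϖ.flux d.G φ ℓ ℓ x₀ t| ≤ 2 * r * Q := by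
    rw [abs_mul, abs_of_pos (by linarith)]
    exact mul_le_mul_of_nonneg_left hfl (by linarith)
  have h3 : (m / (2 * r) + 1) * (2 * r) = m + 2 * r := by field_simp
  have key : (m / (2 * r) + 1) * (∫ x in Ioo (x₀ - r) (x₀ + r), ϖ.flux d.G φ ℓ ℓ x t) -
      (∫ x in Ioo (x₀ - r) (x₀ + r), F x) -
      (m * ϖ.flux d.G φ ℓ ℓ x₀ t + T.dev t x₀ ℓ * labelRate ϖ φ d ℓ x₀ t) =
      (m / (2 * r) + 1) * ((∫ x in Ioo (x₀ - r) (x₀ + r), ϖ.flux d.G φ ℓ ℓ x t) -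
        2 * r * ϖ.flux d.G φ ℓ ℓ x₀ t) + 2 * r * ϖ.flux d.G φ ℓ ℓ x₀ t -
      (∫ x in Ioo (x₀ - r) (x₀ + r), F x) - T.dev t x₀ ℓ * labelRate ϖ φ d ℓ x₀ t := by
    linear_combination (ϖ.flux d.G φ ℓ ℓ x₀ t) * h3
  rw [key]
  have h4 : (m + 2 * r) * (Q * r) ≤ (massBound d B + 2 * cap) * (Q * cap) := by
    refine mul_le_mul (by linarith) (mul_le_mul_of_nonneg_left hr hQ) (by positivity) ?_
    linarith
  have h5 : 2 * r * Q ≤ 2 * cap * Q := mul_le_mul_of_nonneg_right (by linarith) hQ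
  have h6 : d.Vb * Q * (2 * r) ≤ d.Vb * Q * (2 * cap) :=
    mul_le_mul_of_nonneg_left (by linarith) (mul_nonneg d.Vb_pos.le hQ)
  rw [stripBound, ← hQdef]
  have h7 := abs_le.1 h1
  have h8 := abs_le.1 h2
  have h9 := abs_le.1 hF'
  have h10 := abs_le.1 hβ
  refine abs_le.2 ⟨?_, ?_⟩ <;> linarith [h7.1, h7.2, h8.1, h8.2, h9.1, h9.2, h10.1, h10.2]

/-- At a fixed time, the weak form of the approximate solution is that in label coordinates, up to
the errors of the waves that reach the support of the test function. -/
theorem abs_slice_le (hφ : IsTest φ K B M) (hϖ : ϖ.IsGood B C) {N : ℕ} {δ e : ℝ}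
    (hT : T.Accurate N δ e) (he : 0 < e) (hcap1 : cap ≤ 1) {t : ℝ} (ht : t ∈ Icc 0 B)
    (hev : ∀ p, d.D p → ¬ T.Ev p t) (hN : ∀ p, d.D p → N < p → K + 1 ≤ T.c t p)
    (hint : Integrable fun y => d.rho y * T.rate ϖ φ t y)
    {Θ : ℝ → ℝ → ℝ} (hΘm : Measurable fun p : ℝ × ℝ => Θ p.1 p.2)
    (hΘ : ∀ ℓ x, Θ (V ℓ t) x = ϖ.flux d.G φ ℓ ℓ x t) :
    |(∫ x, (T.field hV hcap (x, t)).1 * Θ (T.field hV hcap (x, t)).2 x) -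
      ∫ y, d.rho y * T.rate ϖ φ t y| ≤ (N + 1) * stripBound d N δ e cap B M C := by
  classical
  obtain ⟨r, hr⟩ := exists_isRadius (T := T) hcap ht.1 hev
  have hQ : 0 ≤ fluxBound d B M C := fluxBound_nonneg hφ hϖ (ht.1.trans ht.2)
  set P : Finset ℕ := (Finset.range (N + 1)).filter fun p => T.Lead t p ∧ T.c t p < K + 1
    with hPdef
  have hP : ∀ p, p ∈ P ↔ T.Lead t p ∧ T.c t p < K + 1 := fun p => by
    rw [hPdef, Finset.mem_filter, Finset.mem_range]
    refine ⟨fun h => h.2, fun h => ⟨?_, h⟩⟩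
    by_contra hlt
    linarith [hN p h.1.1 (by omega), h.2]
  set I : ℕ → Set ℝ := fun p => Ioo (T.c t p - r p) (T.c t p + r p) with hIdef
  have hmemI : ∀ p x, x ∈ I p ↔ |x - T.c t p| < r p := fun p x => by
    simp only [hIdef, mem_Ioo, abs_lt]
    constructor <;> rintro ⟨h1, h2⟩ <;> constructor <;> linarith
  set F : ℝ → ℝ := fun x => (T.out V (x, t)).1 * Θ (T.out V (x, t)).2 x with hFdef
  have hΘ0 : ∀ x, K ≤ |x| → ∀ ℓ, Θ (V ℓ t) x = 0 := fun x hx ℓ => by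
    rw [hΘ, flux_eq_zero hφ hx]
  have hF0 : ∀ x, K ≤ |x| → F x = 0 := fun x hx => by
    simp only [hFdef]
    rcases out_cases T V x ht.1 with ⟨ℓ, -, h⟩ | ⟨i, -, -, -, h⟩
    · rw [h]; simp
    · rw [h]; simp only [hΘ0 x hx, mul_zero]
  have hFb : ∀ x, |F x| ≤ d.Vb * fluxBound d B M C := fun x => by
    simp only [hFdef]
    rw [abs_mul]
    have h1 := out_dens T V (p := (x, t)) ht.1
    refine mul_le_mul (by rw [abs_of_nonneg h1.1]; exact h1.2) ?_ (abs_nonneg _) d.Vb_pos.le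
    rcases out_cases T V x ht.1 with ⟨ℓ, hℓ, h⟩ | ⟨i, -, -, -, h⟩
    · rw [h, hΘ]; exact abs_flux_le hφ hϖ ht hℓ hℓ
    · rw [h, hΘ]; exact abs_flux_le hφ hϖ ht (d.w_le i) (d.w_le i)
  have houtm : Measurable fun x => T.out V (x, t) := by
    have := (measurable_out (T := T) hV).comp
      ((measurable_id (α := ℝ)).prodMk (measurable_const (a := t)))
    simpa only [Function.comp_def, id, if_pos ht.1] using this
  have hFm : Measurable F := houtm.fst.mul (hΘm.comp (houtm.snd.prodMk measurable_id))
  have hFint : Integrable F := by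
    refine (integrable_window K (d.Vb * fluxBound d B M C)).mono' hFm.aestronglyMeasurable
      (Eventually.of_forall fun x => ?_)
    by_cases hx : x ∈ Icc (-K) K
    · rw [indicator_of_mem hx]; exact hFb x
    · rw [indicator_of_notMem hx, hF0 x, norm_zero]
      by_contra hlt
      exact hx (abs_le.1 (not_le.1 hlt).le)
  -- the strips that matter are those of the waves in `P`
  have hU : ∀ x, (T.field hV hcap (x, t)).1 * Θ (T.field hV hcap (x, t)).2 x =
      F x + ∑ p ∈ P, (I p).indicator (fun x => (T.mass t (T.c t p) / (2 * r p) + 1) *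
        ϖ.flux d.G φ (T.label t p) (T.label t p) x t - F x) x := by
    intro x
    by_cases hx : ∃ p ∈ P, x ∈ I p
    · obtain ⟨p, hp, hxp⟩ := hx
      have hpl := (hP p).1 hp
      rw [Finset.sum_eq_single p, indicator_of_mem hxp, hr.field_eq hV hcap hpl.1
        ((hmemI p x).1 hxp), hΘ]
      · ring
      · intro q hq hqp
        refine indicator_of_notMem (fun hxq => ?_) _
        exact hr.sep p hpl.1 q ((hP q).1 hq).1 hqp.symm x ⟨(hmemI p x).1 hxp, (hmemI q x).1 hxq⟩
      · intro h; exact absurd hp h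
    · push Not at hx
      rw [Finset.sum_eq_zero fun p hp => indicator_of_notMem (hx p hp) _, add_zero]
      by_cases hxK : K ≤ |x|
      · obtain ⟨ℓ, -, h⟩ := field_vel hV hcap (T := T) (p := (x, t)) ht.1
        rw [hF0 x hxK, h, hΘ0 x hxK, mul_zero]
      · rw [hr.field_eq_out hV hcap ht.1 fun p hp hlt => hx p ((hP p).2 ⟨hp, ?_⟩)
          ((hmemI p x).2 hlt)]
        have h1 := abs_lt.1 (not_le.1 hxK)
        have h2 := abs_lt.1 hlt
        linarith [hr.le_cap p hp]
  have hR : ∀ y, d.rho y * T.rate ϖ φ t y =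
      (T.alone t).indicator (fun y => d.rho y * T.rate ϖ φ t y) y +
      ∑ p ∈ P, (T.fib t (T.c t p)).indicator (fun y => d.rho y * T.rate ϖ φ t y) y := by
    intro y
    by_cases hy : y ∈ T.alone t
    · have h0 : ∀ p ∈ P, (T.fib t (T.c t p)).indicator (fun y => d.rho y * T.rate ϖ φ t y) y = 0 :=
        fun p hp => indicator_of_notMem (s := T.fib t (T.c t p)) (a := y)
          (fun h => hy p ((hP p).1 hp).1.1 h) _
      rw [indicator_of_mem hy, Finset.sum_eq_zero h0, add_zero]
    · rw [indicator_of_notMem hy, zero_add]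
      simp only [alone, mem_ofPred_eq, not_forall, not_not] at hy
      obtain ⟨q, hq, hyq⟩ := hy
      obtain ⟨a, ha, -, haq⟩ := T.exists_lead t hq
      have hya : y ∈ T.fib t (T.c t a) := hyq.trans haq.symm
      have hother : ∀ b ∈ P, b ≠ a → (T.fib t (T.c t b)).indicator
          (fun y => d.rho y * T.rate ϖ φ t y) y = 0 := fun b hb hba => by
        refine indicator_of_notMem (fun hyb => hba ?_) _
        exact ((hP b).1 hb).1.eq_of_eq ha (Eq.trans (Eq.symm hyb) hya)
      rw [Finset.sum_eq_single a hother, indicator_of_mem hya]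
      intro haP
      rw [indicator_of_mem hya]
      have h1 : K + 1 ≤ T.c t a := not_lt.1 fun hlt => haP ((hP a).2 ⟨ha, hlt⟩)
      have hya' : T.pos t y = T.c t a := hya
      rw [rate, flux_eq_zero hφ, mul_zero]
      rw [hya']
      exact (by linarith : K ≤ T.c t a).trans (le_abs_self _)
  have hIm : ∀ p, MeasurableSet (I p) := fun p => measurableSet_Ioo
  have hfluxint : ∀ p, IntegrableOn (fun x => ϖ.flux d.G φ (T.label t p) (T.label t p) x t)
      (I p) := fun p =>
    ((continuous_flux hφ _ _ t).integrableOn_Icc).mono_set Ioo_subset_Icc_self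
  have hIint : ∀ p, IntegrableOn (fun x => (T.mass t (T.c t p) / (2 * r p) + 1) *
        ϖ.flux d.G φ (T.label t p) (T.label t p) x t - F x) (I p) := fun p =>
    ((hfluxint p).const_mul _).sub hFint.integrableOn
  have e1 : ∫ x, (T.field hV hcap (x, t)).1 * Θ (T.field hV hcap (x, t)).2 x =
      (∫ x, F x) + ∑ p ∈ P, ((T.mass t (T.c t p) / (2 * r p) + 1) * (∫ x in I p,
        ϖ.flux d.G φ (T.label t p) (T.label t p) x t) - ∫ x in I p, F x) := by
    simp only [hU]
    rw [integral_add hFint (integrable_finsetSum _ fun p _ =>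
      (integrable_indicator_iff (hIm p)).2 (hIint p)), integral_finsetSum _ fun p _ =>
      (integrable_indicator_iff (hIm p)).2 (hIint p)]
    congr 1
    refine Finset.sum_congr rfl fun p _ => ?_
    rw [integral_indicator (hIm p), integral_sub ((hfluxint p).const_mul _) hFint.integrableOn,
      integral_const_mul]
  have e2 : ∫ y, d.rho y * T.rate ϖ φ t y = (∫ x, F x) +
      ∑ p ∈ P, ∫ y in T.fib t (T.c t p), d.rho y * T.rate ϖ φ t y := by
    have hfm : ∀ p, MeasurableSet (T.fib t (T.c t p)) := fun p => T.measurableSet_fib _ _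
    rw [integral_congr_ae (Eventually.of_forall hR), integral_add
      (hint.indicator (measurableSet_alone t)) (integrable_finsetSum _ fun p _ =>
      hint.indicator (hfm p)), integral_finsetSum _ fun p _ => hint.indicator (hfm p)]
    congr 1
    · rw [integral_indicator (measurableSet_alone t), hFdef, integral_out ht.1]
      refine setIntegral_congr_fun (measurableSet_alone t) fun y hy => ?_
      simp only [rate, posLabel_of_alone hy, hΘ]
    · exact Finset.sum_congr rfl fun p _ => integral_indicator (hfm p)
  rw [e1, e2, add_sub_add_left_eq_sub, ← Finset.sum_sub_distrib]
  refine (Finset.abs_sum_le_sum_abs _ _).trans ?_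
  have hcard : (P.card : ℝ) ≤ N + 1 := by
    have : P.card ≤ N + 1 := (Finset.card_filter_le _ _).trans (Finset.card_range _).le
    exact_mod_cast this
  have hterm : ∀ p ∈ P, |(T.mass t (T.c t p) / (2 * r p) + 1) * (∫ x in I p,
        ϖ.flux d.G φ (T.label t p) (T.label t p) x t) - (∫ x in I p, F x) -
        ∫ y in T.fib t (T.c t p), d.rho y * T.rate ϖ φ t y| ≤ stripBound d N δ e cap B M C := by
    intro p hp
    have hpl := (hP p).1 hp
    refine abs_strip_sub_fib_le hφ hϖ hT he ht hpl.1.1 (fun q hq heq => ?_) (hr.pos p hpl.1)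
      (hr.le_cap p hpl.1) hFb
    by_contra hlt
    linarith [hN q hq (not_le.1 hlt), hpl.2]
  have hδ : 0 ≤ δ := by linarith [T.tick_lt 0, hT.tick_le 0]
  have hbnd : 0 ≤ stripBound d N δ e cap B M C := by
    have h1 : 0 ≤ massBound d B := (T.mass_nonneg t 0).trans (T.mass_le ht.1 ht.2 0)
    have h2 := d.Vb_pos
    have h3 := d.Wb_nonneg
    have h4 := absMass_nonneg d B hδ
    rw [stripBound, devBound]
    positivity
  refine (Finset.sum_le_sum hterm).trans ?_
  rw [Finset.sum_const, nsmul_eq_mul]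
  exact mul_le_mul_of_nonneg_right hcard hbnd

end Track

end StepData

namespace StepData

namespace Track

variable {d : StepData} {T : Track d} {V : ℝ → ℝ → ℝ}
  (hV : Continuous fun p : ℝ × ℝ => V p.1 p.2) {cap : ℝ} (hcap : 0 < cap)
  {ϖ : Weight} {φ : ℝ × ℝ → ℝ} {K B M C : ℝ}

/-! ### The defect in the weak form -/

/-- Integration of `abs_slice_le` in time; in label coordinates the weak form holds exactly. -/
theorem abs_defect_le (hφ : IsTest φ K B M) (hϖ : ϖ.IsGood B C) {N : ℕ} {δ e : ℝ}
    (hT : T.Accurate N δ e) (he : 0 < e) (hcap1 : cap ≤ 1) (hB : 0 < B)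
    (hN : ∀ p, d.D p → N < p → ∀ t ∈ Icc 0 B, K + 1 ≤ T.c t p)
    {Ψ : ℝ → ℝ × ℝ → ℝ} (hΨm : Measurable fun q : ℝ × ℝ × ℝ => Ψ q.1 q.2)
    (hΨ : ∀ ℓ x, ∀ t ∈ Icc 0 B, Ψ (V ℓ t) (x, t) = ϖ.flux d.G φ ℓ ℓ x t)
    (hΨ0 : ∀ u p, K ≤ |p.1| ∨ B ≤ p.2 → Ψ u p = 0) :
    |(∫ p in {p : ℝ × ℝ | 0 ≤ p.2}, (T.field hV hcap p).1 * Ψ (T.field hV hcap p).2 p) +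
      ∫ x, d.rho x * (ϖ.A (d.lab x) 0 * φ (x, 0))| ≤
      (N + 1) * stripBound d N δ e cap B M C * B := by
  set f : ℝ × ℝ → ℝ := fun p => (T.field hV hcap p).1 * Ψ (T.field hV hcap p).2 p with hf
  have hfield := measurable_field (T := T) hV hcap
  have hfm : Measurable f := hfield.fst.mul (hΨm.comp (hfield.snd.prodMk measurable_id))
  have hbox : MeasurableSet (Icc (-K) K ×ˢ Icc 0 B : Set (ℝ × ℝ)) :=
    measurableSet_Icc.prod measurableSet_Icc
  have hf0 : ∀ p : ℝ × ℝ, K ≤ |p.1| ∨ B ≤ p.2 → f p = 0 := fun p hp => by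
    simp only [hf, hΨ0 _ p hp, mul_zero]
  have hfbox : IntegrableOn f (Icc (-K) K ×ˢ Icc 0 B) := by
    refine ((integrableOn_dens hV hcap (T := T) (-K) K B).const_mul (fluxBound d B M C)).mono'
      hfm.aestronglyMeasurable ((ae_restrict_mem hbox).mono fun p hp => ?_)
    obtain ⟨ℓ, hℓ, h⟩ := field_vel hV hcap (T := T) (p := p) hp.2.1
    simp only [hf]
    rw [norm_mul, Real.norm_of_nonneg (field_dens_nonneg hV hcap hp.2.1), mul_comm, h]
    refine mul_le_mul_of_nonneg_right ?_ (field_dens_nonneg hV hcap hp.2.1)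
    rw [show p = (p.1, p.2) from rfl, hΨ ℓ p.1 p.2 hp.2]
    exact abs_flux_le hφ hϖ hp.2 hℓ hℓ
  have hfS : IntegrableOn f (univ ×ˢ Ioo 0 B) := by
    refine hfbox.of_forall_sdiff_eq_zero (MeasurableSet.univ.prod measurableSet_Ioo) fun p hp => ?_
    refine hf0 p (Or.inl ?_)
    by_contra hlt
    exact hp.2 ⟨abs_le.1 (not_le.1 hlt).le, hp.1.2.1.le, hp.1.2.2.le⟩
  have h1 : ∫ p in {p : ℝ × ℝ | 0 ≤ p.2}, f p = ∫ p in univ ×ˢ Ioo 0 B, f p := by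
    refine setIntegral_eq_of_subset_of_ae_sdiff_eq_zero
      (measurableSet_le measurable_const measurable_snd).nullMeasurableSet
      (fun p hp => hp.2.1.le) ?_
    have hnull : ∀ᵐ p : ℝ × ℝ, p.2 ≠ 0 := by
      have : ∀ᵐ t : ℝ, t ≠ 0 := by simp [ae_iff, measure_singleton]
      exact (Measure.quasiMeasurePreserving_snd (μ := (volume : Measure ℝ))
        (ν := (volume : Measure ℝ))).ae this
    filter_upwards [hnull] with p hp hpS
    refine hf0 p (Or.inr ?_)
    by_contra hlt
    exact hpS.2 ⟨mem_univ _, lt_of_le_of_ne hpS.1 hp.symm, not_le.1 hlt⟩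
  have hprod : (volume : Measure (ℝ × ℝ)).restrict (univ ×ˢ Ioo 0 B) =
      (volume : Measure ℝ).prod (volume.restrict (Ioo 0 B)) := by
    rw [Measure.volume_eq_prod, ← Measure.prod_restrict, Measure.restrict_univ]
  rw [IntegrableOn, hprod] at hfS
  rw [h1, hprod, integral_prod_symm _ hfS]
  obtain ⟨h2, h3⟩ := integral_rate T hφ hϖ hB
  rw [← neg_eq_iff_eq_neg] at h3
  rw [← h3, ← sub_eq_add_neg, ← integral_sub hfS.integral_prod_right h2, ← Real.norm_eq_abs]
  have hvol : volume (Ioo 0 B) < ⊤ := by simp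
  have hreal : volume.real (Ioo 0 B) = B := by
    rw [measureReal_def, Real.volume_Ioo, ENNReal.toReal_ofReal (by linarith), sub_zero]
  refine (norm_setIntegral_le_of_norm_le_const_ae hvol
    (C := (N + 1) * stripBound d N δ e cap B M C) ?_).trans (by rw [hreal])
  rw [ae_restrict_iff' measurableSet_Ioo]
  filter_upwards [hϖ.deriv, ae_not_ev (T := T)] with t h4 h5 ht
  have ht' : t ∈ Icc 0 B := ⟨ht.1.le, ht.2.le⟩
  have h6 := hasDerivAt_total hφ hϖ ht h5 (h4 ht).1 (h4 ht).2
  exact abs_slice_le hV hcap hφ hϖ hT he hcap1 ht' h5 (fun p hp hlt => hN p hp hlt t ht') h6.1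
    (Θ := fun u x => Ψ u (x, t)) (hΨm.comp (measurable_fst.prodMk
      (measurable_snd.prodMk measurable_const))) fun ℓ x => hΨ ℓ x t ht'

end Track

end StepData

/-! ### Locally bounded coefficients -/

/-- A measurable function that is bounded on bounded sets. -/
structure IsLocBdd (g : ℝ → ℝ) : Prop where
  meas : Measurable g
  bdd : ∀ T : ℝ, ∃ C : ℝ, ∀ t, |t| ≤ T → |g t| ≤ C

/-- A function in `L^∞_loc([0, ∞))` has a representative that is bounded on bounded sets, not
only essentially bounded. -/
theorem exists_isLocBdd {g : ℝ → ℝ} (hg : ∀ T : ℝ, MemLp g ⊤ (volume.restrict (Icc 0 T))) :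
    ∃ g' : ℝ → ℝ, IsLocBdd g' ∧ ∀ᵐ t, 0 ≤ t → g' t = g t := by
  have hU : (Ici 0 : Set ℝ) = ⋃ n : ℕ, Icc (0 : ℝ) n := by
    ext t
    simp only [mem_Ici, mem_iUnion, mem_Icc]
    exact ⟨fun h => ⟨⌈t⌉₊, h, Nat.le_ceil t⟩, fun ⟨n, h, _⟩ => h⟩
  have hm : AEMeasurable g (volume.restrict (Ici 0)) := by
    rw [hU]
    exact (aestronglyMeasurable_iUnion_iff.2 fun n : ℕ => (hg n).1).aemeasurable
  set C : ℕ → ℝ := fun n => (eLpNorm g ⊤ (volume.restrict (Icc (0 : ℝ) n))).toReal with hC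
  have hle : ∀ᵐ t, ∀ n : ℕ, t ∈ Icc (0 : ℝ) n → |g t| ≤ C n := by
    refine ae_all_iff.2 fun n => (ae_restrict_iff' measurableSet_Icc).1 ?_
    filter_upwards [ae_le_eLpNormEssSup (f := g) (μ := volume.restrict (Icc (0 : ℝ) n))]
      with t ht
    rw [← eLpNorm_exponent_top] at ht
    have := ENNReal.toReal_mono (hg n).2.ne ht
    rwa [toReal_enorm] at this
  have hmeasC : Measurable fun t : ℝ => C ⌈t⌉₊ := (measurable_from_nat (f := C)).comp Nat.measurable_ceil
  have hm' := hm.measurable_mk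
  refine ⟨fun t => if |hm.mk g t| ≤ C ⌈t⌉₊ then hm.mk g t else 0,
    ⟨Measurable.ite (measurableSet_le (measurable_norm.comp hm') hmeasC) hm' measurable_const,
      fun T => ⟨∑ n ∈ Finset.range (⌈T⌉₊ + 1), C n, fun t ht => ?_⟩⟩, ?_⟩
  · have h0 : ∀ n ∈ Finset.range (⌈T⌉₊ + 1), 0 ≤ C n := fun n _ => ENNReal.toReal_nonneg
    split_ifs with h
    · refine h.trans (Finset.single_le_sum h0 (Finset.mem_range.2 (Nat.lt_succ_iff.2 ?_)))
      exact Nat.ceil_mono ((le_abs_self t).trans ht)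
    · simpa using Finset.sum_nonneg h0
  · have hae := (ae_restrict_iff' measurableSet_Ici).1 hm.ae_eq_mk
    filter_upwards [hae, hle] with t h1 h2 ht
    rw [← h1 ht, if_pos (h2 _ ⟨ht, Nat.le_ceil t⟩)]

namespace IsLocBdd

variable {g h : ℝ → ℝ}

theorem of_continuous (hg : Continuous g) : IsLocBdd g where
  meas := hg.measurable
  bdd T := by
    obtain ⟨C, hC⟩ := (isCompact_Icc (a := -T) (b := T)).exists_bound_of_continuousOn
      hg.continuousOn
    exact ⟨C, fun t ht => hC t (abs_le.1 ht)⟩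

theorem mul (hg : IsLocBdd g) (hh : IsLocBdd h) : IsLocBdd fun t => g t * h t where
  meas := hg.meas.mul hh.meas
  bdd T := by
    obtain ⟨C, hC⟩ := hg.bdd T
    obtain ⟨D, hD⟩ := hh.bdd T
    refine ⟨C * D, fun t ht => ?_⟩
    rw [abs_mul]
    exact mul_le_mul (hC t ht) (hD t ht) (abs_nonneg _) ((abs_nonneg _).trans (hC t ht))

theorem sub (hg : IsLocBdd g) (hh : IsLocBdd h) : IsLocBdd fun t => g t - h t where
  meas := hg.meas.sub hh.meas
  bdd T := by
    obtain ⟨C, hC⟩ := hg.bdd T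
    obtain ⟨D, hD⟩ := hh.bdd T
    exact ⟨C + D, fun t ht => (abs_sub _ _).trans (add_le_add (hC t ht) (hD t ht))⟩

theorem intervalIntegrable (hg : IsLocBdd g) (a b : ℝ) : IntervalIntegrable g volume a b := by
  obtain ⟨C, hC⟩ := hg.bdd (max |a| |b|)
  refine (intervalIntegrable_const (c := C)).mono_fun hg.meas.aestronglyMeasurable
    ((ae_restrict_iff' measurableSet_uIoc).2 (Eventually.of_forall fun t ht => ?_))
  refine (hC t ?_).trans (le_abs_self _)
  have h1 := uIoc_subset_uIcc ht
  have h2 := neg_abs_le a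
  have h3 := neg_abs_le b
  have h4 := le_abs_self a
  have h5 := le_abs_self b
  have h6 := le_max_left |a| |b|
  have h7 := le_max_right |a| |b|
  rcases mem_uIcc.1 h1 with h | h <;> exact abs_le.2 ⟨by linarith [h.1], by linarith [h.2]⟩

theorem continuous_primitive (hg : IsLocBdd g) : Continuous fun t => ∫ s in (0 : ℝ)..t, g s :=
  intervalIntegral.continuous_primitive hg.intervalIntegrable 0

theorem ae_hasDerivAt (hg : IsLocBdd g) :
    ∀ᵐ t, HasDerivAt (fun t => ∫ s in (0 : ℝ)..t, g s) (g t) t := by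
  have hli : LocallyIntegrable g volume := (locallyIntegrable_iff).2 fun k hk => by
    obtain ⟨r, hr⟩ := hk.isBounded.subset_closedBall 0
    have h : k ⊆ Icc (-max r 0) (max r 0) := fun t ht => by
      have := hr ht
      rw [mem_closedBall_zero_iff, Real.norm_eq_abs] at this
      exact abs_le.1 (this.trans (le_max_left _ _))
    exact IntegrableOn.mono_set ((intervalIntegrable_iff_integrableOn_Icc_of_le (by
      linarith [le_max_right r 0])).1 (hg.intervalIntegrable _ _)) h
  filter_upwards [LocallyIntegrable.ae_hasDerivAt_integral hli] with t ht using ht 0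

theorem locallyLipschitz_primitive (hg : IsLocBdd g) :
    LocallyLipschitz fun t => ∫ s in (0 : ℝ)..t, g s := by
  intro x
  obtain ⟨C, hC⟩ := hg.bdd (|x| + 1)
  refine ⟨C.toNNReal, Metric.ball x 1, Metric.ball_mem_nhds x one_pos, ?_⟩
  refine LipschitzOnWith.of_dist_le_mul fun s hs t ht => ?_
  rw [dist_eq_norm, intervalIntegral.integral_interval_sub_left (hg.intervalIntegrable _ _)
    (hg.intervalIntegrable _ _), Real.dist_eq]
  refine intervalIntegral.norm_integral_le_of_norm_le_const fun r hr => ?_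
  refine (hC r ?_).trans (Real.le_coe_toNNReal C)
  have h1 : r ∈ Metric.ball x 1 := by
    have := (convex_ball x 1).ordConnected.uIcc_subset ht hs
    exact this (uIoc_subset_uIcc hr)
  rw [Metric.mem_ball, Real.dist_eq] at h1
  have := abs_sub_abs_le_abs_sub r x
  linarith

end IsLocBdd

/-! ### The velocity along the characteristics -/

theorem velocity_congr {κ ua κ' ua' : ℝ → ℝ} (hκ : ∀ᵐ t, 0 ≤ t → κ' t = κ t)
    (hua : ∀ᵐ t, 0 ≤ t → ua' t = ua t) (w : ℝ) {t : ℝ} (ht : 0 ≤ t) :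
    velocity κ ua w t = velocity κ' ua' w t := by
  have h1 : ∀ s, 0 ≤ s → ∫ r in (0 : ℝ)..s, κ r = ∫ r in (0 : ℝ)..s, κ' r := fun s hs => by
    refine intervalIntegral.integral_congr_ae ?_
    filter_upwards [hκ] with r hr hrs
    rw [uIoc_of_le hs] at hrs
    exact (hr hrs.1.le).symm
  rw [velocity, velocity, h1 t ht]
  congr 2
  refine intervalIntegral.integral_congr_ae ?_
  filter_upwards [hκ, hua] with r h2 h3 hr
  rw [uIoc_of_le ht] at hr
  rw [h2 hr.1.le, h3 hr.1.le, h1 r hr.1.le]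

/-- Momentum as a quantity carried by the mass: the velocity of the characteristic with label `ℓ`
is affine in `ℓ`, and it changes at the rate `κ (ua - velocity)`. -/
def momentumWeight (κ ua : ℝ → ℝ) : Weight where
  a := velocity κ ua 0
  b t := Real.exp (-∫ s in (0 : ℝ)..t, κ s)
  sa t := κ t * (ua t - velocity κ ua 0 t)
  sb t := -(κ t * Real.exp (-∫ s in (0 : ℝ)..t, κ s))

/-- Mass as a quantity carried by the mass. -/
def massWeight : Weight := ⟨fun _ => 1, fun _ => 0, fun _ => 0, fun _ => 0⟩

theorem massWeight_isGood (B : ℝ) : massWeight.IsGood B 1 where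
  bound t _ := by simp [massWeight]
  lip s _ t _ := by simp [massWeight]
  deriv := Eventually.of_forall fun t _ => ⟨hasDerivAt_const _ _, hasDerivAt_const _ _⟩

section

variable {κ ua : ℝ → ℝ}

theorem momentumWeight_A (ℓ t : ℝ) : (momentumWeight κ ua).A ℓ t = velocity κ ua ℓ t := by
  simp only [Weight.A, momentumWeight, velocity]
  ring

theorem momentumWeight_S (ℓ t : ℝ) :
    (momentumWeight κ ua).S ℓ t = κ t * (ua t - velocity κ ua ℓ t) := by
  rw [← momentumWeight_A]
  simp only [Weight.S, Weight.A, momentumWeight]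
  ring

theorem velocity_zero (w : ℝ) : velocity κ ua w 0 = w := by simp [velocity]

theorem velocity_strictMono (t : ℝ) : StrictMono fun w => velocity κ ua w t := fun w w' h => by
  have := mul_lt_mul_of_pos_left h (Real.exp_pos (-∫ s in (0 : ℝ)..t, κ s))
  simp only [velocity, mul_add]
  linarith

variable (hκ : IsLocBdd κ) (hua : IsLocBdd ua)

include hκ

theorem isLocBdd_exp : IsLocBdd fun t => Real.exp (∫ s in (0 : ℝ)..t, κ s) :=
  .of_continuous (Real.continuous_exp.comp hκ.continuous_primitive)

include hua

theorem continuous_velocity : Continuous fun p : ℝ × ℝ => velocity κ ua p.1 p.2 :=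
  (Real.continuous_exp.comp (hκ.continuous_primitive.comp continuous_snd).neg).mul
    ((((hκ.mul hua).mul (isLocBdd_exp hκ)).continuous_primitive.comp continuous_snd).add
      continuous_fst)

theorem exists_momentumWeight_isGood (B : ℝ) :
    ∃ C, (momentumWeight κ ua).IsGood B C := by
  have hI := (hκ.mul hua).mul (isLocBdd_exp hκ)
  set ϖ := momentumWeight κ ua with hϖ
  have hca : Continuous ϖ.a :=
    (continuous_velocity hκ hua).comp (continuous_const.prodMk continuous_id)
  have hcb : Continuous ϖ.b := Real.continuous_exp.comp hκ.continuous_primitive.neg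
  have hsa : IsLocBdd ϖ.sa := hκ.mul (hua.sub (.of_continuous hca))
  have hsb : IsLocBdd fun t => κ t * ϖ.b t := hκ.mul (.of_continuous hcb)
  have hpair : LocallyLipschitz fun t => (∫ s in (0 : ℝ)..t, κ s,
      ∫ s in (0 : ℝ)..t, κ s * ua s * Real.exp (∫ r in (0 : ℝ)..s, κ r)) :=
    hκ.locallyLipschitz_primitive.prodMk hI.locallyLipschitz_primitive
  have hla : LocallyLipschitz ϖ.a := by
    have h : ContDiff ℝ 1 fun p : ℝ × ℝ => Real.exp (-p.1) * (p.2 + 0) := by fun_prop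
    exact h.locallyLipschitz.comp hpair
  have hlb : LocallyLipschitz ϖ.b := by
    have h : ContDiff ℝ 1 fun p : ℝ × ℝ => Real.exp (-p.1) := by fun_prop
    exact h.locallyLipschitz.comp hpair
  obtain ⟨C₁, h₁⟩ := (IsLocBdd.of_continuous hca).bdd B
  obtain ⟨C₂, h₂⟩ := (IsLocBdd.of_continuous hcb).bdd B
  obtain ⟨C₃, h₃⟩ := hsa.bdd B
  obtain ⟨C₄, h₄⟩ := hsb.bdd B
  obtain ⟨C₅, h₅⟩ := (hla.locallyLipschitzOn (s := Icc 0 B)).exists_lipschitzOnWith_of_compact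
    isCompact_Icc
  obtain ⟨C₆, h₆⟩ := (hlb.locallyLipschitzOn (s := Icc 0 B)).exists_lipschitzOnWith_of_compact
    isCompact_Icc
  set C : ℝ := |C₁| + |C₂| + |C₃| + |C₄| + C₅ + C₆ with hC
  have a₁ := le_abs_self C₁
  have a₂ := le_abs_self C₂
  have a₃ := le_abs_self C₃
  have a₄ := le_abs_self C₄
  have b₁ := abs_nonneg C₁
  have b₂ := abs_nonneg C₂
  have b₃ := abs_nonneg C₃
  have b₄ := abs_nonneg C₄
  have b₅ := C₅.coe_nonneg
  have b₆ := C₆.coe_nonneg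
  refine ⟨C, fun t ht => ?_, fun s hs t ht => ?_, ?_⟩
  · have htB : |t| ≤ B := by rw [abs_of_nonneg ht.1]; exact ht.2
    refine ⟨(h₁ t htB).trans (by linarith), (h₂ t htB).trans (by linarith),
      (h₃ t htB).trans (by linarith), ?_⟩
    have : |ϖ.sb t| = |κ t * ϖ.b t| := abs_neg _
    rw [this]
    exact (h₄ t htB).trans (by linarith)
  · have h7 := h₅.dist_le_mul t ht s hs
    have h8 := h₆.dist_le_mul t ht s hs
    rw [Real.dist_eq, Real.dist_eq] at h7 h8
    exact ⟨h7.trans (mul_le_mul_of_nonneg_right (by linarith) (abs_nonneg _)),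
      h8.trans (mul_le_mul_of_nonneg_right (by linarith) (abs_nonneg _))⟩
  · filter_upwards [hκ.ae_hasDerivAt, hI.ae_hasDerivAt] with t h1 h2 _
    have h3 := h1.neg.exp
    refine ⟨(h3.mul (h2.add_const 0)).congr_deriv ?_, h3.congr_deriv ?_⟩
    · simp only [hϖ, momentumWeight, velocity, Pi.neg_apply]
      have := Real.exp_add (-∫ s in (0 : ℝ)..t, κ s) (∫ s in (0 : ℝ)..t, κ s)
      rw [neg_add_cancel, Real.exp_zero] at this
      linear_combination -κ t * ua t * this
    · simp only [hϖ, momentumWeight, Pi.neg_apply]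
      ring

end

/-! ### Test functions -/

theorem exists_isTest {φ : ℝ × ℝ → ℝ} (hφ : ContDiff ℝ ∞ φ) (hs : HasCompactSupport φ) :
    ∃ K B M, 0 < B ∧ IsTest φ K B M := by
  have hd : ∀ v : ℝ × ℝ, ContDiff ℝ ∞ fun p => fderiv ℝ φ p v := fun v =>
    (hφ.fderiv_right (m := ∞) (by norm_num)).clm_apply contDiff_const
  have hds : ∀ v : ℝ × ℝ, HasCompactSupport fun p => fderiv ℝ φ p v := fun v =>
    hs.fderiv_apply ℝ v
  obtain ⟨r, hr⟩ := hs.isBounded.subset_closedBall 0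
  have h0 : ∀ p : ℝ × ℝ, |r| + 1 ≤ |p.1| ∨ |r| + 1 ≤ p.2 → p ∉ tsupport φ := fun p hp hmem => by
    have h1 := mem_closedBall_zero_iff.1 (hr hmem)
    rw [Prod.norm_def, max_le_iff, Real.norm_eq_abs, Real.norm_eq_abs] at h1
    have h2 := le_abs_self r
    have h3 := le_abs_self p.2
    rcases hp with hp | hp <;> linarith [h1.1, h1.2]
  obtain ⟨M₁, h₁⟩ := hs.exists_bound_of_continuous hφ.continuous
  obtain ⟨M₂, h₂⟩ := (hds (0, 1)).exists_bound_of_continuous (hd (0, 1)).continuous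
  obtain ⟨M₃, h₃⟩ := (hds (1, 0)).exists_bound_of_continuous (hd (1, 0)).continuous
  obtain ⟨M₄, h₄⟩ := hφ.lipschitzWith_of_hasCompactSupport hs (by simp)
  obtain ⟨M₅, h₅⟩ := (hd (0, 1)).lipschitzWith_of_hasCompactSupport (hds (0, 1)) (by simp)
  obtain ⟨M₆, h₆⟩ := (hd (1, 0)).lipschitzWith_of_hasCompactSupport (hds (1, 0)) (by simp)
  have a₁ := (norm_nonneg _).trans (h₁ 0)
  have a₂ := (norm_nonneg _).trans (h₂ 0)
  have a₃ := (norm_nonneg _).trans (h₃ 0)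
  have a₄ := M₄.coe_nonneg
  have a₅ := M₅.coe_nonneg
  have a₆ := M₆.coe_nonneg
  refine ⟨|r| + 1, |r| + 1, M₁ + M₂ + M₃ + M₄ + M₅ + M₆, by positivity,
    hφ.differentiable (by simp), (hd _).continuous, (hd _).continuous, fun p hp => ?_,
    fun p => ⟨(h₁ p).trans (by linarith), (h₂ p).trans (by linarith), (h₃ p).trans (by linarith)⟩,
    fun p q => ⟨(h₄.dist_le_mul p q).trans ?_, (h₅.dist_le_mul p q).trans ?_,
      (h₆.dist_le_mul p q).trans ?_⟩⟩
  · have := h0 p hp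
    rw [image_eq_zero_of_notMem_tsupport this, fderiv_of_notMem_tsupport ℝ this]
    simp
  all_goals exact mul_le_mul_of_nonneg_right (by linarith) dist_nonneg

namespace StepData

namespace Track

/-! ### Choice of the parameters -/

variable {d : StepData}

theorem _root_.DropletModel.StepData.L_mono (d : StepData) {B B' : ℝ} (h : B ≤ B') :
    d.L B ≤ d.L B' := by
  refine Real.sSup_le ?_ (d.L_nonneg B')
  rintro _ ⟨p, hp, rfl⟩
  exact d.abs_G_le (abs_le.2 hp.1) ⟨hp.2.1, hp.2.2.trans h⟩

theorem massBound_nonneg (d : StepData) {B : ℝ} (hB : 0 ≤ B) : 0 ≤ massBound d B := by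
  have := d.L_nonneg B
  have := d.Vb_pos
  rw [massBound]
  positivity

theorem massBound_mono (d : StepData) {B B' : ℝ} (hB : 0 ≤ B) (h : B ≤ B') :
    massBound d B ≤ massBound d B' := by
  have := mul_le_mul (d.L_mono h) h hB (d.L_nonneg B')
  exact mul_le_mul_of_nonneg_left (by linarith) d.Vb_pos.le

/-- The part of the bound for the defects that does not depend on the test function. -/
def trackError (d : StepData) (N : ℕ) (δ e cap B : ℝ) : ℝ :=
  (N + 1) * ((massBound d B + 2 * cap) * cap + 2 * cap + 2 * cap * d.Vb + devBound d N δ e B)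

theorem trackError_mono (d : StepData) (N : ℕ) {δ e cap B B' : ℝ} (hδ : 0 ≤ δ) (he : 0 ≤ e)
    (hcap : 0 ≤ cap) (hB : 0 ≤ B) (h : B ≤ B') :
    trackError d N δ e cap B ≤ trackError d N δ e cap B' := by
  have h1 := massBound_mono d hB h
  have h2 := d.L_mono h
  have := d.Vb_pos
  have := d.Wb_nonneg
  rw [trackError, trackError, devBound, devBound, absMass, absMass]
  gcongr

/-- For a suitable track and suitable strip widths, all error terms are at most `ε`, on the space
and time scale `1 / ε`. -/
theorem exists_accurate (d : StepData) {ε : ℝ} (hε : 0 < ε) :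
    ∃ (T : Track d) (N : ℕ) (δ e cap : ℝ), 0 < cap ∧ cap ≤ 1 ∧ cap ≤ ε ∧ 0 < δ ∧ 0 < e ∧
      T.Accurate N δ e ∧
      (∀ p, d.D p → N < p → ∀ t ∈ Icc 0 (1 / ε), 1 / ε + 1 ≤ T.c t p) ∧
      trackError d N δ e cap (1 / ε) ≤ ε := by
  set B := 1 / ε with hB
  have hB0 : 0 < B := one_div_pos.2 hε
  obtain ⟨N, hN⟩ := d.exists_Y_gt (B + 1 + d.L B * B)
  have hVb := d.Vb_pos
  have hWb := d.Wb_nonneg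
  have hL := d.L_nonneg B
  have hm := massBound_nonneg d hB0.le
  have hN0 : (0 : ℝ) < N + 1 := by positivity
  set X := 2 * (2 * d.Wb * (d.Vb * (2 * d.L B))) + 4 * massBound d B with hX
  have hX0 : 0 ≤ X := by positivity
  -- `δ = e` makes the momentum defects small, `cap ≤ q` the errors proportional to the widths
  set e := ε / (2 * (N + 1) ^ 2 * (X + 1)) with he
  have he0 : 0 < e := by positivity
  set q := ε / (2 * (N + 1) * (massBound d B + 4 + 2 * d.Vb)) with hq
  have hq0 : 0 < q := by positivity
  set cap := min (min 1 ε) q with hcap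
  have hcap0 : 0 < cap := lt_min (lt_min one_pos hε) hq0
  have hcap1 : cap ≤ 1 := (min_le_left _ _).trans (min_le_left _ _)
  obtain ⟨T, hT⟩ := exists_track d N he0 he0
  refine ⟨T, N, e, e, cap, hcap0, hcap1, (min_le_left _ _).trans (min_le_right _ _), he0, he0, hT,
    fun p hp hNp t ht => ?_, ?_⟩
  · have h1 := abs_le.1 (T.abs_c_sub_Y_le ht.1 ht.2 hp)
    have h2 := hN p hNp.le
    linarith [h1.1]
  · have h1 : (N + 1) * devBound d N e e B ≤ ε / 2 := by
      have h2 : (N + 1) * devBound d N e e B = (2 * (N + 1) ^ 2 * (X + 1)) * e / 2 * (X / (X + 1)) := by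
        rw [devBound, absMass, hX]
        field_simp
      rw [h2, he, mul_div_cancel₀ _ (by positivity)]
      exact mul_le_of_le_one_right (by positivity) ((div_le_one (by positivity)).2 (by linarith))
    have h3 : (N + 1) * ((massBound d B + 2 * cap) * cap + 2 * cap + 2 * cap * d.Vb) ≤ ε / 2 := by
      have h4 : (massBound d B + 2 * cap) * cap + 2 * cap + 2 * cap * d.Vb ≤
          (massBound d B + 4 + 2 * d.Vb) * q := by
        have h5 : cap ≤ q := min_le_right _ _
        have h6 := mul_le_mul_of_nonneg_left hcap1 hcap0.le
        have h7 : (massBound d B + 4 + 2 * d.Vb) * cap ≤ (massBound d B + 4 + 2 * d.Vb) * q :=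
          mul_le_mul_of_nonneg_left h5 (by positivity)
        linarith
      refine (mul_le_mul_of_nonneg_left h4 hN0.le).trans (le_of_eq ?_)
      rw [hq]
      field_simp
    rw [trackError, mul_add]
    linarith

end Track

end StepData

/-! ### The approximate solutions -/

open StepData StepData.Track

/-- For given data in label form, there is an approximate solution with strip widths at most `ε`
whose defects, for a test function with support in the box of size `1 / ε`, are at most `ε` times a
constant that depends only on the data bounds, the coefficients and the test function. -/
theorem exists_approx {f κ ua κ' ua' : ℝ → ℝ} (hf : Continuous f) (hfm : StrictMono f)
    (hκ : IsLocBdd κ') (hua : IsLocBdd ua') (hκ' : ∀ᵐ t, 0 ≤ t → κ' t = κ t)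
    (hua' : ∀ᵐ t, 0 ≤ t → ua' t = ua t) (d : StepData)
    (hG : ∀ ℓ t, d.G ℓ t = f (velocity κ' ua' ℓ t)) {st : ℕ → ℝ × ℝ}
    (hst : ∀ i, st i = (d.v i, d.w i)) {ε : ℝ} (hε : 0 < ε) :
    ∃ (U : ℝ × ℝ → ℝ × ℝ) (W : Set ShadowWave),
      (IsShadowWaveTracking f κ ua d.Y st W U ∧ IsOvercompressive f W U ∧ IsLocallyRegular U) ∧
      (∀ B : ℝ, ∀ w ∈ W, ∀ t : ℝ, w.Alive t → t ≤ B →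
        w.left t ≤ ε ∧ w.right t ≤ ε ∧ (w.left t + w.right t) * w.mass t ≤ massBound d B + 2) ∧
      ∀ φ K B M, 0 < B → IsTest φ K B M → K ≤ 1 / ε → B ≤ 1 / ε →
        |massDefect f U φ| ≤ fluxBound d B M 1 * B * ε ∧
        ∀ C, (momentumWeight κ' ua').IsGood B C →
          |momentumDefect f κ ua U φ| ≤ fluxBound d B M C * B * ε := by
  obtain ⟨T, N, δ, e, cap, hcap, hcap1, hcapε, hδ, he, hT, hN, herr⟩ := exists_accurate d hε
  have hV := continuous_velocity hκ hua
  have hdef : ∀ {φ K B M C} {ϖ : Weight}, 0 < B → IsTest φ K B M → K ≤ 1 / ε → B ≤ 1 / ε →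
      ϖ.IsGood B C →
      (N + 1) * stripBound d N δ e cap B M C * B ≤ fluxBound d B M C * B * ε := by
    intro φ K B M C ϖ hB hφ hK hBε hϖ
    have h1 := (trackError_mono d N hδ.le he.le hcap.le hB.le hBε).trans herr
    have h2 := mul_le_mul_of_nonneg_left h1
      (mul_nonneg (fluxBound_nonneg (d := d) hφ hϖ hB.le) hB.le)
    refine (le_of_eq ?_).trans h2
    rw [stripBound, trackError]
    ring
  have hfar : ∀ {K B : ℝ}, K ≤ 1 / ε → B ≤ 1 / ε →
      ∀ p, d.D p → N < p → ∀ t ∈ Icc 0 B, K + 1 ≤ T.c t p := fun hK hB p hp hNp t ht => by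
    have := hN p hp hNp t ⟨ht.1, ht.2.trans hB⟩
    linarith
  refine ⟨T.field hV hcap, T.waves (continuous_right hV) hcap,
    ⟨T.isShadowWaveTracking_field hV hcap hst hG
      (fun ℓ t ht => velocity_congr hκ' hua' ℓ ht) velocity_zero fun y ℓ t ht => ?_,
    T.isOvercompressive_field hV hcap hfm velocity_strictMono, T.isLocallyRegular_field hV hcap⟩,
    ?_, fun φ K B M hB hφ hK hBε => ⟨?_, fun C hC => ?_⟩⟩
  · rw [charLine, Phi]
    congr 1
    refine intervalIntegral.integral_congr fun s hs => ?_
    rw [uIcc_of_le ht] at hs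
    simp only [hG, velocity_congr hκ' hua' ℓ hs.1]
  · rintro B _ ⟨p, s, s', h, rfl⟩ t ht htB
    rw [h.alive_iff] at ht
    have h0 : 0 ≤ t := h.nonneg.trans ht.1.le
    have h1 : T.width cap p s s' t ≤ cap := (h.isWidth hcap).le_cap t
    have h2 := T.mass_le h0 htB (T.c t p)
    have h3 := h.width_mul_mass hcap ht
    refine ⟨h1.trans hcapε, h1.trans hcapε, ?_⟩
    change (T.width cap p s s' t + T.width cap p s s' t) *
      (T.mass t (T.c t p) / (2 * T.width cap p s s' t) + 1) ≤ _
    rw [← two_mul, h3, massBound]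
    linarith
  · have h := abs_defect_le hV hcap hφ (massWeight_isGood B) hT he hcap1 hB (hfar hK hBε)
      (Ψ := fun u p => fderiv ℝ φ p (0, 1) + f u * fderiv ℝ φ p (1, 0))
      ((hφ.cont_t.measurable.comp measurable_snd).add ((hf.measurable.comp measurable_fst).mul
        (hφ.cont_x.measurable.comp measurable_snd)))
      (fun ℓ x t _ => by simp [Weight.flux, Weight.A, Weight.S, massWeight, hG])
      (fun u p hp => by simp [hφ.supp p hp])
    refine le_trans (le_of_eq ?_) (h.trans (hdef hB hφ hK hBε (massWeight_isGood B)))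
    rw [massDefect]
    congr 2
    · refine setIntegral_congr_fun (measurableSet_le measurable_const measurable_snd) fun p _ => ?_
      ring
    · refine integral_congr_ae (Eventually.of_forall fun x => ?_)
      simp [field_zero, Weight.A, massWeight]
  · have h := abs_defect_le hV hcap hφ hC hT he hcap1 hB (hfar hK hBε)
      (Ψ := fun u p => u * fderiv ℝ φ p (0, 1) + u * f u * fderiv ℝ φ p (1, 0) +
        κ' p.2 * (ua' p.2 - u) * φ p)
      (((measurable_fst.mul (hφ.cont_t.measurable.comp measurable_snd)).add
        ((measurable_fst.mul (hf.measurable.comp measurable_fst)).mul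
        (hφ.cont_x.measurable.comp measurable_snd))).add
        (((hκ.meas.comp (measurable_snd.comp measurable_snd)).mul
          ((hua.meas.comp (measurable_snd.comp measurable_snd)).sub measurable_fst)).mul
          (hφ.diff.continuous.measurable.comp measurable_snd)))
      (fun ℓ x t _ => by rw [Weight.flux, momentumWeight_A, momentumWeight_S, hG]; ring)
      (fun u p hp => by simp [hφ.supp p hp])
    refine le_trans (le_of_eq ?_) (h.trans (hdef hB hφ hK hBε hC))
    rw [momentumDefect]
    congr 2
    · have hsnd := Measure.quasiMeasurePreserving_snd (μ := (volume : Measure ℝ))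
        (ν := (volume : Measure ℝ))
      refine setIntegral_congr_ae (measurableSet_le measurable_const measurable_snd) ?_
      filter_upwards [hsnd.ae hκ', hsnd.ae hua'] with p h1 h2 hp
      rw [← h1 hp, ← h2 hp]
      ring
    · refine integral_congr_ae (Eventually.of_forall fun x => ?_)
      simp only [field_zero, momentumWeight_A]
      ring

end DropletModel

end

theorem theorem1p1
    (f : ℝ → ℝ) (hf : ContDiff ℝ 1 f) (hf_mono : StrictMono f)
    (κ ua : ℝ → ℝ)
    (hκ : ∀ T : ℝ, MemLp κ ⊤ (volume.restrict (Icc 0 T)))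
    (hua : ∀ T : ℝ, MemLp ua ⊤ (volume.restrict (Icc 0 T)))
    (R v₀ u₀ : ℝ) (hv₀ : 0 < v₀)
    (v u : ℝ → ℝ)
    (hv_pos : ∀ x : ℝ, R ≤ x → 0 < v x)
    (hv_bdd : ∃ M : ℝ, ∀ x : ℝ, R ≤ x → v x ≤ M)
    (hu_cont : ContinuousOn u (Ici R))
    (hu_bdd : ∃ M : ℝ, ∀ x : ℝ, R ≤ x → |u x| ≤ M)
    (hu_ext : DropletModel.HasFinitelyManyExtrema u R)
    (C₁ C₂ α : ℝ) (hC₁ : 1 ≤ C₁) (hC₂ : 1 ≤ C₂) (hα : α ∈ Ioo (0 : ℝ) 1)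
    (ρ : ℝ → ℝ) (hρ : Tendsto ρ (𝓝[>] 0) (𝓝 0))
    (ε₀ : ℝ) (hε₀ : 0 < ε₀)
    (Y : ℝ → ℕ → ℝ)
    (hY₀ : ∀ ε ∈ Ioo 0 ε₀, Y ε 0 = R)
    (hY : ∀ ε ∈ Ioo 0 ε₀, ∀ i : ℕ,
      C₁ * ε ^ α < Y ε (i + 1) - Y ε i ∧ Y ε (i + 1) - Y ε i < C₂ * ρ ε) :
    ∃ (U : ℝ → ℝ × ℝ → ℝ × ℝ) (W : ℝ → Set DropletModel.ShadowWave),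
      (∀ ε ∈ Ioo 0 ε₀,
        DropletModel.IsShadowWaveTracking f κ ua (Y ε)
          (DropletModel.sampledState v₀ u₀ v u (Y ε)) (W ε) (U ε) ∧
        DropletModel.IsOvercompressive f (W ε) (U ε) ∧
        DropletModel.IsLocallyRegular (U ε)) ∧
      (∀ T : ℝ, ∃ C : ℝ, ∀ ε ∈ Ioo 0 ε₀, ∀ w ∈ W ε, ∀ t : ℝ, w.Alive t → t ≤ T →
        w.left t ≤ C * ε ∧ w.right t ≤ C * ε ∧ (w.left t + w.right t) * w.mass t ≤ C) ∧
      (∀ φ : ℝ × ℝ → ℝ, ContDiff ℝ ∞ φ → HasCompactSupport φ →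
        Tendsto (fun ε => DropletModel.massDefect f (U ε) φ) (𝓝[>] 0) (𝓝 0) ∧
        Tendsto (fun ε => DropletModel.momentumDefect f κ ua (U ε) φ) (𝓝[>] 0) (𝓝 0)) := by
  obtain ⟨κ', hκb, hκe⟩ := DropletModel.exists_isLocBdd hκ
  obtain ⟨ua', huab, huae⟩ := DropletModel.exists_isLocBdd hua
  obtain ⟨Mv, hMv⟩ := hv_bdd
  obtain ⟨Mu, hMu⟩ := hu_bdd
  set G : ℝ → ℝ → ℝ := fun ℓ t => f (DropletModel.velocity κ' ua' ℓ t) with hGdef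
  -- the bounds `Wb`, `Vb` and the speeds `G` do not depend on `ε`
  set Wb := max |u₀| Mu with hWb
  set Vb := max v₀ Mv with hVb
  have key : ∀ ε ∈ Ioo 0 ε₀, ∃ (U : ℝ × ℝ → ℝ × ℝ) (W : Set DropletModel.ShadowWave),
      (DropletModel.IsShadowWaveTracking f κ ua (Y ε)
          (DropletModel.sampledState v₀ u₀ v u (Y ε)) W U ∧
        DropletModel.IsOvercompressive f W U ∧ DropletModel.IsLocallyRegular U) ∧
      (∀ B : ℝ, ∀ w ∈ W, ∀ t : ℝ, w.Alive t → t ≤ B →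
        w.left t ≤ ε ∧ w.right t ≤ ε ∧ (w.left t + w.right t) * w.mass t ≤
          Vb * (2 * (DropletModel.speedBound G Wb B * B)) + 2) ∧
      ∀ φ K B M, 0 < B → DropletModel.IsTest φ K B M → K ≤ 1 / ε → B ≤ 1 / ε →
        |DropletModel.massDefect f U φ| ≤
          1 * (1 + Wb) * M * (2 + DropletModel.speedBound G Wb B) * B * ε ∧
        ∀ C, (DropletModel.momentumWeight κ' ua').IsGood B C →
          |DropletModel.momentumDefect f κ ua U φ| ≤
            C * (1 + Wb) * M * (2 + DropletModel.speedBound G Wb B) * B * ε := by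
    intro ε hε
    have hgap : 0 < C₁ * ε ^ α := mul_pos (by linarith) (Real.rpow_pos_of_pos hε.1 _)
    have hR : ∀ i, R ≤ Y ε i := fun i => by
      induction i with
      | zero => exact (hY₀ ε hε).ge
      | succ i ih => linarith [(hY ε hε i).1]
    -- a larger label means a larger velocity, hence a larger speed
    let d : DropletModel.StepData :=
      { G := G
        cont := hf.continuous.comp (DropletModel.continuous_velocity hκb huab)
        mono := fun t => hf_mono.comp (DropletModel.velocity_strictMono t)
        w := fun i => (DropletModel.sampledState v₀ u₀ v u (Y ε) i).2
        Wb := Wb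
        w_le := fun i => by
          cases i with
          | zero => exact le_max_left _ _
          | succ i => exact (hMu _ (hR _)).trans (le_max_right _ _)
        v := fun i => (DropletModel.sampledState v₀ u₀ v u (Y ε) i).1
        v_pos := fun i => by
          cases i with
          | zero => exact hv₀
          | succ i => exact hv_pos _ (hR _)
        Vb := Vb
        v_le := fun i => by
          cases i with
          | zero => exact le_max_left _ _
          | succ i => exact (hMv _ (hR _)).trans (le_max_right _ _)
        Y := Y ε
        gap := C₁ * ε ^ α
        gap_pos := hgap
        Y_gap := fun i => by linarith [(hY ε hε i).1] }
    exact DropletModel.exists_approx hf.continuous hf_mono hκb huab hκe huae d (fun _ _ => rfl)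
      (fun _ => rfl) hε.1
  choose! U W h using key
  refine ⟨U, W, fun ε hε => (h ε hε).1, fun T => ?_, fun φ hφ hφs => ?_⟩
  · set m := Vb * (2 * (DropletModel.speedBound G Wb T * T)) with hm
    refine ⟨|m| + 2, fun ε hε w hw t ht htT => ?_⟩
    obtain ⟨h1, h2, h3⟩ := (h ε hε).2.1 T w hw t ht htT
    have h4 : ε ≤ (|m| + 2) * ε := le_mul_of_one_le_left hε.1.le (by linarith [abs_nonneg m])
    exact ⟨h1.trans h4, h2.trans h4, h3.trans (by linarith [le_abs_self m])⟩
  · obtain ⟨K, B, M, hB, htest⟩ := DropletModel.exists_isTest hφ hφs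
    obtain ⟨C, hC⟩ := DropletModel.exists_momentumWeight_isGood hκb huab B
    have hinv : Tendsto (fun ε : ℝ => 1 / ε) (𝓝[>] 0) atTop := by
      simpa only [one_div] using tendsto_inv_nhdsGT_zero (𝕜 := ℝ)
    have hev : ∀ᶠ ε in 𝓝[>] (0 : ℝ), ε ∈ Ioo 0 ε₀ ∧ K ≤ 1 / ε ∧ B ≤ 1 / ε := by
      filter_upwards [Ioo_mem_nhdsGT hε₀, hinv.eventually_ge_atTop K,
        hinv.eventually_ge_atTop B] with ε h1 h2 h3 using ⟨h1, h2, h3⟩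
    have hlim : ∀ a : ℝ, Tendsto (fun ε => a * ε) (𝓝[>] 0) (𝓝 0) := fun a => by
      have : Tendsto (fun ε => a * ε) (𝓝 0) (𝓝 (a * 0)) := tendsto_id.const_mul a
      rw [mul_zero] at this
      exact this.mono_left nhdsWithin_le_nhds
    constructor
    · refine squeeze_zero_norm' ?_ (hlim (1 * (1 + Wb) * M *
        (2 + DropletModel.speedBound G Wb B) * B))
      filter_upwards [hev] with ε hε
      exact ((h ε hε.1).2.2 φ K B M hB htest hε.2.1 hε.2.2).1
    · refine squeeze_zero_norm' ?_ (hlim (C * (1 + Wb) * M *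
        (2 + DropletModel.speedBound G Wb B) * B))
      filter_upwards [hev] with ε hε
      exact ((h ε hε.1).2.2 φ K B M hB htest hε.2.1 hε.2.2).2 C hC
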